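/- Let $G=SL_2(\mathbb{R})$ act on the real projective line $\mathbb{RP}^1$ by $A\overline{x}=\overline{Ax}$, and equip $\mathbb{RP}^1$ with the rotation-invariant metric $$d(\overline{x},\overline{y})=\frac1\pi\arcsin\Bigl(\bigl(1-\bigl(\tfrac{\langle x,y\rangle}{\|x\|\|y\|}\bigr)^2\bigr)^{1/2}\Bigr),$$ with open balls $B_r(x)$. All logarithms are to base $2$ and $\|\cdot\|$ is the Euclidean operator norm. Let $\mu$ be a Borel probability measure on $G$ with $\int\log\|A\|\,d\mu(A)<\infty$, and let $G_\mu$ be the subgroup generated by $\operatorname{supp}\mu$. Assume that $G_\mu$ is unbounded and totally irreducible, i.e. that it preserves no nonempty finite subset of $\mathbb{RP}^1$. Then the Lyapunov exponent of $\mu$ exists, is finite and is positive: there is $\chi\in(0,\infty)$ such that $\frac1n\log\|X_n\cdots X_1\|\to\chi$ almost surely, where $X_1,X_2,\dots$ are i.i.d. with law $\mu$. Put $\lambda=2^\chi$. Let $\nu$ be the $\mu$-stationary probability measure on $\mathbb{RP}^1$, i.e. the push-forward of $\mu\times\nu$ under $(A,x)\mapsto Ax$ is $\nu$. Write $A\nu$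 for the push-forward of $\nu$ under $x\mapsto Ax$. Then $A\nu\ll\nu$ for $\mu$-a.e. $A$, the Furstenberg entropy $$h_F(\nu)=\int\!\!\int\log\frac{dA\nu}{d\nu}(x)\,dA\nu(x)\,d\mu(A)$$ is given by absolutely convergent integrals, and $\nu$ is exact dimensional with local dimension $h_F(\nu)/(2\log\lambda)$, that is, for $\nu$-a.e. $x$, $$\lim_{r\to0^+}\frac{\log\nu(B_r(x))}{\log r}=\frac{h_F(\nu)}{2\log\lambda}.$$ -/

import Mathlib

open MeasureTheory Filter Topology

noncomputable section

namespace FurstenbergDim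

/-- The group `G = SL₂(ℝ)`. -/
abbrev G : Type := Matrix.SpecialLinearGroup (Fin 2) ℝ

/-- The real projective line, with Mathlib's action `A • [x] = [A x]` of `SL₂(ℝ)`. -/
abbrev RP : Type := Projectivization ℝ (Fin 2 → ℝ)

/-- `SL₂(ℝ)` carries its Borel σ-algebra (for the topology induced from the matrices). -/
instance instMeasurableSpaceG : MeasurableSpace G := borel G

instance instBorelSpaceG : BorelSpace G := ⟨rfl⟩

/-- The projective line carries the quotient topology of `ℝ² ∖ {0}`. -/
instance instTopologicalSpaceRP : TopologicalSpace RP :=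
  inferInstanceAs (TopologicalSpace (Quotient (projectivizationSetoid ℝ (Fin 2 → ℝ))))

/-- The projective line carries its Borel σ-algebra. -/
instance instMeasurableSpaceRP : MeasurableSpace RP := borel RP

instance instBorelSpaceRP : BorelSpace RP := ⟨rfl⟩

/-- The quantity `π⁻¹ arcsin √(1 - (⟨x, y⟩ / (‖x‖ ‖y‖))²)` for vectors of the Euclidean plane. -/
def vecDist (x y : Fin 2 → ℝ) : ℝ :=
  Real.arcsin (√(1 - ((x ⬝ᵥ y) / (√(x ⬝ᵥ x) * √(y ⬝ᵥ y))) ^ 2)) / Real.pi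

/-- The rotation-invariant metric on the projective line for which the total length is `1`. -/
def rpDist (x y : RP) : ℝ := vecDist x.rep y.rep

lemma vecDist_smul (a b : ℝ) (ha : a ≠ 0) (hb : b ≠ 0) (x y : Fin 2 → ℝ) :
    vecDist (a • x) (b • y) = vecDist x y := by
  have h : (((a • x) ⬝ᵥ (b • y)) /
      (√((a • x) ⬝ᵥ (a • x)) * √((b • y) ⬝ᵥ (b • y)))) ^ 2
      = ((x ⬝ᵥ y) / (√(x ⬝ᵥ x) * √(y ⬝ᵥ y))) ^ 2 := by
    simp only [smul_dotProduct, dotProduct_smul, smul_eq_mul, ← mul_assoc]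
    rw [Real.sqrt_mul (mul_self_nonneg a), Real.sqrt_mul (mul_self_nonneg b),
      Real.sqrt_mul_self_eq_abs, Real.sqrt_mul_self_eq_abs]
    simp only [div_pow, mul_pow, sq_abs]
    rw [show a ^ 2 * √(x ⬝ᵥ x) ^ 2 * (b ^ 2 * √(y ⬝ᵥ y) ^ 2)
      = (b ^ 2 * a ^ 2) * (√(x ⬝ᵥ x) ^ 2 * √(y ⬝ᵥ y) ^ 2) by ring]
    exact mul_div_mul_left _ _ (show b ^ 2 * a ^ 2 ≠ 0 by positivity)
  rw [vecDist, vecDist, h]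

/-- `rpDist` may be computed with arbitrary representatives. -/
lemma rpDist_mk (x y : Fin 2 → ℝ) (hx : x ≠ 0) (hy : y ≠ 0) :
    rpDist (Projectivization.mk ℝ x hx) (Projectivization.mk ℝ y hy) = vecDist x y := by
  obtain ⟨a, ha⟩ := Projectivization.exists_smul_eq_mk_rep ℝ x hx
  obtain ⟨b, hb⟩ := Projectivization.exists_smul_eq_mk_rep ℝ y hy
  rw [rpDist, ← ha, ← hb]
  exact vecDist_smul _ _ a.ne_zero b.ne_zero x y

/-- The open ball `B_r(x)` of the projective line. -/
def rpBall (x : RP) (r : ℝ) : Set RP := {y | rpDist x y < r}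

/-- The operator norm of `A ∈ SL₂(ℝ)` on the Euclidean plane. -/
def opNorm (A : G) : ℝ :=
  ‖Matrix.toEuclideanCLM (n := Fin 2) (𝕜 := ℝ) (A : Matrix (Fin 2) (Fin 2) ℝ)‖

/-- `G_μ`: the (not necessarily closed) subgroup generated by the topological support of `μ`. -/
def generatedGroup (μ : Measure G) : Subgroup G := Subgroup.closure μ.support

/-- A subgroup of `SL₂(ℝ)` is unbounded if the norms of its elements are. -/
def IsUnbounded (H : Subgroup G) : Prop := ∀ C : ℝ, ∃ A ∈ H, C < opNorm A

/-- A subgroup of `SL₂(ℝ)` is totally irreducible if it preserves no nonempty finite subset of the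
projective line. -/
def IsTotallyIrreducible (H : Subgroup G) : Prop :=
  ∀ F : Set RP, F.Finite → F.Nonempty → ¬ ∀ A ∈ H, (fun x : RP => A • x) '' F = F

/-- `Aν`: the push-forward of `ν` under `x ↦ A x`. -/
def push (A : G) (ν : Measure RP) : Measure RP := ν.map (fun x => A • x)

/-- `ν` is `μ`-stationary: the push-forward of `μ × ν` under `(A, x) ↦ A x` is `ν`. -/
def IsStationary (μ : Measure G) (ν : Measure RP) : Prop :=
  (μ.prod ν).map (fun p : G × RP => p.1 • p.2) = ν

/-- The product `X_n ⋯ X_1`; the sequence `X_1, X_2, …` is indexed as `X 0, X 1, …`. -/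
def leftProd (X : ℕ → G) : ℕ → G
  | 0 => 1
  | n + 1 => X n * leftProd X n

/-- `χ` is the Lyapunov exponent of `μ`: for i.i.d. `X_1, X_2, …` with law `μ`,
`(1/n) log₂ ‖X_n ⋯ X_1‖ → χ` almost surely. -/
def IsLyapunovExponent (μ : Measure G) (χ : ℝ) : Prop :=
  ∀ᵐ X ∂(Measure.infinitePi fun _ : ℕ => μ),
    Tendsto (fun n : ℕ => Real.logb 2 (opNorm (leftProd X n)) / n) atTop (𝓝 χ)

/-- The inner integral `∫ log₂ (dAν/dν) dAν` of the Furstenberg entropy. -/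
def entropyAt (ν : Measure RP) (A : G) : ℝ :=
  ∫ x, Real.logb 2 ((push A ν).rnDeriv ν x).toReal ∂(push A ν)

/-- The Furstenberg entropy `h_F(ν) = ∫ ∫ log₂ (dAν/dν)(x) dAν(x) dμ(A)`. -/
def furstenbergEntropy (μ : Measure G) (ν : Measure RP) : ℝ :=
  ∫ A, entropyAt ν A ∂μ

/-- The double integral that defines the Furstenberg entropy makes sense: the density `dAν/dν`
exists for `μ`-almost every `A`, and both integrals are (absolutely) convergent. -/
def FurstenbergEntropyConverges (μ : Measure G) (ν : Measure RP) : Prop :=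
  (∀ᵐ A ∂μ, push A ν ≪ ν ∧
    Integrable (fun x => Real.logb 2 ((push A ν).rnDeriv ν x).toReal) (push A ν)) ∧
  Integrable (entropyAt ν) μ

/-- The local dimension of `ν` at `x` exists and equals `α`: all balls around `x` have positive
mass and `log ν(B_r(x)) / log r → α` as `r → 0`. -/
def HasLocalDim (ν : Measure RP) (x : RP) (α : ℝ) : Prop :=
  (∀ r : ℝ, 0 < r → 0 < ν (rpBall x r)) ∧
  Tendsto (fun r : ℝ => Real.logb 2 (ν (rpBall x r)).toReal / Real.logb 2 r) (𝓝[>] 0) (𝓝 α)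

/-- `ν` is exact dimensional with dimension `α`. -/
def HasExactDim (ν : Measure RP) (α : ℝ) : Prop := ∀ᵐ x ∂ν, HasLocalDim ν x α

end FurstenbergDim

end

/-! Let Λ be the growth rate, to base 2, of the squared norms `N2` of random products, so that χ =
Λ/2, and let h be the entropy. The mass of a small ball about a ν-typical point is computed by
pulling the ball back along a random walk and multiplying the densities met on the way.

A stationary measure ν is diffuse, since its atoms of maximal mass would form an invariant finite
set. It is not invariant, since matrices of large norm concentrate diffuse measures. The integrals
of a function against (ω_0⋯ω_{n-1})ν form a bounded martingale. Its mean square increments tend to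
0, which forces the walk out of every compact set, and along a subsequence these measures collapse
to a point mass at some Z(ω). With σ the shift, Z(ω) = ω_0 Z(σω), and Z has law ν
(`exists_boundary_map`).

Growth of norms: the upper bound is subadditivity combined with Birkhoff's theorem on blocks. The
lower bound comes from the additive cocycle log(|Ax|²/|x|²) along the points Z(σⁿω). Its mean is at
least Λ because a diffuse measure hardly sees the contracted directions. Products in the other order
are inverses of such products for the inverted law.

Dimension: let B be an arc about Z(ω) and B_k = (ω_0⋯ω_{k-1})⁻¹B, an arc about Z(σ^k ω). Then
ν(B_{k+1}) = (ω_k ν)(B_k), so ν(B) = ν(B_n) ∏_{k<n} ν(B_k)/(ω_k ν)(B_k). While the arcs stay short,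
the ratios should be near the densities at Z(σ^k ω), and Birkhoff's theorem suggests log ν(B) ≈ -nh.
A ball of radius 2^(-nΛ) stays short for about n steps, hence the dimension h/Λ. To make this
rigorous each ratio is replaced by the maximal function `Dsup` over all arcs of diameter at most δ,
a bound valid for every short arc, and δ tends to 0 under the ergodic average. The maximal
inequality holds for arbitrary measures with constant 2, because among three arcs with a common
point one is redundant (`arc_subset_union_of_common_point`). It yields logarithmic integrability of
the maximal functions.

The upper bound on masses needs only the positive part of log `Dsup` ν (Aν), whose integral has a
universal bound. Comparison with the at least linear mass of balls about typical points bounds the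
truncated entropies by Λ. This gives at once Aν ≪ ν, the convergence of h and h ≤ Λ. Since h is an
average of relative entropies and ν is not invariant, h > 0, and therefore Λ > 0.

For the lower bound on masses, a ball of radius 2^(-jt) with KΛ < t < (K+1)Λ is followed for Kj
steps with sharp density bounds and for j further steps with crude ones, after which the arc carries
at least half of the mass. The crude part is negligible as K grows. -/

noncomputable section

namespace FurstenbergDim

/-! ### The projective line -/

/-- The determinant of two plane vectors. -/
def wedge (u v : Fin 2 → ℝ) : ℝ := u 0 * v 1 - u 1 * v 0

/-- The squared Euclidean norm of a plane vector. -/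
def nsq (v : Fin 2 → ℝ) : ℝ := v 0 ^ 2 + v 1 ^ 2

lemma nsq_pos {v : Fin 2 → ℝ} (hv : v ≠ 0) : 0 < nsq v := by
  by_contra h
  apply hv
  have h0 : v 0 ^ 2 + v 1 ^ 2 ≤ 0 := not_lt.mp h
  have h1 : v 0 = 0 := by nlinarith [sq_nonneg (v 0), sq_nonneg (v 1)]
  have h2 : v 1 = 0 := by nlinarith [sq_nonneg (v 0), sq_nonneg (v 1)]
  ext i
  fin_cases i <;> simpa

lemma nsq_rep_pos (x : RP) : 0 < nsq x.rep := nsq_pos x.rep_nonzero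

lemma nsq_smul (a : ℝ) (v : Fin 2 → ℝ) : nsq (a • v) = a ^ 2 * nsq v := by
  simp [nsq]; ring

/-- The embedding `[v] ↦ v² / |v|²` of the projective line onto the unit circle. -/
def emb (x : RP) : ℂ :=
  ⟨(x.rep 0 ^ 2 - x.rep 1 ^ 2) / nsq x.rep, 2 * x.rep 0 * x.rep 1 / nsq x.rep⟩

lemma emb_mk (v : Fin 2 → ℝ) (hv : v ≠ 0) : emb (Projectivization.mk ℝ v hv) =
    ⟨(v 0 ^ 2 - v 1 ^ 2) / nsq v, 2 * v 0 * v 1 / nsq v⟩ := by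
  obtain ⟨a, ha⟩ := Projectivization.exists_smul_eq_mk_rep ℝ v hv
  have ha0 : (a : ℝ) ≠ 0 := a.ne_zero
  have hv0 := (nsq_pos hv).ne'
  rw [emb, ← ha, Units.smul_def, nsq_smul]
  simp only [Pi.smul_apply, smul_eq_mul]
  congr 1 <;> field_simp

/-- Squaring unit vectors doubles angles, so the chord between two images is twice the sine of the
angle between the lines. This expresses distance through `wedge`, which unimodular matrices
preserve. -/
lemma norm_emb_sub_sq (x y : RP) :
    ‖emb x - emb y‖ ^ 2 = 4 * wedge x.rep y.rep ^ 2 / (nsq x.rep * nsq y.rep) := by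
  have hx := (nsq_rep_pos x).ne'
  have hy := (nsq_rep_pos y).ne'
  rw [Complex.sq_norm, Complex.normSq_apply]
  simp only [emb, Complex.sub_re, Complex.sub_im]
  field_simp
  simp only [nsq, wedge]
  ring

lemma norm_emb (x : RP) : ‖emb x‖ = 1 := by
  have hx := (nsq_rep_pos x).ne'
  have : ‖emb x‖ ^ 2 = 1 := by
    rw [Complex.sq_norm, Complex.normSq_apply]
    simp only [emb]
    field_simp
    simp only [nsq]
    ring
  nlinarith [norm_nonneg (emb x)]

lemma mk_eq_mk_of_wedge {u v : Fin 2 → ℝ} (hu : u ≠ 0) (hv : v ≠ 0) (h : wedge u v = 0) :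
    Projectivization.mk ℝ u hu = Projectivization.mk ℝ v hv := by
  rw [Projectivization.mk_eq_mk_iff']
  have hn := (nsq_pos hv).ne'
  refine ⟨(u 0 * v 0 + u 1 * v 1) / nsq v, ?_⟩
  simp only [wedge] at h
  ext i
  fin_cases i
  · simp only [Pi.smul_apply, smul_eq_mul, Fin.zero_eta]
    field_simp
    simp only [nsq]
    linear_combination (-v 1) * h
  · simp only [Pi.smul_apply, smul_eq_mul, Fin.mk_one]
    field_simp
    simp only [nsq]
    linear_combination (v 0) * h

lemma emb_injective : Function.Injective emb := by
  intro x y h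
  have h1 := norm_emb_sub_sq x y
  rw [h, sub_self, norm_zero] at h1
  have hx := (nsq_rep_pos x)
  have hy := (nsq_rep_pos y)
  have h2 : wedge x.rep y.rep = 0 := by
    by_contra hne
    have : 0 < 4 * wedge x.rep y.rep ^ 2 / (nsq x.rep * nsq y.rep) := by positivity
    rw [← h1] at this
    norm_num at this
  rw [← x.mk_rep, ← y.mk_rep]
  exact mk_eq_mk_of_wedge _ _ h2

lemma continuous_mk_comp {X : Type*} [TopologicalSpace X] {f : X → Fin 2 → ℝ}
    (hf : Continuous f) (h0 : ∀ x, f x ≠ 0) :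
    Continuous fun x => (Projectivization.mk ℝ (f x) (h0 x) : RP) := by
  have h1 : Continuous (fun v : {v : Fin 2 → ℝ // v ≠ 0} =>
      (Projectivization.mk ℝ v.1 v.2 : RP)) :=
    continuous_quot_mk (X := {v : Fin 2 → ℝ // v ≠ 0})
  exact h1.comp (hf.subtype_mk h0)

lemma continuous_emb : Continuous emb := by
  have h1 : IsQuotientMap (fun v : {v : Fin 2 → ℝ // v ≠ 0} =>
      (Projectivization.mk ℝ v.1 v.2 : RP)) :=
    isQuotientMap_quot_mk (X := {v : Fin 2 → ℝ // v ≠ 0})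
  rw [h1.continuous_iff]
  have h2 : emb ∘ (fun v : {v : Fin 2 → ℝ // v ≠ 0} => (Projectivization.mk ℝ v.1 v.2 : RP)) =
      fun v => (((v.1 0 ^ 2 - v.1 1 ^ 2) / nsq v.1 : ℝ) : ℂ)
        + ((2 * v.1 0 * v.1 1 / nsq v.1 : ℝ) : ℂ) * Complex.I := by
    ext v
    simp only [Function.comp_apply, emb_mk]
    exact Complex.mk_eq_add_mul_I _ _
  rw [h2]
  have c : ∀ i, Continuous fun v : {v : Fin 2 → ℝ // v ≠ 0} => v.1 i := fun i =>
    (continuous_apply i).comp continuous_subtype_val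
  have h3 : Continuous fun v : {v : Fin 2 → ℝ // v ≠ 0} => nsq v.1 :=
    ((c 0).pow 2).add ((c 1).pow 2)
  have h4 : ∀ v : {v : Fin 2 → ℝ // v ≠ 0}, nsq v.1 ≠ 0 := fun v => (nsq_pos v.2).ne'
  exact (Complex.continuous_ofReal.comp ((((c 0).pow 2).sub ((c 1).pow 2)).div h3 h4)).add
    ((Complex.continuous_ofReal.comp (((continuous_const.mul (c 0)).mul (c 1)).div h3 h4)).mul
      continuous_const)

lemma cos_sin_ne_zero (θ : ℝ) : (![Real.cos θ, Real.sin θ] : Fin 2 → ℝ) ≠ 0 := by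
  intro h
  have h0 := congrFun h 0
  have h1 := congrFun h 1
  simp at h0 h1
  have := Real.sin_sq_add_cos_sq θ
  simp [h0, h1] at this

/-- The direction of angle `θ`. -/
def dir (θ : ℝ) : RP := Projectivization.mk ℝ ![Real.cos θ, Real.sin θ] (cos_sin_ne_zero θ)

lemma continuous_dir : Continuous dir := by
  refine continuous_mk_comp ?_ _
  refine continuous_pi fun i => ?_
  fin_cases i
  · simpa using Real.continuous_cos
  · simpa using Real.continuous_sin

lemma exists_dir_eq (x : RP) : ∃ θ ∈ Set.Icc (-Real.pi) Real.pi, dir θ = x := by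
  let z : ℂ := ⟨x.rep 0, x.rep 1⟩
  refine ⟨z.arg, ⟨(Complex.neg_pi_lt_arg z).le, Complex.arg_le_pi z⟩, ?_⟩
  rw [← x.mk_rep]
  refine mk_eq_mk_of_wedge _ _ ?_
  have hz : z ≠ 0 := by
    intro h
    apply x.rep_nonzero
    have h1 : x.rep 0 = 0 := congrArg Complex.re h
    have h2 : x.rep 1 = 0 := congrArg Complex.im h
    ext i; fin_cases i <;> simpa
  have hn : ‖z‖ ≠ 0 := norm_ne_zero_iff.mpr hz
  simp only [wedge, Matrix.cons_val_zero, Matrix.cons_val_one, Complex.cos_arg hz,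
    Complex.sin_arg, z]
  ring

instance instCompactSpaceRP : CompactSpace RP := by
  constructor
  have : (Set.univ : Set RP) = dir '' Set.Icc (-Real.pi) Real.pi := by
    ext x
    simpa using exists_dir_eq x
  rw [this]
  exact isCompact_Icc.image continuous_dir

lemma isClosedEmbedding_emb : IsClosedEmbedding emb :=
  continuous_emb.isClosedEmbedding emb_injective

/-- The chordal metric, compatible with the quotient topology. -/
instance instMetricSpaceRP : MetricSpace RP :=
  (MetricSpace.induced emb emb_injective inferInstance).replaceTopology
    isClosedEmbedding_emb.isInducing.eq_induced

lemma dist_eq_norm_emb (x y : RP) : dist x y = ‖emb x - emb y‖ := by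
  rw [← dist_eq_norm]; rfl

instance instSecondCountableTopologyRP : SecondCountableTopology RP := inferInstance

lemma dist_le_two (x y : RP) : dist x y ≤ 2 := by
  rw [dist_eq_norm_emb]
  refine (norm_sub_le _ _).trans ?_
  rw [norm_emb, norm_emb]; norm_num

lemma dist_sq_mk (u v : Fin 2 → ℝ) (hu : u ≠ 0) (hv : v ≠ 0) :
    dist (Projectivization.mk ℝ u hu : RP) (Projectivization.mk ℝ v hv) ^ 2 =
      4 * wedge u v ^ 2 / (nsq u * nsq v) := by
  have hx := (nsq_pos hu).ne'
  have hy := (nsq_pos hv).ne'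
  rw [dist_eq_norm_emb, Complex.sq_norm, Complex.normSq_apply]
  simp only [emb_mk, Complex.sub_re, Complex.sub_im]
  field_simp
  simp only [nsq, wedge]
  ring

lemma dist_dir_le (θ θ' : ℝ) : dist (dir θ) (dir θ') ≤ 2 * |θ - θ'| := by
  have h := dist_sq_mk _ _ (cos_sin_ne_zero θ) (cos_sin_ne_zero θ')
  have h1 : ∀ t : ℝ, nsq ![Real.cos t, Real.sin t] = 1 := fun t => by
    simp [nsq]
  have h2 : wedge ![Real.cos θ, Real.sin θ] ![Real.cos θ', Real.sin θ'] ^ 2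
      = Real.sin (θ - θ') ^ 2 := by
    simp only [wedge, Matrix.cons_val_zero, Matrix.cons_val_one, Real.sin_sub]
    ring
  rw [h1, h1, h2] at h
  have h3 : |Real.sin (θ - θ')| ≤ |θ - θ'| := Real.abs_sin_le_abs
  have h4 : dist (dir θ) (dir θ') ^ 2 ≤ (2 * |θ - θ'|) ^ 2 := by
    change dist (dir θ) (dir θ') ^ 2 = _ at h
    rw [h, mul_pow, ← sq_abs (Real.sin _)]
    have := pow_le_pow_left₀ (abs_nonneg _) h3 2
    linarith
  exact le_of_sq_le_sq h4 (by positivity)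

/-! ### The action of `SL₂(ℝ)` -/

/-- The matrix-vector product. -/
def app (A : G) (v : Fin 2 → ℝ) : Fin 2 → ℝ := (A : Matrix (Fin 2) (Fin 2) ℝ).mulVec v

lemma app_zero (A : G) (v : Fin 2 → ℝ) : app A v 0 = A.1 0 0 * v 0 + A.1 0 1 * v 1 := by
  simp [app, Matrix.mulVec, dotProduct, Fin.sum_univ_two]

lemma app_one (A : G) (v : Fin 2 → ℝ) : app A v 1 = A.1 1 0 * v 0 + A.1 1 1 * v 1 := by
  simp [app, Matrix.mulVec, dotProduct, Fin.sum_univ_two]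

lemma det_eq_one (A : G) : A.1 0 0 * A.1 1 1 - A.1 0 1 * A.1 1 0 = 1 := by
  have := A.2
  rwa [Matrix.det_fin_two] at this

lemma wedge_app (A : G) (u v : Fin 2 → ℝ) : wedge (app A u) (app A v) = wedge u v := by
  simp only [wedge, app_zero, app_one]
  linear_combination (u 0 * v 1 - u 1 * v 0) * det_eq_one A

lemma app_mul (A B : G) (v : Fin 2 → ℝ) : app (A * B) v = app A (app B v) := by
  rw [app, app, app, Matrix.SpecialLinearGroup.coe_mul, Matrix.mulVec_mulVec]

lemma app_ne_zero (A : G) {v : Fin 2 → ℝ} (hv : v ≠ 0) : app A v ≠ 0 :=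
  (smul_ne_zero_iff_ne A).mpr hv

lemma smul_mk_eq (A : G) (v : Fin 2 → ℝ) (hv : v ≠ 0) :
    A • (Projectivization.mk ℝ v hv : RP) =
      Projectivization.mk ℝ (app A v) (app_ne_zero A hv) := rfl

/-- `nrm2 A x = |A v|² / |v|²` for `x = [v]`. -/
def nrm2 (A : G) (x : RP) : ℝ := nsq (app A x.rep) / nsq x.rep

lemma app_smul (A : G) (a : ℝ) (v : Fin 2 → ℝ) : app A (a • v) = a • app A v := by
  simp [app, Matrix.mulVec_smul]

lemma nrm2_mk (A : G) (v : Fin 2 → ℝ) (hv : v ≠ 0) :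
    nrm2 A (Projectivization.mk ℝ v hv) = nsq (app A v) / nsq v := by
  obtain ⟨a, ha⟩ := Projectivization.exists_smul_eq_mk_rep ℝ v hv
  have ha0 : (a : ℝ) ≠ 0 := a.ne_zero
  have hv0 := (nsq_pos hv).ne'
  rw [nrm2, ← ha, Units.smul_def, nsq_smul, app_smul, nsq_smul]
  field_simp

lemma nrm2_pos (A : G) (x : RP) : 0 < nrm2 A x :=
  div_pos (nsq_pos (app_ne_zero A x.rep_nonzero)) (nsq_rep_pos x)

lemma nrm2_mul (A B : G) (x : RP) : nrm2 (A * B) x = nrm2 A (B • x) * nrm2 B x := by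
  rw [← x.mk_rep, smul_mk_eq, nrm2_mk, nrm2_mk, nrm2_mk, app_mul]
  have h1 := (nsq_pos (app_ne_zero B x.rep_nonzero)).ne'
  field_simp

lemma nrm2_one (x : RP) : nrm2 1 x = 1 := by
  have : app 1 x.rep = x.rep := by simp [app]
  rw [nrm2, this]
  exact div_self (nsq_rep_pos x).ne'

/-- The wedge is invariant, so only the lengths of the representatives change. This exact distortion
identity is the source of all contraction estimates. -/
lemma dist_smul_sq (A : G) (x y : RP) :
    dist (A • x) (A • y) ^ 2 * (nrm2 A x * nrm2 A y) = dist x y ^ 2 := by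
  rw [← x.mk_rep, ← y.mk_rep, smul_mk_eq, smul_mk_eq, dist_sq_mk, dist_sq_mk, nrm2_mk, nrm2_mk,
    wedge_app]
  have h1 := (nsq_pos (app_ne_zero A x.rep_nonzero)).ne'
  have h2 := (nsq_pos (app_ne_zero A y.rep_nonzero)).ne'
  have h3 := (nsq_rep_pos x).ne'
  have h4 := (nsq_rep_pos y).ne'
  field_simp

/-- The squared Hilbert-Schmidt norm. -/
def N2 (A : G) : ℝ := A.1 0 0 ^ 2 + A.1 0 1 ^ 2 + A.1 1 0 ^ 2 + A.1 1 1 ^ 2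

lemma two_le_N2 (A : G) : 2 ≤ N2 A := by
  have := det_eq_one A
  unfold N2
  nlinarith [sq_nonneg (A.1 0 0 - A.1 1 1), sq_nonneg (A.1 0 1 + A.1 1 0)]

lemma N2_pos (A : G) : 0 < N2 A := lt_of_lt_of_le two_pos (two_le_N2 A)

lemma N2_inv (A : G) : N2 A⁻¹ = N2 A := by
  simp only [N2, Matrix.SpecialLinearGroup.SL2_inv_expl]
  simp
  ring

lemma N2_mul_le (A B : G) : N2 (A * B) ≤ N2 A * N2 B := by
  simp only [N2, Matrix.SpecialLinearGroup.coe_mul, Matrix.mul_apply, Fin.sum_univ_two]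
  generalize A.1 0 0 = a
  generalize A.1 0 1 = b
  generalize A.1 1 0 = c
  generalize A.1 1 1 = d
  generalize B.1 0 0 = p
  generalize B.1 0 1 = q
  generalize B.1 1 0 = r
  generalize B.1 1 1 = s
  nlinarith [sq_nonneg (a * r - b * p), sq_nonneg (a * s - b * q), sq_nonneg (c * r - d * p),
    sq_nonneg (c * s - d * q)]

lemma nrm2_le_N2 (A : G) (x : RP) : nrm2 A x ≤ N2 A := by
  rw [nrm2, div_le_iff₀ (nsq_rep_pos x)]
  simp only [nsq, N2, app_zero, app_one]
  generalize A.1 0 0 = a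
  generalize A.1 0 1 = b
  generalize A.1 1 0 = c
  generalize A.1 1 1 = d
  generalize x.rep 0 = u
  generalize x.rep 1 = v
  nlinarith [sq_nonneg (a * v - b * u), sq_nonneg (c * v - d * u)]

lemma nrm2_inv_mul (A : G) (x : RP) : nrm2 A⁻¹ (A • x) * nrm2 A x = 1 := by
  rw [← nrm2_mul, inv_mul_cancel, nrm2_one]

lemma one_le_N2_mul_nrm2 (A : G) (x : RP) : 1 ≤ N2 A * nrm2 A x := by
  rw [← nrm2_inv_mul A x, ← N2_inv A]
  exact mul_le_mul_of_nonneg_right (nrm2_le_N2 _ _) (nrm2_pos A x).le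

/-- The squared lengths of the two columns of A⁻¹ add up to `N2 A`, so one of them is at least half
of it. The direction of that column is contracted by A. -/
lemma exists_contracted (A : G) : ∃ y : RP, nrm2 A y ≤ 2 / N2 A := by
  have hN := N2_pos A
  have e0 : (![1, 0] : Fin 2 → ℝ) ≠ 0 := fun h => by simpa using congrFun h 0
  have e1 : (![0, 1] : Fin 2 → ℝ) ≠ 0 := fun h => by simpa using congrFun h 1
  have key : ∀ z : RP, N2 A ≤ 2 * nrm2 A⁻¹ z → nrm2 A (A⁻¹ • z) ≤ 2 / N2 A := by
    intro z hz
    have := nrm2_inv_mul A⁻¹ z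
    rw [inv_inv] at this
    rw [le_div_iff₀ hN]
    nlinarith [nrm2_pos A (A⁻¹ • z)]
  have hs : nrm2 A⁻¹ (Projectivization.mk ℝ _ e0) + nrm2 A⁻¹ (Projectivization.mk ℝ _ e1)
      = N2 A := by
    rw [nrm2_mk, nrm2_mk, ← N2_inv A]
    simp [nsq, app_zero, app_one, N2]
    ring
  rcases le_total (nrm2 A⁻¹ (Projectivization.mk ℝ _ e0)) (nrm2 A⁻¹ (Projectivization.mk ℝ _ e1))
    with h | h
  · exact ⟨_, key (Projectivization.mk ℝ _ e1) (by linarith)⟩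
  · exact ⟨_, key (Projectivization.mk ℝ _ e0) (by linarith)⟩

/-- Directions away from a repelling direction are expanded almost as much as possible. -/
lemma exists_repelling (A : G) : ∃ y : RP, ∀ x, dist x y ^ 2 * N2 A ≤ 8 * nrm2 A x := by
  obtain ⟨y, hy⟩ := exists_contracted A
  refine ⟨y, fun x => ?_⟩
  have hN := N2_pos A
  rw [le_div_iff₀ hN] at hy
  have h1 := dist_smul_sq A x y
  have h2 : dist (A • x) (A • y) ^ 2 ≤ 4 := by
    nlinarith [dist_le_two (A • x) (A • y), dist_nonneg (x := A • x) (y := A • y)]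
  rw [← h1]
  have hx := nrm2_pos A x
  have hyp := nrm2_pos A y
  -- The constant 8 is 4 times 2: squared distances are at most 4, and y is contracted by at least 2
  -- / `N2 A`.
  calc dist (A • x) (A • y) ^ 2 * (nrm2 A x * nrm2 A y) * N2 A
      = dist (A • x) (A • y) ^ 2 * nrm2 A x * (nrm2 A y * N2 A) := by ring
    _ ≤ 4 * nrm2 A x * 2 := by gcongr
    _ = 8 * nrm2 A x := by ring

/-! ### Arcs -/

/-- The quadratic form with coefficients `Q`. -/
def qf (Q : ℝ × ℝ × ℝ) (v : Fin 2 → ℝ) : ℝ :=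
  Q.1 * v 0 ^ 2 + Q.2.1 * (v 0 * v 1) + Q.2.2 * v 1 ^ 2

lemma qf_smul (Q : ℝ × ℝ × ℝ) (a : ℝ) (v : Fin 2 → ℝ) : qf Q (a • v) = a ^ 2 * qf Q v := by
  simp [qf]; ring

/-- The quadratic form with coefficients `Q`, as a function on the projective line. -/
def nqf (Q : ℝ × ℝ × ℝ) (x : RP) : ℝ := qf Q x.rep / nsq x.rep

lemma nqf_mk (Q : ℝ × ℝ × ℝ) (v : Fin 2 → ℝ) (hv : v ≠ 0) :
    nqf Q (Projectivization.mk ℝ v hv) = qf Q v / nsq v := by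
  obtain ⟨a, ha⟩ := Projectivization.exists_smul_eq_mk_rep ℝ v hv
  have ha0 : (a : ℝ) ≠ 0 := a.ne_zero
  have hv0 := (nsq_pos hv).ne'
  rw [nqf, ← ha, Units.smul_def, nsq_smul, qf_smul]
  field_simp

lemma nqf_eq (Q : ℝ × ℝ × ℝ) (x : RP) : nqf Q x =
    Q.1 * ((1 + (emb x).re) / 2) + Q.2.1 * ((emb x).im / 2) + Q.2.2 * ((1 - (emb x).re) / 2) := by
  have hx := (nsq_rep_pos x).ne'
  simp only [nqf, emb, qf]
  field_simp
  simp only [nsq]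
  ring

lemma continuous_nqf_prod : Continuous fun p : (ℝ × ℝ × ℝ) × RP => nqf p.1 p.2 := by
  simp only [nqf_eq]
  have h : Continuous fun p : (ℝ × ℝ × ℝ) × RP => emb p.2 := continuous_emb.comp continuous_snd
  have h1 := Complex.continuous_re.comp h
  have h2 := Complex.continuous_im.comp h
  simp only [Function.comp_def] at h1 h2
  fun_prop

/-- The open arc on which the quadratic form with coefficients `Q` is positive. -/
def arc (Q : ℝ × ℝ × ℝ) : Set RP := {x | 0 < nqf Q x}

lemma continuous_nqf (Q : ℝ × ℝ × ℝ) : Continuous (nqf Q) :=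
  continuous_nqf_prod.comp (by fun_prop : Continuous fun x : RP => (Q, x))

lemma isOpen_arc (Q : ℝ × ℝ × ℝ) : IsOpen (arc Q) :=
  isOpen_lt continuous_const (continuous_nqf Q)

lemma measurableSet_arc (Q : ℝ × ℝ × ℝ) : MeasurableSet (arc Q) := (isOpen_arc Q).measurableSet

/-- The pull-back of a quadratic form. -/
def pull (A : G) (Q : ℝ × ℝ × ℝ) : ℝ × ℝ × ℝ :=
  (Q.1 * A.1 0 0 ^ 2 + Q.2.1 * (A.1 0 0 * A.1 1 0) + Q.2.2 * A.1 1 0 ^ 2,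
   2 * Q.1 * (A.1 0 0 * A.1 0 1) + Q.2.1 * (A.1 0 0 * A.1 1 1 + A.1 0 1 * A.1 1 0)
     + 2 * Q.2.2 * (A.1 1 0 * A.1 1 1),
   Q.1 * A.1 0 1 ^ 2 + Q.2.1 * (A.1 0 1 * A.1 1 1) + Q.2.2 * A.1 1 1 ^ 2)

lemma qf_pull (A : G) (Q : ℝ × ℝ × ℝ) (v : Fin 2 → ℝ) : qf (pull A Q) v = qf Q (app A v) := by
  simp only [qf, pull, app_zero, app_one]; ring

lemma nqf_pull (A : G) (Q : ℝ × ℝ × ℝ) (x : RP) : nqf (pull A Q) x = nqf Q (A • x) * nrm2 A x := by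
  rw [← x.mk_rep, smul_mk_eq, nqf_mk, nqf_mk, nrm2_mk, qf_pull]
  have h1 := (nsq_pos (app_ne_zero A x.rep_nonzero)).ne'
  field_simp

/-- Describing arcs by quadratic forms makes preimages under matrices arcs again, given by an
explicit form. It also gives every arc arbitrarily close approximations from a countable family, the
forms with rational coefficients. -/
lemma mem_arc_pull (A : G) (Q : ℝ × ℝ × ℝ) (x : RP) : x ∈ arc (pull A Q) ↔ A • x ∈ arc Q := by
  simp only [arc, Set.mem_ofPred_eq, nqf_pull]
  exact mul_pos_iff_of_pos_right (nrm2_pos A x)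

lemma nrm2_eq_nqf (A : G) (x : RP) : nrm2 A x = nqf (pull A (1, 0, 1)) x := by
  rw [nqf_pull]
  have : nqf (1, 0, 1) (A • x) = 1 := by
    rw [nqf]
    have := (nsq_rep_pos (A • x)).ne'
    rw [div_eq_one_iff_eq this]
    simp [qf, nsq]
  rw [this, one_mul]

lemma continuous_coe_G : Continuous fun A : G => (A : Matrix (Fin 2) (Fin 2) ℝ) :=
  continuous_subtype_val

lemma continuous_entry (i j : Fin 2) : Continuous fun A : G => A.1 i j :=
  continuous_coe_G.matrix_elem i j

lemma continuous_pull (Q : ℝ × ℝ × ℝ) : Continuous fun A : G => pull A Q := by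
  have h := continuous_entry
  have h00 := h 0 0
  have h01 := h 0 1
  have h10 := h 1 0
  have h11 := h 1 1
  unfold pull
  fun_prop

lemma continuous_N2 : Continuous N2 := by
  have h := continuous_entry
  have h00 := h 0 0
  have h01 := h 0 1
  have h10 := h 1 0
  have h11 := h 1 1
  unfold N2
  fun_prop

lemma continuous_nrm2 : Continuous fun p : G × RP => nrm2 p.1 p.2 := by
  simp only [nrm2_eq_nqf]
  exact continuous_nqf_prod.comp
    (((continuous_pull _).comp continuous_fst).prodMk continuous_snd)

lemma continuous_action : Continuous fun p : G × RP => p.1 • p.2 := by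
  rw [isClosedEmbedding_emb.isInducing.continuous_iff]
  have h : ∀ p : G × RP, emb (p.1 • p.2) =
      ((nqf (pull p.1 (1, 0, -1)) p.2 / nrm2 p.1 p.2 : ℝ) : ℂ)
        + ((nqf (pull p.1 (0, 2, 0)) p.2 / nrm2 p.1 p.2 : ℝ) : ℂ) * Complex.I := by
    intro p
    have h0 := (nrm2_pos p.1 p.2).ne'
    rw [nqf_pull, nqf_pull, mul_div_cancel_right₀ _ h0, mul_div_cancel_right₀ _ h0, nqf_eq, nqf_eq]
    refine Eq.trans ?_ (Complex.mk_eq_add_mul_I _ _)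
    apply Complex.ext <;> simp <;> ring
  have h2 := continuous_nrm2
  have h3 : ∀ p : G × RP, nrm2 p.1 p.2 ≠ 0 := fun p => (nrm2_pos p.1 p.2).ne'
  have h4 : ∀ Q, Continuous fun p : G × RP => nqf (pull p.1 Q) p.2 := fun Q =>
    continuous_nqf_prod.comp (((continuous_pull _).comp continuous_fst).prodMk continuous_snd)
  have h5 := (h4 (1, 0, -1)).div h2 h3
  have h6 := (h4 (0, 2, 0)).div h2 h3
  simp only [Function.comp_def, h]
  exact (Complex.continuous_ofReal.comp h5).add
    ((Complex.continuous_ofReal.comp h6).mul continuous_const)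

lemma continuous_smul_left (A : G) : Continuous fun x : RP => A • x :=
  continuous_action.comp (by fun_prop : Continuous fun x : RP => (A, x))

/-- Convexity of an upward parabola, in the form of the interpolation identity `e`. -/
lemma quadratic_nonpos_of_between {a b c s t u : ℝ} (ha : 0 < a) (hs : s ≤ t) (hu : t ≤ u)
    (h1 : a * s ^ 2 + b * s + c ≤ 0) (h2 : a * u ^ 2 + b * u + c ≤ 0) :
    a * t ^ 2 + b * t + c ≤ 0 := by
  rcases eq_or_lt_of_le (hs.trans hu) with h | h
  · have : t = s := le_antisymm (by linarith) hs
    rw [this]; exact h1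
  · have h3 : (u - s) * (a * t ^ 2 + b * t + c) ≤ 0 := by
      have e : (u - s) * (a * t ^ 2 + b * t + c) = (u - t) * (a * s ^ 2 + b * s + c)
          + (t - s) * (a * u ^ 2 + b * u + c) - a * ((u - t) * (t - s) * (u - s)) := by ring
      have p1 : (u - t) * (a * s ^ 2 + b * s + c) ≤ 0 :=
        mul_nonpos_of_nonneg_of_nonpos (by linarith) h1
      have p2 : (t - s) * (a * u ^ 2 + b * u + c) ≤ 0 :=
        mul_nonpos_of_nonneg_of_nonpos (by linarith) h2
      have p3 : 0 ≤ a * ((u - t) * (t - s) * (u - s)) :=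
        mul_nonneg ha.le (mul_nonneg (mul_nonneg (by linarith) (by linarith)) (by linarith))
      linarith
    by_contra hc
    push Not at hc
    nlinarith [mul_pos (sub_pos.mpr h) hc]

/-- The affine coordinate centred at infinity `p`. -/
def affCoord (p x : RP) : ℝ :=
  (x.rep 0 * p.rep 0 + x.rep 1 * p.rep 1) / (nsq p.rep * wedge p.rep x.rep)

/-- With p sent to infinity, the form becomes a quadratic polynomial whose leading coefficient is
its value at p. When the arc contains p this coefficient is positive, and the complement of the arc
is convex in the affine coordinate. -/
lemma exists_affine_form (p : RP) (Q : ℝ × ℝ × ℝ) : ∃ b c : ℝ, ∀ x : RP, x ≠ p →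
    (x ∈ arc Q ↔ 0 < qf Q p.rep * affCoord p x ^ 2 + b * affCoord p x + c) := by
  have hp := nsq_rep_pos p
  refine ⟨(-2 * Q.1 * (p.rep 0 * p.rep 1) + Q.2.1 * (p.rep 0 ^ 2 - p.rep 1 ^ 2)
    + 2 * Q.2.2 * (p.rep 0 * p.rep 1)) / nsq p.rep,
    (Q.1 * p.rep 1 ^ 2 - Q.2.1 * (p.rep 0 * p.rep 1) + Q.2.2 * p.rep 0 ^ 2) / nsq p.rep ^ 2,
    fun x hx => ?_⟩
  have hw : wedge p.rep x.rep ≠ 0 := by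
    intro h
    apply hx
    rw [← x.mk_rep, ← p.mk_rep]
    exact (mk_eq_mk_of_wedge _ _ h).symm
  have e : qf Q x.rep = wedge p.rep x.rep ^ 2 * (qf Q p.rep * affCoord p x ^ 2 +
      (-2 * Q.1 * (p.rep 0 * p.rep 1) + Q.2.1 * (p.rep 0 ^ 2 - p.rep 1 ^ 2)
    + 2 * Q.2.2 * (p.rep 0 * p.rep 1)) / nsq p.rep * affCoord p x +
    (Q.1 * p.rep 1 ^ 2 - Q.2.1 * (p.rep 0 * p.rep 1) + Q.2.2 * p.rep 0 ^ 2) / nsq p.rep ^ 2) := by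
    unfold affCoord
    field_simp
    simp only [qf, nsq, wedge]
    ring
  have h1 : x ∈ arc Q ↔ 0 < qf Q x.rep := by
    simp only [arc, nqf, Set.mem_ofPred_eq]
    exact div_pos_iff_of_pos_right (nsq_rep_pos x)
  rw [h1, e]
  exact mul_pos_iff_of_pos_left (by positivity)

/-- Among three arcs with a common point, one is contained in the union of the other two. -/
lemma arc_subset_union_of_common_point {Q : Fin 3 → ℝ × ℝ × ℝ} {p : RP} (hp : ∀ i, p ∈ arc (Q i)) :
    arc (Q 0) ⊆ arc (Q 1) ∪ arc (Q 2) ∨ arc (Q 1) ⊆ arc (Q 0) ∪ arc (Q 2) ∨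
      arc (Q 2) ⊆ arc (Q 0) ∪ arc (Q 1) := by
  by_contra hcon
  push Not at hcon
  obtain ⟨h0, h1, h2⟩ := hcon
  rw [Set.not_subset] at h0 h1 h2
  obtain ⟨x0, hx0, hx0'⟩ := h0
  obtain ⟨x1, hx1, hx1'⟩ := h1
  obtain ⟨x2, hx2, hx2'⟩ := h2
  simp only [Set.mem_union, not_or] at hx0' hx1' hx2'
  choose b c hbc using fun i => exists_affine_form p (Q i)
  have hq : ∀ i, 0 < qf (Q i) p.rep := fun i => by
    have := hp i
    simp only [arc, nqf, Set.mem_ofPred_eq] at this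
    exact (div_pos_iff_of_pos_right (nsq_rep_pos p)).mp this
  have n0 : x0 ≠ p := fun h => hx0'.1 (h ▸ hp 1)
  have n1 : x1 ≠ p := fun h => hx1'.1 (h ▸ hp 0)
  have n2 : x2 ≠ p := fun h => hx2'.1 (h ▸ hp 0)
  rw [hbc _ _ n0] at hx0 hx0'
  rw [hbc _ _ n1] at hx1 hx1'
  rw [hbc _ _ n2] at hx2 hx2'
  rw [hbc _ _ n0] at hx0'
  rw [hbc _ _ n1] at hx1'
  rw [hbc _ _ n2] at hx2'
  simp only [not_lt] at hx0' hx1' hx2'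
  generalize affCoord p x0 = s0 at *
  generalize affCoord p x1 = s1 at *
  generalize affCoord p x2 = s2 at *
  -- Each point lies in its own arc and outside the other two. The middle one lies between two
  -- points that miss its arc, so by convexity it misses its arc as well.
  rcases le_total s0 s1 with h01 | h01 <;> rcases le_total s1 s2 with h12 | h12 <;>
    rcases le_total s0 s2 with h02 | h02
  · exact absurd (quadratic_nonpos_of_between (hq 1) h01 h12 hx0'.1 hx2'.2) (not_le.mpr hx1)
  · exact absurd (quadratic_nonpos_of_between (hq 1) h01 h12 hx0'.1 hx2'.2) (not_le.mpr hx1)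
  · exact absurd (quadratic_nonpos_of_between (hq 2) h02 h12 hx0'.2 hx1'.2) (not_le.mpr hx2)
  · exact absurd (quadratic_nonpos_of_between (hq 0) h02 h01 hx2'.1 hx1'.1) (not_le.mpr hx0)
  · exact absurd (quadratic_nonpos_of_between (hq 0) h01 h02 hx1'.1 hx2'.1) (not_le.mpr hx0)
  · exact absurd (quadratic_nonpos_of_between (hq 2) h12 h02 hx1'.2 hx0'.2) (not_le.mpr hx2)
  · exact absurd (quadratic_nonpos_of_between (hq 1) h12 h01 hx2'.2 hx0'.1) (not_le.mpr hx1)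
  · exact absurd (quadratic_nonpos_of_between (hq 1) h12 h01 hx2'.2 hx0'.1) (not_le.mpr hx1)

/-- For fixed x, both |x|²|y|² and the squared wedge are quadratic forms in y, and the ball is where
a combination of the two is positive. -/
lemma exists_arc_eq_ball (x : RP) {r : ℝ} (hr : 0 < r) : ∃ Q, arc Q = Metric.ball x r := by
  have hx := nsq_rep_pos x
  refine ⟨(r ^ 2 * nsq x.rep - 4 * x.rep 1 ^ 2, 8 * (x.rep 0 * x.rep 1),
    r ^ 2 * nsq x.rep - 4 * x.rep 0 ^ 2), ?_⟩
  ext y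
  have hy := nsq_rep_pos y
  have hd : dist y x ^ 2 = 4 * wedge x.rep y.rep ^ 2 / (nsq x.rep * nsq y.rep) := by
    rw [dist_comm, dist_eq_norm_emb, norm_emb_sub_sq]
  have e : nqf (r ^ 2 * nsq x.rep - 4 * x.rep 1 ^ 2, 8 * (x.rep 0 * x.rep 1),
    r ^ 2 * nsq x.rep - 4 * x.rep 0 ^ 2) y = nsq x.rep * (r ^ 2 - dist y x ^ 2) := by
    rw [hd, nqf]
    field_simp
    simp only [qf, nsq, wedge]
    ring
  simp only [arc, Set.mem_ofPred_eq, e, Metric.mem_ball]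
  rw [mul_pos_iff_of_pos_left hx, sub_pos]
  exact pow_lt_pow_iff_left₀ dist_nonneg hr.le two_ne_zero

lemma rpDist_eq (x y : RP) : rpDist x y = Real.arcsin (dist x y / 2) / Real.pi := by
  have hx := nsq_rep_pos x
  have hy := nsq_rep_pos y
  have hd : dist x y ^ 2 = 4 * wedge x.rep y.rep ^ 2 / (nsq x.rep * nsq y.rep) := by
    rw [dist_eq_norm_emb, norm_emb_sub_sq]
  have hn : ∀ v : Fin 2 → ℝ, v ⬝ᵥ v = nsq v := fun v => by
    simp [dotProduct, Fin.sum_univ_two, nsq, sq]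
  have e : 1 - ((x.rep ⬝ᵥ y.rep) / (√(x.rep ⬝ᵥ x.rep) * √(y.rep ⬝ᵥ y.rep))) ^ 2
      = (dist x y / 2) ^ 2 := by
    rw [div_pow, mul_pow, hn, hn, Real.sq_sqrt hx.le, Real.sq_sqrt hy.le, div_pow, hd]
    have : x.rep ⬝ᵥ y.rep = x.rep 0 * y.rep 0 + x.rep 1 * y.rep 1 := by
      simp [dotProduct, Fin.sum_univ_two]
    rw [this]
    field_simp
    simp only [nsq, wedge]
    ring
  rw [rpDist, vecDist, e, Real.sqrt_sq (by positivity)]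

lemma rpBall_eq_ball (x : RP) {r : ℝ} (hr : 0 < r) (hr' : r ≤ 1 / 2) :
    rpBall x r = Metric.ball x (2 * Real.sin (Real.pi * r)) := by
  ext y
  have hpi := Real.pi_pos
  simp only [rpBall, Set.mem_ofPred_eq, Metric.mem_ball, rpDist_eq]
  rw [div_lt_iff₀ hpi, Real.arcsin_lt_iff_lt_sin' ⟨by nlinarith, by nlinarith⟩, dist_comm,
    div_lt_iff₀ two_pos, mul_comm r, mul_comm 2]

/-! ### The operator norm -/

lemma opNorm_sq_le_N2 (A : G) : opNorm A ^ 2 ≤ N2 A := by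
  have h : opNorm A ≤ √(N2 A) := by
    refine ContinuousLinearMap.opNorm_le_bound _ (Real.sqrt_nonneg _) fun v => ?_
    rw [EuclideanSpace.norm_eq, EuclideanSpace.norm_eq, ← Real.sqrt_mul (N2_pos A).le]
    apply Real.sqrt_le_sqrt
    simp only [Fin.sum_univ_two, Real.norm_eq_abs, sq_abs, Matrix.ofLp_toEuclideanCLM]
    have e0 := app_zero A v.ofLp
    have e1 := app_one A v.ofLp
    simp only [app] at e0 e1
    rw [e0, e1, N2]
    generalize A.1 0 0 = a
    generalize A.1 0 1 = b
    generalize A.1 1 0 = c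
    generalize A.1 1 1 = d
    generalize v.ofLp 0 = u
    generalize v.ofLp 1 = w
    nlinarith [sq_nonneg (a * w - b * u), sq_nonneg (c * w - d * u)]
  calc opNorm A ^ 2 ≤ √(N2 A) ^ 2 := pow_le_pow_left₀ (norm_nonneg _) h 2
    _ = N2 A := Real.sq_sqrt (N2_pos A).le

/-- Each column is the image of a unit vector. The Hilbert–Schmidt and operator norms thus differ by
a bounded factor and have the same growth rate. -/
lemma N2_le_opNorm_sq (A : G) : N2 A ≤ 2 * opNorm A ^ 2 := by
  have h : ∀ i : Fin 2, A.1 0 i ^ 2 + A.1 1 i ^ 2 ≤ opNorm A ^ 2 := by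
    intro i
    have h1 := ContinuousLinearMap.le_opNorm
      (Matrix.toEuclideanCLM (n := Fin 2) (𝕜 := ℝ) (A : Matrix (Fin 2) (Fin 2) ℝ))
      (PiLp.single 2 i 1)
    rw [PiLp.norm_single, norm_one, mul_one, EuclideanSpace.norm_eq] at h1
    have h2 := pow_le_pow_left₀ (Real.sqrt_nonneg _) h1 2
    rw [Real.sq_sqrt (by positivity)] at h2
    simpa [Fin.sum_univ_two, Matrix.ofLp_toEuclideanCLM, opNorm] using h2
  have h0 := h 0
  have h1 := h 1
  unfold N2
  linarith

section

/-! ### Birkhoff's ergodic theorem -/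

lemma integral_comp_measurePreserving {α β : Type*} [MeasurableSpace α] [MeasurableSpace β]
    {m : Measure α} {m' : Measure β} {T : α → β} (hT : MeasurePreserving T m m') {f : β → ℝ}
    (hf : AEStronglyMeasurable f m') : ∫ x, f (T x) ∂m = ∫ y, f y ∂m' := by
  rw [← hT.map_eq] at hf ⊢
  exact (integral_map hT.measurable.aemeasurable hf).symm

section Birkhoff

variable {α : Type*} {T : α → α} {f : α → ℝ}

/-- The running maximum of the non-trivial Birkhoff sums. -/
def runMax (T : α → α) (f : α → ℝ) : ℕ → α → ℝ
  | 0 => f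
  | n + 1 => fun x => f x + max 0 (runMax T f n (T x))

lemma runMax_succ_apply (n : ℕ) (x : α) :
    runMax T f (n + 1) x = f x + max 0 (runMax T f n (T x)) := rfl

lemma runMax_le_succ (n : ℕ) (x : α) : runMax T f n x ≤ runMax T f (n + 1) x := by
  induction n generalizing x with
  | zero => rw [runMax_succ_apply]; exact le_add_of_nonneg_right (le_max_left _ _)
  | succ n ih =>
    rw [runMax_succ_apply, runMax_succ_apply (n + 1)]
    gcongr
    exact ih _

lemma runMax_mono (x : α) : Monotone fun n => runMax T f n x :=
  monotone_nat_of_le_succ fun n => runMax_le_succ n x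

lemma birkhoffSum_le_runMax (n : ℕ) (x : α) : birkhoffSum T f (n + 1) x ≤ runMax T f n x := by
  induction n generalizing x with
  | zero => simp [birkhoffSum, runMax]
  | succ n ih =>
    rw [birkhoffSum_succ', runMax_succ_apply]
    gcongr
    exact (ih _).trans (le_max_right _ _)

variable [MeasurableSpace α] {m : Measure α}

lemma measurable_runMax (hT : Measurable T) (hf : Measurable f) (n : ℕ) :
    Measurable (runMax T f n) := by
  induction n with
  | zero => exact hf
  | succ n ih => exact hf.add (measurable_const.max (ih.comp hT))

lemma integrable_runMax [IsFiniteMeasure m] (hT : MeasurePreserving T m m) (hf : Integrable f m)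
    (n : ℕ) : Integrable (runMax T f n) m := by
  induction n with
  | zero => exact hf
  | succ n ih => exact hf.add ((integrable_zero _ _ _).sup (hT.integrable_comp_of_integrable ih))

/-- Write M_n for `runMax`. The set where M_n is unbounded is invariant, hence null or of full
measure. If it is full, then M_{n+1} - M_n∘T, which is f plus the negative part of M_n∘T, converges
to f under domination. Its integral is that of M_{n+1} - M_n ≥ 0, so the integral of f cannot be
negative. -/
lemma ae_bddAbove_birkhoffSum [IsProbabilityMeasure m] (hT : Ergodic T m) (hfm : Measurable f)
    (hf : Integrable f m) (hneg : ∫ x, f x ∂m < 0) :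
    ∀ᵐ x ∂m, ∃ C : ℝ, ∀ n, birkhoffSum T f n x ≤ C := by
  set A : Set α := {x | ∀ N : ℕ, ∃ n, (N : ℝ) < runMax T f n x} with hA
  have hAm : MeasurableSet A := by
    have : A = ⋂ N : ℕ, ⋃ n, {x | (N : ℝ) < runMax T f n x} := by ext x; simp [hA]
    rw [this]
    exact MeasurableSet.iInter fun N => MeasurableSet.iUnion fun n =>
      measurableSet_lt measurable_const (measurable_runMax hT.measurable hfm n)
  have hinv : T ⁻¹' A = A := by
    ext x
    simp only [hA, Set.mem_preimage, Set.mem_ofPred_eq]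
    constructor
    · intro h N
      obtain ⟨K, hK⟩ := exists_nat_gt (N - f x)
      obtain ⟨n, hn⟩ := h K
      refine ⟨n + 1, ?_⟩
      rw [runMax_succ_apply]
      have := le_max_right 0 (runMax T f n (T x))
      linarith
    · intro h N
      obtain ⟨K, hK⟩ := exists_nat_gt (N + f x)
      obtain ⟨n, hn⟩ := h K
      refine ⟨n, ?_⟩
      have h1 := hn.trans_le (runMax_le_succ n x)
      rw [runMax_succ_apply] at h1
      have h2 : (N : ℝ) < max 0 (runMax T f n (T x)) := by linarith
      rcases lt_max_iff.mp h2 with h3 | h3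
      · exact absurd h3 (not_lt.mpr (Nat.cast_nonneg _))
      · exact h3
  rcases hT.ae_empty_or_univ hAm hinv with h0 | h1
  · have hae : ∀ᵐ x ∂m, x ∉ A := by
      filter_upwards [h0] with x hx hxA
      exact hx.mp hxA
    filter_upwards [hae] with x hx
    simp only [hA, Set.mem_ofPred_eq, not_forall, not_exists, not_lt] at hx
    obtain ⟨N, hN⟩ := hx
    refine ⟨N, fun n => ?_⟩
    cases n with
    | zero => simp
    | succ n => exact (birkhoffSum_le_runMax n x).trans (hN n)
  · exfalso
    have hTx : ∀ᵐ x ∂m, ∀ N : ℕ, ∃ n, (N : ℝ) < runMax T f n (T x) := by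
      filter_upwards [h1] with x hx
      have h2 : x ∈ A := hx.mpr trivial
      rw [← hinv] at h2
      exact h2
    have hint := integrable_runMax hT.toMeasurePreserving hf
    have hlim : Tendsto (fun n => ∫ x, (runMax T f (n + 1) x - runMax T f n (T x)) ∂m) atTop
        (𝓝 (∫ x, f x ∂m)) := by
      refine tendsto_integral_of_dominated_convergence (fun x => |f x| + |f (T x)|)
        (fun n => ?_) ?_ (fun n => ?_) ?_
      · exact ((hint (n + 1)).sub
          (hT.toMeasurePreserving.integrable_comp_of_integrable (hint n))).aestronglyMeasurable
      · exact hf.abs.add (hT.toMeasurePreserving.integrable_comp_of_integrable hf.abs)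
      · refine ae_of_all _ fun x => ?_
        have hm : f (T x) ≤ runMax T f n (T x) := runMax_mono (T x) (Nat.zero_le n)
        rw [runMax_succ_apply, Real.norm_eq_abs, add_sub_assoc]
        refine (abs_add_le _ _).trans (add_le_add le_rfl ?_)
        rcases le_total 0 (runMax T f n (T x)) with h | h
        · rw [max_eq_right h, sub_self, abs_zero]; exact abs_nonneg _
        · rw [max_eq_left h, zero_sub, abs_neg, abs_of_nonpos h, abs_of_nonpos (hm.trans h)]
          linarith
      · filter_upwards [hTx] with x hx
        obtain ⟨n, hn⟩ := hx 0
        refine tendsto_const_nhds.congr' ?_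
        filter_upwards [eventually_ge_atTop n] with k hk
        have h2 : 0 ≤ runMax T f k (T x) := by
          have := runMax_mono (T := T) (f := f) (T x) hk
          simp only [Nat.cast_zero] at hn
          exact hn.le.trans this
        rw [runMax_succ_apply, max_eq_right h2]
        ring
    refine absurd (ge_of_tendsto' hlim fun n => ?_) (not_le.mpr hneg)
    have e1 := integral_sub (hint (n + 1))
      (hT.toMeasurePreserving.integrable_comp_of_integrable (hint n))
    simp only [Function.comp_apply] at e1
    rw [e1, integral_comp_measurePreserving hT.toMeasurePreserving (hint n).aestronglyMeasurable,
      sub_nonneg]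
    exact integral_mono (hint n) (hint (n + 1)) fun x => runMax_le_succ n x

lemma ae_birkhoffSum_le [IsProbabilityMeasure m] (hT : Ergodic T m) (hfm : Measurable f)
    (hf : Integrable f m) {c : ℝ} (hc : ∫ x, f x ∂m < c) :
    ∀ᵐ x ∂m, ∃ C : ℝ, ∀ n : ℕ, birkhoffSum T f n x ≤ C + n * c := by
  have hg : ∫ x, (f x - c) ∂m < 0 := by
    rw [integral_sub hf (integrable_const c)]
    simpa using hc
  filter_upwards [ae_bddAbove_birkhoffSum hT (hfm.sub_const c) (hf.sub (integrable_const c)) hg]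
    with x hx
  obtain ⟨C, hC⟩ := hx
  refine ⟨C, fun n => ?_⟩
  have := hC n
  simp only [birkhoffSum, Finset.sum_sub_distrib, Finset.sum_const, Finset.card_range,
    nsmul_eq_mul] at this ⊢
  linarith

lemma ae_eventually_birkhoffSum_le [IsProbabilityMeasure m] (hT : Ergodic T m) (hfm : Measurable f)
    (hf : Integrable f m) {c : ℝ} (hc : ∫ x, f x ∂m < c) :
    ∀ᵐ x ∂m, ∀ᶠ n : ℕ in atTop, birkhoffSum T f n x ≤ n * c := by
  obtain ⟨c', h1, h2⟩ := exists_between hc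
  filter_upwards [ae_birkhoffSum_le hT hfm hf h1] with x hx
  obtain ⟨C, hC⟩ := hx
  obtain ⟨N, hN⟩ := exists_nat_gt (C / (c - c'))
  filter_upwards [eventually_ge_atTop N] with n hn
  have h3 : C < n * (c - c') := by
    rw [← div_lt_iff₀ (sub_pos.mpr h2)]
    exact hN.trans_le (by exact_mod_cast hn)
  linarith [hC n]

/-- Birkhoff's pointwise ergodic theorem for ergodic transformations. -/
theorem ae_tendsto_birkhoffSum_div [IsProbabilityMeasure m] (hT : Ergodic T m)
    (hfm : Measurable f) (hf : Integrable f m) :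
    ∀ᵐ x ∂m, Tendsto (fun n : ℕ => birkhoffSum T f n x / n) atTop (𝓝 (∫ x, f x ∂m)) := by
  have h1 : ∀ᵐ x ∂m, ∀ j : ℕ, ∀ᶠ n : ℕ in atTop,
      birkhoffSum T f n x ≤ n * (∫ x, f x ∂m + 1 / ((j : ℝ) + 1)) :=
    ae_all_iff.mpr fun j => ae_eventually_birkhoffSum_le hT hfm hf
      (lt_add_of_pos_right _ (by positivity))
  have h2 : ∀ᵐ x ∂m, ∀ j : ℕ, ∀ᶠ n : ℕ in atTop,
      birkhoffSum T (fun x => - f x) n x ≤ n * (∫ x, - f x ∂m + 1 / ((j : ℝ) + 1)) :=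
    ae_all_iff.mpr fun j => ae_eventually_birkhoffSum_le hT hfm.neg hf.neg
      (lt_add_of_pos_right _ (by positivity))
  filter_upwards [h1, h2] with x hx1 hx2
  rw [Metric.tendsto_atTop']
  intro ε hε
  obtain ⟨j, hj⟩ := exists_nat_one_div_lt hε
  obtain ⟨N, hN⟩ := eventually_atTop.mp ((hx1 j).and (hx2 j))
  refine ⟨N, fun n hn => ?_⟩
  obtain ⟨e1, e2⟩ := hN n hn.le
  have hn0 : (0 : ℝ) < n := by exact_mod_cast (Nat.zero_le N).trans_lt hn
  have e3 : birkhoffSum T (fun x => - f x) n x = - birkhoffSum T f n x := by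
    simp [birkhoffSum]
  rw [e3, integral_neg] at e2
  rw [Real.dist_eq, abs_lt, lt_sub_iff_add_lt, sub_lt_iff_lt_add, lt_div_iff₀ hn0, div_lt_iff₀ hn0]
  constructor <;> nlinarith [mul_lt_mul_of_pos_left hj hn0]

/-- The term is a difference of consecutive Birkhoff sums, whose averages have the same limit. -/
lemma ae_tendsto_comp_iterate_div [IsProbabilityMeasure m] (hT : Ergodic T m)
    (hfm : Measurable f) (hf : Integrable f m) :
    ∀ᵐ x ∂m, Tendsto (fun n : ℕ => f (T^[n] x) / n) atTop (𝓝 0) := by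
  filter_upwards [ae_tendsto_birkhoffSum_div hT hfm hf] with x hx
  have h1 := (tendsto_add_atTop_iff_nat 1).mpr hx
  have h2 : Tendsto (fun n : ℕ => ((n : ℝ) + 1) / n) atTop (𝓝 1) := by
    have : Tendsto (fun n : ℕ => 1 + 1 / (n : ℝ)) atTop (𝓝 (1 + 0)) :=
      tendsto_const_nhds.add tendsto_one_div_atTop_nhds_zero_nat
    rw [add_zero] at this
    refine this.congr' ?_
    filter_upwards [eventually_gt_atTop 0] with n hn
    have : (n : ℝ) ≠ 0 := by exact_mod_cast hn.ne'
    field_simp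
    try ring
  have h3 := (h1.mul h2).sub hx
  rw [mul_one, sub_self] at h3
  refine h3.congr' ?_
  filter_upwards [eventually_gt_atTop 0] with n hn
  have : (n : ℝ) ≠ 0 := by exact_mod_cast hn.ne'
  have h4 : (n : ℝ) + 1 ≠ 0 := by positivity
  rw [birkhoffSum_succ]
  push_cast
  field_simp
  ring

end Birkhoff

/-! ### Bernoulli shifts -/

section Shift

variable {α : Type*}

/-- The left shift on sequences. -/
def shift (ω : ℕ → α) : ℕ → α := fun i => ω (i + 1)

lemma shift_iterate (n : ℕ) (ω : ℕ → α) : shift^[n] ω = fun i => ω (i + n) := by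
  induction n generalizing ω with
  | zero => rfl
  | succ n ih => rw [Function.iterate_succ_apply, ih]; rfl

/-- Prepending a letter to a sequence. -/
def consSeq (p : α × (ℕ → α)) : ℕ → α
  | 0 => p.1
  | n + 1 => p.2 n

variable [MeasurableSpace α]

lemma measurable_shift : Measurable (shift : (ℕ → α) → ℕ → α) :=
  measurable_pi_lambda _ fun i => measurable_pi_apply (i + 1)

lemma measurable_shift_iterate (n : ℕ) : Measurable (shift^[n] : (ℕ → α) → ℕ → α) :=
  measurable_shift.iterate n

variable (μ : Measure α) [IsProbabilityMeasure μ]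

lemma measurePreserving_shift :
    MeasurePreserving shift (Measure.infinitePi fun _ : ℕ => μ) (Measure.infinitePi fun _ => μ) :=
  ⟨measurable_shift, Measure.map_infinitePi_infinitePi_of_inj (P := fun _ : ℕ => μ)
    (f := fun i => i + 1) (add_left_injective 1)⟩

/-- Invariance allows replacing the set by its preimage under m * n shifts, which depends only on
coordinates from n onwards. The set is therefore a tail event, and Kolmogorov's zero-one law
applies. -/
lemma measurableSet_limsup_of_invariant {s : Set (ℕ → α)} (hs : MeasurableSet s) {m : ℕ}
    (hm : 0 < m) (hinv : shift^[m] ⁻¹' s = s) :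
    MeasurableSet[limsup (fun n => MeasurableSpace.comap (fun ω : ℕ → α => ω n) inferInstance)
      atTop] s := by
  rw [limsup_eq_iInf_iSup_of_nat]
  simp only [MeasurableSpace.measurableSet_iInf]
  intro n
  have hinv' : (shift^[m * n]) ⁻¹' s = s := by
    rw [Function.iterate_mul]
    exact (Set.preimage_iterate_eq ▸ Function.IsFixedPt.iterate (f := Set.preimage shift^[m])
      hinv n)
  rw [← hinv']
  have key : @Measurable _ _ (⨆ i ≥ n, MeasurableSpace.comap (fun ω : ℕ → α => ω i) inferInstance) _
      (shift^[m * n]) := by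
    rw [@measurable_pi_iff]
    intro i
    simp only [shift_iterate]
    have hle : n ≤ i + m * n := by nlinarith
    exact (comap_measurable (fun ω : ℕ → α => ω (i + m * n))).mono
      (le_iSup₂_of_le (i + m * n) hle le_rfl) le_rfl
  exact key hs

/-- Powers of the shift are needed because the subadditive bound applies Birkhoff's theorem to
blocks of length m. -/
lemma ergodic_shift_iterate {m : ℕ} (hm : 0 < m) :
    Ergodic (shift^[m] : (ℕ → α) → ℕ → α) (Measure.infinitePi fun _ : ℕ => μ) := by
  refine ⟨(measurePreserving_shift μ).iterate m, ⟨fun s hs hinv => ?_⟩⟩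
  have h1 : ProbabilityTheory.iIndep
      (fun n => MeasurableSpace.comap (fun ω : ℕ → α => ω n) inferInstance)
      (Measure.infinitePi fun _ : ℕ => μ) :=
    ProbabilityTheory.iIndepFun_infinitePi (P := fun _ : ℕ => μ) (X := fun _ x => x)
      (fun _ => measurable_id)
  have h2 := ProbabilityTheory.measure_zero_or_one_of_measurableSet_limsup_atTop
    (fun n => (measurable_pi_apply n).comap_le) h1 (measurableSet_limsup_of_invariant hs hm hinv)
  rw [eventuallyConst_set]
  rcases h2 with h | h
  · exact Or.inr (measure_eq_zero_iff_ae_notMem.mp h)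
  · exact Or.inl ((prob_compl_eq_zero_iff hs).mpr h)

lemma ergodic_shift : Ergodic (shift : (ℕ → α) → ℕ → α) (Measure.infinitePi fun _ : ℕ => μ) := by
  simpa using ergodic_shift_iterate μ one_pos

lemma measurable_consSeq : Measurable (consSeq : α × (ℕ → α) → ℕ → α) := by
  refine measurable_pi_lambda _ fun n => ?_
  cases n with
  | zero => exact measurable_fst
  | succ n => exact (measurable_pi_apply n).comp measurable_snd

lemma map_consSeq : (μ.prod (Measure.infinitePi fun _ : ℕ => μ)).map consSeq =
    Measure.infinitePi fun _ : ℕ => μ := by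
  classical
  refine Measure.eq_infinitePi _ fun s t ht => ?_
  obtain ⟨N, hN⟩ := s.exists_nat_subset_range
  -- The cylinder is padded with trivial conditions to a full initial segment; its length N + 1 is
  -- positive, so the first letter can be split off.
  set t' : ℕ → Set α := fun i => if i ∈ s then t i else Set.univ with ht'
  have hm : ∀ i, MeasurableSet (t' i) := fun i => by
    simp only [ht']; split_ifs
    exacts [ht i, MeasurableSet.univ]
  have e1 : Set.pi (s : Set ℕ) t = Set.pi (Finset.range (N + 1) : Set ℕ) t' := by
    ext ω
    simp only [Set.mem_pi, ht', Finset.mem_coe]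
    constructor
    · intro h i _
      split_ifs with hi
      exacts [h i hi, trivial]
    · intro h i hi
      have := h i (Finset.range_mono (Nat.le_succ N) (hN hi))
      rwa [if_pos hi] at this
  have e2 : ∏ i ∈ s, μ (t i) = ∏ i ∈ Finset.range (N + 1), μ (t' i) := by
    rw [← Finset.prod_subset (hN.trans (Finset.range_mono (Nat.le_succ N)))]
    · exact Finset.prod_congr rfl fun i hi => by simp [ht', hi]
    · intro i _ hi
      simp [ht', hi]
  rw [e1, e2, Measure.map_apply measurable_consSeq
    (MeasurableSet.pi (Finset.countable_toSet _) fun i _ => hm i), Finset.prod_range_succ']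
  have e3 : consSeq ⁻¹' (Set.pi (Finset.range (N + 1) : Set ℕ) t') =
      (t' 0) ×ˢ (Set.pi (Finset.range N : Set ℕ) fun i => t' (i + 1)) := by
    ext p
    simp only [Set.mem_preimage, Set.mem_pi, Finset.coe_range, Set.mem_Iio, Set.mem_prod]
    constructor
    · intro h
      exact ⟨h 0 (Nat.succ_pos _), fun i hi => h (i + 1) (Nat.succ_lt_succ hi)⟩
    · rintro ⟨h0, h1⟩ i hi
      cases i with
      | zero => exact h0
      | succ i => exact h1 i (Nat.lt_of_succ_lt_succ hi)
  rw [e3, Measure.prod_prod, Measure.infinitePi_pi _ (fun i _ => hm (i + 1)), mul_comm]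

lemma measurePreserving_split :
    MeasurePreserving (fun ω : ℕ → α => (ω 0, shift ω)) (Measure.infinitePi fun _ : ℕ => μ)
      (μ.prod (Measure.infinitePi fun _ : ℕ => μ)) := by
  have hm : Measurable (fun ω : ℕ → α => (ω 0, shift ω)) :=
    (measurable_pi_apply 0).prodMk measurable_shift
  refine ⟨hm, ?_⟩
  conv_lhs => rw [← map_consSeq μ]
  rw [Measure.map_map hm measurable_consSeq]
  exact Measure.map_id

end Shift

/-! ### Random products -/

instance instSecondCountableTopologyG : SecondCountableTopology G :=
  haveI : SecondCountableTopology (Matrix (Fin 2) (Fin 2) ℝ) :=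
    inferInstanceAs (SecondCountableTopology (Fin 2 → Fin 2 → ℝ))
  TopologicalSpace.Subtype.secondCountableTopology _

/-- The product `ω 0 * ω 1 * ⋯ * ω (n - 1)`. -/
def rp : ℕ → (ℕ → G) → G
  | 0, _ => 1
  | n + 1, ω => ω 0 * rp n (shift ω)

lemma rp_add (n m : ℕ) (ω : ℕ → G) : rp (n + m) ω = rp n ω * rp m (shift^[n] ω) := by
  induction n generalizing ω with
  | zero => simp [rp]
  | succ n ih =>
    rw [Nat.succ_add, rp, ih, rp, mul_assoc, Function.iterate_succ_apply]

lemma rp_one (ω : ℕ → G) : rp 1 ω = ω 0 := by simp [rp]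

lemma rp_succ (n : ℕ) (ω : ℕ → G) : rp (n + 1) ω = rp n ω * ω n := by
  rw [rp_add, rp_one, shift_iterate]
  simp

lemma measurable_rp (n : ℕ) : Measurable (rp n) := by
  induction n with
  | zero => exact measurable_const
  | succ n ih => exact (measurable_pi_apply 0).mul (ih.comp measurable_shift)

/-- The law of a sequence of independent matrices with law `μ`. -/
abbrev law (μ : Measure G) : Measure (ℕ → G) := Measure.infinitePi fun _ : ℕ => μ

/-- The `n`-fold convolution power of `μ`. -/
def convPow (μ : Measure G) (n : ℕ) : Measure G := (law μ).map (rp n)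

variable (μ : Measure G) [IsProbabilityMeasure μ]

instance instIsProbabilityMeasureConvPow (n : ℕ) : IsProbabilityMeasure (convPow μ n) :=
  Measure.isProbabilityMeasure_map (measurable_rp n).aemeasurable

lemma measurePreserving_rp_shift (n : ℕ) :
    MeasurePreserving (fun ω => (rp n ω, shift^[n] ω)) (law μ) ((convPow μ n).prod (law μ)) := by
  have hm : ∀ n, Measurable (fun ω : ℕ → G => (rp n ω, shift^[n] ω)) := fun n =>
    (measurable_rp n).prodMk (measurable_shift_iterate n)
  -- The induction runs with an unnamed first factor; the first marginal then identifies it as the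
  -- convolution power.
  suffices h : ∃ m : Measure G, IsProbabilityMeasure m ∧
      (law μ).map (fun ω => (rp n ω, shift^[n] ω)) = m.prod (law μ) by
    obtain ⟨m, hmp, h⟩ := h
    refine ⟨hm n, ?_⟩
    have : convPow μ n = m := by
      have h2 := congrArg (Measure.map Prod.fst) h
      rw [Measure.map_map measurable_fst (hm n), Measure.map_fst_prod, measure_univ, one_smul] at h2
      exact h2
    rw [this, h]
  induction n with
  | zero =>
    refine ⟨Measure.dirac 1, inferInstance, ?_⟩
    rw [Measure.dirac_prod]
    rfl
  | succ n ih =>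
    obtain ⟨m, hmp, h⟩ := ih
    have hφ : Measurable fun p : G × (G × (ℕ → G)) => (p.1 * p.2.1, p.2.2) := by fun_prop
    refine ⟨(μ.prod m).map fun p => p.1 * p.2,
      Measure.isProbabilityMeasure_map (by fun_prop), ?_⟩
    have e1 : (fun ω : ℕ → G => (rp (n + 1) ω, shift^[n + 1] ω)) =
        (fun p : G × (G × (ℕ → G)) => (p.1 * p.2.1, p.2.2)) ∘
        (Prod.map id fun ω => (rp n ω, shift^[n] ω)) ∘ fun ω => (ω 0, shift ω) := rfl
    rw [e1, ← Measure.map_map hφ ((measurable_id.prodMap (hm n)).comp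
      (measurePreserving_split μ).measurable), ← Measure.map_map (measurable_id.prodMap (hm n))
      (measurePreserving_split μ).measurable, (measurePreserving_split μ).map_eq,
      ← Measure.map_prod_map _ _ measurable_id (hm n), h, Measure.map_id]
    have e2 : (fun p : G × (G × (ℕ → G)) => (p.1 * p.2.1, p.2.2)) =
      (Prod.map (fun p : G × G => p.1 * p.2) id) ∘ MeasurableEquiv.prodAssoc.symm := rfl
    rw [e2, ← Measure.map_map (by fun_prop) (by fun_prop), 
      ((measurePreserving_prodAssoc μ m (law μ)).symm _).map_eq,
      ← Measure.map_prod_map _ _ (by fun_prop) measurable_id, Measure.map_id]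

end

section

/-! ### Stationary measures -/

lemma measurable_action : Measurable fun p : G × RP => p.1 • p.2 := continuous_action.measurable

lemma measurable_smul_left (A : G) : Measurable fun x : RP => A • x :=
  (continuous_smul_left A).measurable

lemma push_apply (A : G) (ν : Measure RP) {E : Set RP} (hE : MeasurableSet E) :
    push A ν E = ν ((fun x => A • x) ⁻¹' E) :=
  Measure.map_apply (measurable_smul_left A) hE

instance instIsProbabilityMeasurePush (A : G) (ν : Measure RP) [IsProbabilityMeasure ν] :
    IsProbabilityMeasure (push A ν) :=
  Measure.isProbabilityMeasure_map (measurable_smul_left A).aemeasurable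

lemma measurable_push_apply (ν : Measure RP) [SFinite ν] {E : Set RP} (hE : MeasurableSet E) :
    Measurable fun A : G => push A ν E := by
  simp only [push_apply _ ν hE]
  exact measurable_measure_prodMk_left (measurable_action hE)

lemma IsStationary.measurePreserving {μ : Measure G} {ν : Measure RP} (h : IsStationary μ ν) :
    MeasurePreserving (fun p : G × RP => p.1 • p.2) (μ.prod ν) ν :=
  ⟨measurable_action, h⟩

lemma IsStationary.lintegral_eq {μ : Measure G} {ν : Measure RP} [SFinite ν] (h : IsStationary μ ν)
    {f : RP → ENNReal} (hf : Measurable f) :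
    ∫⁻ A, ∫⁻ x, f (A • x) ∂ν ∂μ = ∫⁻ x, f x ∂ν := by
  rw [← h.measurePreserving.lintegral_comp hf, lintegral_prod]
  exact (hf.comp measurable_action).aemeasurable

lemma IsStationary.lintegral_push {μ : Measure G} {ν : Measure RP} [SFinite ν]
    (h : IsStationary μ ν) {E : Set RP} (hE : MeasurableSet E) :
    ∫⁻ A, push A ν E ∂μ = ν E := by
  have h1 := h.lintegral_eq (f := E.indicator 1) (measurable_one.indicator hE)
  rw [lintegral_indicator_one hE] at h1
  rw [← h1]
  refine lintegral_congr fun A => ?_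
  rw [push_apply A ν hE, ← lintegral_indicator_one (measurable_smul_left A hE)]
  rfl

lemma isStationary_of_lintegral {μ : Measure G} {ν : Measure RP} [SFinite μ] [SFinite ν]
    (h : ∀ f : RP → ENNReal, Measurable f →
      ∫⁻ A, ∫⁻ x, f (A • x) ∂ν ∂μ = ∫⁻ x, f x ∂ν) : IsStationary μ ν := by
  refine Measure.ext fun E hE => ?_
  have h1 := h (E.indicator 1) (measurable_one.indicator hE)
  rw [lintegral_indicator_one hE] at h1
  rw [← h1, ← lintegral_indicator_one hE,
    lintegral_map (measurable_one.indicator hE) measurable_action, lintegral_prod]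
  exact ((measurable_one.indicator hE).comp measurable_action).aemeasurable

section ConvPow

variable (μ : Measure G) [IsProbabilityMeasure μ]

lemma convPow_zero : convPow μ 0 = Measure.dirac 1 := by
  have : rp 0 = fun _ => (1 : G) := rfl
  rw [convPow, this, Measure.map_const]
  simp

lemma convPow_one : convPow μ 1 = μ := by
  have : rp 1 = fun ω => ω 0 := funext rp_one
  rw [convPow, this]
  exact Measure.infinitePi_map_eval (fun _ : ℕ => μ) 0

lemma convPow_add (n m : ℕ) :
    convPow μ (n + m) = ((convPow μ n).prod (convPow μ m)).map fun p => p.1 * p.2 := by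
  have e : rp (n + m) = (fun p : G × G => p.1 * p.2) ∘ (Prod.map id (rp m)) ∘
      fun ω => (rp n ω, shift^[n] ω) := funext (rp_add n m)
  have hm : Measurable (Prod.map (id : G → G) (rp m)) := measurable_id.prodMap (measurable_rp m)
  conv_lhs => rw [convPow, e]
  rw [← Measure.map_map (by fun_prop) (hm.comp (measurePreserving_rp_shift μ n).measurable),
    ← Measure.map_map hm (measurePreserving_rp_shift μ n).measurable,
    (measurePreserving_rp_shift μ n).map_eq, ← Measure.map_prod_map _ _ measurable_id
    (measurable_rp m), Measure.map_id]
  rfl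

variable {μ}

lemma IsStationary.convPow {ν : Measure RP} [SFinite ν] (h : IsStationary μ ν) (n : ℕ) :
    IsStationary (convPow μ n) ν := by
  induction n with
  | zero =>
    refine isStationary_of_lintegral fun f hf => ?_
    have hF : Measurable fun A : G => ∫⁻ x, f (A • x) ∂ν :=
      (hf.comp measurable_action).lintegral_prod_right'
    rw [convPow_zero, lintegral_dirac' _ hF]
    simp
  | succ n ih =>
    refine isStationary_of_lintegral fun f hf => ?_
    have hF : Measurable fun A : G => ∫⁻ x, f (A • x) ∂ν :=
      (hf.comp measurable_action).lintegral_prod_right'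
    have hF2 : Measurable fun p : G × G => ∫⁻ x, f ((p.1 * p.2) • x) ∂ν := hF.comp measurable_mul
    rw [convPow_add, convPow_one, lintegral_map hF measurable_mul,
      lintegral_prod _ hF2.aemeasurable]
    simp only [mul_smul]
    rw [← ih.lintegral_eq hf]
    refine lintegral_congr fun A => ?_
    exact h.lintegral_eq (f := fun x => f (A • x)) (hf.comp (measurable_smul_left A))

lemma IsStationary.integral_eq {ν : Measure RP} [IsFiniteMeasure ν] (h : IsStationary μ ν)
    {f : RP → ℝ} (hf : Continuous f) :
    ∫ A, ∫ x, f (A • x) ∂ν ∂μ = ∫ x, f x ∂ν := by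
  obtain ⟨C, hC⟩ := isCompact_univ.exists_bound_of_continuousOn hf.continuousOn
  rw [← integral_comp_measurePreserving h.measurePreserving hf.aestronglyMeasurable, integral_prod]
  exact Integrable.of_bound (hf.measurable.comp measurable_action).aestronglyMeasurable C
    (ae_of_all _ fun p => hC _ trivial)

end ConvPow

lemma continuous_integral_smul (ν : Measure RP) [IsFiniteMeasure ν] {f : RP → ℝ}
    (hf : Continuous f) : Continuous fun A : G => ∫ x, f (A • x) ∂ν := by
  obtain ⟨C, hC⟩ := isCompact_univ.exists_bound_of_continuousOn hf.continuousOn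
  refine continuous_of_dominated (bound := fun _ => C)
    (fun A => (hf.comp (continuous_smul_left A)).aestronglyMeasurable)
    (fun A => ae_of_all _ fun x => hC _ trivial) (integrable_const C)
    (ae_of_all _ fun x => ?_)
  exact hf.comp (continuous_action.comp (by fun_prop : Continuous fun A : G => (A, x)))

lemma integral_push (A : G) (ν : Measure RP) {f : RP → ℝ} (hf : Continuous f) :
    ∫ x, f x ∂(push A ν) = ∫ x, f (A • x) ∂ν :=
  integral_map (measurable_smul_left A).aemeasurable hf.aestronglyMeasurable

/-! ### Diffuseness and non-invariance of stationary measures -/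

/-- No finite nonempty set is preserved by `μ`-almost every matrix. -/
def NoFiniteInvariant (μ : Measure G) : Prop :=
  ∀ F : Set RP, F.Finite → F.Nonempty → ¬ ∀ᵐ A ∂μ, (fun x : RP => A • x) '' F = F

/-- No diffuse probability measure is preserved by `μ`-almost every matrix. -/
def NoInvariantMeasure (μ : Measure G) : Prop :=
  ∀ ν : Measure RP, IsProbabilityMeasure ν → NullSingletonClass ν → ¬ ∀ᵐ A ∂μ, push A ν = ν

/-- Atoms of maximal mass M form a finite set F. By stationarity the mass M of an atom x in F is the
μ-average of the masses of A⁻¹x, none of which exceeds M, so almost every A⁻¹ maps F into itself.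
This contradicts `NoFiniteInvariant`. -/
lemma nullSingletonClass_of_isStationary {μ : Measure G} [IsProbabilityMeasure μ] {ν : Measure RP}
    [IsProbabilityMeasure ν] (hμ : NoFiniteInvariant μ) (h : IsStationary μ ν) : NullSingletonClass ν := by
  refine ⟨fun x₀ => ?_⟩
  by_contra hx₀
  have hfin : ∀ c : ENNReal, 0 < c → {x : RP | c ≤ ν {x}}.Finite := by
    intro c hc
    refine Measure.finite_const_le_meas_of_disjoint_iUnion ν hc
      (fun x => MeasurableSet.singleton x) (fun x y hxy => Set.disjoint_singleton.mpr hxy) ?_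
    exact measure_ne_top _ _
  have hc : 0 < ν {x₀} := pos_iff_ne_zero.mpr hx₀
  obtain ⟨x₁, hx₁, hmax⟩ := Set.exists_max_image _ (fun x => ν {x}) (hfin _ hc)
    ⟨x₀, le_refl (ν {x₀})⟩
  have hmax' : ∀ x, ν {x} ≤ ν {x₁} := fun x => by
    by_cases hx : ν {x₀} ≤ ν {x}
    · exact hmax x hx
    · exact (not_le.mp hx).le.trans hx₁
  set M := ν {x₁}
  set F : Set RP := {x | M ≤ ν {x}} with hF
  have hFfin : F.Finite := hfin M (hc.trans_le hx₁)
  refine hμ F hFfin ⟨x₁, le_refl M⟩ ?_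
  have hpre : ∀ (A : G) (x : RP), (fun y : RP => A • y) ⁻¹' {x} = {A⁻¹ • x} := fun A x => by
    ext y
    simp only [Set.mem_preimage, Set.mem_singleton_iff]
    exact smul_eq_iff_eq_inv_smul A
  have hae : ∀ᵐ A ∂μ, ∀ x ∈ F, A⁻¹ • x ∈ F := by
    rw [ae_ball_iff hFfin.countable]
    intro x hx
    have h1 := h.lintegral_push (MeasurableSet.singleton x)
    have h2 : (fun A => push A ν {x}) =ᵐ[μ] fun _ => M := by
      refine ae_eq_of_ae_le_of_lintegral_le (ae_of_all _ fun A => ?_) ?_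
        aemeasurable_const ?_
      · dsimp only
        rw [push_apply _ _ (MeasurableSet.singleton x), hpre]
        exact hmax' _
      · rw [h1]; exact measure_ne_top _ _
      · rw [h1, lintegral_const, measure_univ, mul_one]; exact hx
    filter_upwards [h2] with A hA
    rw [push_apply _ _ (MeasurableSet.singleton x), hpre] at hA
    exact hA.ge
  filter_upwards [hae] with A hA
  have hsub : (fun x : RP => A⁻¹ • x) '' F ⊆ F := by
    rintro _ ⟨x, hx, rfl⟩
    exact hA x hx
  have heq : (fun x : RP => A⁻¹ • x) '' F = F := by
    refine (hFfin.subset hsub).eq_of_subset_of_encard_le hsub ?_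
    rw [(MulAction.injective (β := RP) A⁻¹).encard_image]
  conv_lhs => rw [← heq]
  rw [Set.image_image]
  simp

/-- Balls about a fixed point shrink to a point of mass zero; a Lebesgue number makes the radius
uniform. -/
lemma exists_ball_measure_le (ν : Measure RP) [IsFiniteMeasure ν] [NullSingletonClass ν] {ε : ENNReal}
    (hε : 0 < ε) : ∃ δ > 0, ∀ y, ν (Metric.ball y δ) ≤ ε := by
  have h1 : ∀ y : RP, ∃ δ > 0, ν (Metric.ball y δ) < ε := by
    intro y
    have h2 : Tendsto (fun r => ν (Metric.closedBall y r)) (𝓝[>] 0)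
        (𝓝 (ν (Metric.closedBall y 0))) := by
      have := tendsto_measure_biInter_gt (μ := ν) (s := fun r : ℝ => Metric.closedBall y r)
        (a := 0) (fun r _ => Metric.isClosed_closedBall.measurableSet.nullMeasurableSet)
        (fun i j _ hij => Metric.closedBall_subset_closedBall hij) ⟨1, one_pos, measure_ne_top _ _⟩
      have e : Metric.closedBall y 0 = ⋂ r > (0 : ℝ), Metric.closedBall y r := by
        ext z
        simp only [Metric.mem_closedBall, Set.mem_iInter]
        exact ⟨fun h r hr => h.trans (le_of_lt hr),
          fun h => le_of_forall_gt_imp_ge_of_dense fun r hr => h r hr⟩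
      rw [e]
      exact this
    rw [Metric.closedBall_zero, measure_singleton] at h2
    obtain ⟨r, hr, hr0⟩ := ((h2.eventually (gt_mem_nhds hε)).and self_mem_nhdsWithin).exists
    exact ⟨r, hr0, (measure_mono Metric.ball_subset_closedBall).trans_lt hr⟩
  choose δ hδ hν using h1
  obtain ⟨d, hd, hsub⟩ := lebesgue_number_lemma_of_metric (isCompact_univ (X := RP))
    (c := fun y => Metric.ball y (δ y)) (fun y => Metric.isOpen_ball)
    (fun y _ => Set.mem_iUnion.mpr ⟨y, Metric.mem_ball_self (hδ y)⟩)
  refine ⟨d, hd, fun y => ?_⟩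
  obtain ⟨i, hi⟩ := hsub y trivial
  exact (measure_mono hi).trans (hν i).le

/-- Most directions are expanded by a definite proportion of the norm. -/
lemma exists_measure_nrm2_lt_le (ν : Measure RP) [IsFiniteMeasure ν] [NullSingletonClass ν] {ε : ENNReal}
    (hε : 0 < ε) : ∃ κ > 0, ∀ A : G, ν {x | nrm2 A x < κ * N2 A} ≤ ε := by
  obtain ⟨δ, hδ, h⟩ := exists_ball_measure_le ν hε
  refine ⟨δ ^ 2 / 8, by positivity, fun A => ?_⟩
  obtain ⟨y, hy⟩ := exists_repelling A
  refine (measure_mono fun x hx => ?_).trans (h y)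
  simp only [Set.mem_ofPred_eq] at hx
  rw [Metric.mem_ball]
  have h1 : dist x y ^ 2 * N2 A < δ ^ 2 * N2 A := by linarith [hy x]
  exact lt_of_pow_lt_pow_left₀ 2 hδ.le (lt_of_mul_lt_mul_right h1 (N2_pos A).le)

/-- Matrices of large norm concentrate diffuse measures. -/
lemma exists_concentration (ν : Measure RP) [IsProbabilityMeasure ν] [NullSingletonClass ν] {ε : ℝ}
    (hε : 0 < ε) : ∃ R : ℝ, ∀ A : G, R ≤ N2 A →
      ∃ y : RP, ν {x | ε < dist (A • x) y} ≤ ENNReal.ofReal ε := by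
  obtain ⟨κ, hκ, h⟩ := exists_measure_nrm2_lt_le ν
    (ε := min (ENNReal.ofReal ε) (1 / 2)) (by simp [hε])
  -- Two directions expanded by at least κ `N2 A` are mapped within 2 / (κ `N2 A`) of each other,
  -- which this threshold makes at most ε. One such direction supplies the centre y.
  refine ⟨2 / (κ * ε), fun A hA => ?_⟩
  have hN := N2_pos A
  have h2 : ∃ x₀, κ * N2 A ≤ nrm2 A x₀ := by
    by_contra hcon
    push Not at hcon
    have h3 := (h A).trans (min_le_right _ _)
    have : {x | nrm2 A x < κ * N2 A} = Set.univ := Set.eq_univ_of_forall hcon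
    rw [this, measure_univ] at h3
    have h4 := (ENNReal.toReal_le_toReal (by simp) (by simp)).mpr h3
    norm_num at h4
  obtain ⟨x₀, hx₀⟩ := h2
  refine ⟨A • x₀, (measure_mono fun x hx => ?_).trans ((h A).trans (min_le_left _ _))⟩
  simp only [Set.mem_ofPred_eq] at hx ⊢
  by_contra hcon
  push Not at hcon
  have h5 := dist_smul_sq A x x₀
  have h6 : dist x x₀ ^ 2 ≤ 4 := by nlinarith [dist_le_two x x₀, dist_nonneg (x := x) (y := x₀)]
  have h7 : (κ * N2 A) ^ 2 ≤ nrm2 A x * nrm2 A x₀ := by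
    rw [sq]
    exact mul_le_mul hcon hx₀ (by positivity) (nrm2_pos A x).le
  have h8 : 2 ≤ ε * (κ * N2 A) := by
    rw [div_le_iff₀ (by positivity)] at hA
    linarith
  have h9 : ε ^ 2 < dist (A • x) (A • x₀) ^ 2 := pow_lt_pow_left₀ hx hε.le two_ne_zero
  have h10 : ε ^ 2 * (κ * N2 A) ^ 2 < 4 := by
    calc ε ^ 2 * (κ * N2 A) ^ 2 < dist (A • x) (A • x₀) ^ 2 * (κ * N2 A) ^ 2 := by gcongr
      _ ≤ dist (A • x) (A • x₀) ^ 2 * (nrm2 A x * nrm2 A x₀) := by gcongr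
      _ ≤ 4 := by rw [h5]; exact h6
  nlinarith

lemma isClosed_setOf_push_eq (ν : Measure RP) [IsProbabilityMeasure ν] :
    IsClosed {A : G | push A ν = ν} := by
  have : {A : G | push A ν = ν} = ⋂ f : BoundedContinuousFunction RP ℝ,
      {A : G | ∫ x, f (A • x) ∂ν = ∫ x, f x ∂ν} := by
    ext A
    simp only [Set.mem_ofPred_eq, Set.mem_iInter]
    constructor
    · intro h f
      rw [← integral_push A ν f.continuous, h]
    · intro h
      refine ext_of_forall_integral_eq_of_IsFiniteMeasure fun f => ?_
      rw [integral_push A ν f.continuous, h f]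
  rw [this]
  exact isClosed_iInter fun f =>
    isClosed_eq (continuous_integral_smul ν f.continuous) continuous_const

lemma push_mul (A B : G) (ν : Measure RP) : push (A * B) ν = push A (push B ν) := by
  rw [push, push, push, Measure.map_map (measurable_smul_left A) (measurable_smul_left B)]
  congr 1
  ext x
  exact mul_smul A B x

lemma push_one (ν : Measure RP) : push 1 ν = ν := by
  simp [push]

lemma push_inv_of_push_eq {A : G} {ν : Measure RP} (h : push A ν = ν) : push A⁻¹ ν = ν := by
  conv_lhs => rw [← h]
  rw [← push_mul, inv_mul_cancel, push_one]

/-- The stabilizer of ν is a closed subgroup, so it contains the generated group and hence matrices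
of arbitrarily large norm. Such a matrix concentrates most of ν in a small ball, yet it fixes ν,
which gives small balls little mass. -/
lemma noInvariantMeasure_of_isUnbounded {μ : Measure G}
    (h : IsUnbounded (generatedGroup μ)) : NoInvariantMeasure μ := by
  intro ν hν hν' hae
  have h1 : μ.support ⊆ {A : G | push A ν = ν} :=
    Measure.support_subset_of_isClosed (isClosed_setOf_push_eq ν) hae
  have h2 : ∀ A ∈ generatedGroup μ, push A ν = ν := by
    intro A hA
    refine Subgroup.closure_induction (fun x hx => h1 hx) (push_one ν) (fun A B _ _ hA hB => ?_)
      (fun A _ hA => push_inv_of_push_eq hA) hA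
    rw [push_mul, hB, hA]
  obtain ⟨δ, hδ, hb⟩ := exists_ball_measure_le ν (ε := 1 / 4) (by simp)
  obtain ⟨R, hR⟩ := exists_concentration ν (ε := min (δ / 2) (1 / 4)) (by positivity)
  obtain ⟨A, hA, hAR⟩ := h (|R| + 1)
  obtain ⟨y, hy⟩ := hR A (by
    have := opNorm_sq_le_N2 A
    nlinarith [le_abs_self R, abs_nonneg R])
  have h3 : ν {x | min (δ / 2) (1 / 4) < dist (A • x) y} ≤ 1 / 4 := by
    refine hy.trans ?_
    rw [show (1 / 4 : ENNReal) = ENNReal.ofReal (1 / 4) by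
      rw [ENNReal.ofReal_div_of_pos (by norm_num)]; simp]
    exact ENNReal.ofReal_le_ofReal (min_le_right _ _)
  have h4 : ν ((fun x => A • x) ⁻¹' Metric.ball y δ) ≤ 1 / 4 := by
    rw [← push_apply A ν Metric.isOpen_ball.measurableSet, h2 A hA]
    exact hb y
  have h5 : (Set.univ : Set RP) ⊆ {x | min (δ / 2) (1 / 4) < dist (A • x) y} ∪
      (fun x => A • x) ⁻¹' Metric.ball y δ := by
    intro x _
    by_cases hx : min (δ / 2) (1 / 4) < dist (A • x) y
    · exact Or.inl hx
    · right
      rw [Set.mem_preimage, Metric.mem_ball]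
      exact (not_lt.mp hx).trans_lt ((min_le_left _ _).trans_lt (by linarith))
  have h6 := (measure_mono h5).trans ((measure_union_le _ _).trans (add_le_add h3 h4))
  rw [measure_univ] at h6
  have h7 := (ENNReal.toReal_le_toReal (by simp) (by simp)).mpr h6
  rw [ENNReal.toReal_add (by simp) (by simp)] at h7
  norm_num at h7

/-- Mapping the finite set F into itself is a closed condition on A, so it passes to the support; by
finiteness the inclusion is an equality, which passes to the generated group. -/
lemma noFiniteInvariant_of_isTotallyIrreducible {μ : Measure G}
    (h : IsTotallyIrreducible (generatedGroup μ)) : NoFiniteInvariant μ := by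
  intro F hF hne hae
  have hcl : IsClosed {A : G | ∀ x ∈ F, A • x ∈ F} := by
    have : {A : G | ∀ x ∈ F, A • x ∈ F} = ⋂ x ∈ F, (fun A : G => A • x) ⁻¹' F := by
      ext A; simp
    rw [this]
    exact isClosed_biInter fun x _ => hF.isClosed.preimage
      (continuous_action.comp (by fun_prop : Continuous fun A : G => (A, x)))
  have h1 : μ.support ⊆ {A : G | ∀ x ∈ F, A • x ∈ F} := by
    refine Measure.support_subset_of_isClosed hcl ?_
    filter_upwards [hae] with A hA x hx
    rw [← hA]
    exact ⟨x, hx, rfl⟩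
  refine h F hF hne fun A hA => ?_
  refine Subgroup.closure_induction (p := fun A _ => (fun x : RP => A • x) '' F = F)
    (fun A hA => ?_) (by simp) (fun A B _ _ hA hB => ?_) (fun A _ hA => ?_) hA
  · refine (hF.image _).eq_of_subset_of_encard_le ?_ ?_
    · rintro _ ⟨x, hx, rfl⟩
      exact h1 hA x hx
    · rw [(MulAction.injective (β := RP) A).encard_image]
  · simp only [mul_smul]
    rw [← Set.image_image (fun x : RP => A • x) (fun x => B • x), hB, hA]
  · conv_lhs => rw [← hA]
    rw [Set.image_image]
    simp

/-! ### Existence of stationary measures -/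

/-- The averaging operator of `μ`. -/
def avg (μ : Measure G) (f : RP → ℝ) (x : RP) : ℝ := ∫ A, f (A • x) ∂μ

lemma continuous_avg (μ : Measure G) [IsFiniteMeasure μ] {f : RP → ℝ} (hf : Continuous f) :
    Continuous (avg μ f) := by
  obtain ⟨C, hC⟩ := isCompact_univ.exists_bound_of_continuousOn hf.continuousOn
  refine continuous_of_dominated (bound := fun _ => C)
    (fun x => (hf.comp (continuous_action.comp
      (by fun_prop : Continuous fun A : G => (A, x)))).aestronglyMeasurable)
    (fun A => ae_of_all _ fun x => hC _ trivial) (integrable_const C)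
    (ae_of_all _ fun A => ?_)
  exact hf.comp (continuous_smul_left A)

lemma isStationary_of_integral_avg {μ : Measure G} [IsProbabilityMeasure μ] {ν : Measure RP}
    [IsProbabilityMeasure ν]
    (h : ∀ f : BoundedContinuousFunction RP ℝ, ∫ x, avg μ f x ∂ν = ∫ x, f x ∂ν) :
    IsStationary μ ν := by
  have : IsProbabilityMeasure ((μ.prod ν).map (fun p : G × RP => p.1 • p.2)) :=
    Measure.isProbabilityMeasure_map measurable_action.aemeasurable
  refine ext_of_forall_integral_eq_of_IsFiniteMeasure fun f => ?_
  rw [integral_map measurable_action.aemeasurable f.continuous.aestronglyMeasurable,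
    integral_prod_symm, ← h f]
  · rfl
  · exact Integrable.of_bound (f.continuous.measurable.comp measurable_action).aestronglyMeasurable
      ‖f‖ (ae_of_all _ fun p => f.norm_coe_le_norm _)

/-- Krylov–Bogolyubov: take a limit, along an ultrafilter, of the Cesàro averages of the laws of g
x₀ under the convolution powers. Applying the averaging operator once more changes these averages
only by a telescoping term of order 1/n. -/
lemma exists_isStationary (μ : Measure G) [IsProbabilityMeasure μ] :
    ∃ ν : Measure RP, IsProbabilityMeasure ν ∧ IsStationary μ ν := by
  let x₀ : RP := dir 0
  have hmx : Measurable fun g : G => g • x₀ :=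
    measurable_action.comp (by fun_prop : Measurable fun g : G => (g, x₀))
  let m : ℕ → Measure RP := fun n =>
    ((n : ENNReal) + 1)⁻¹ • ∑ k ∈ Finset.range (n + 1), (convPow μ k).map fun g => g • x₀
  have hmk : ∀ k, IsProbabilityMeasure ((convPow μ k).map fun g => g • x₀) := fun k =>
    Measure.isProbabilityMeasure_map hmx.aemeasurable
  have hm : ∀ n, IsProbabilityMeasure (m n) := fun n => by
    refine ⟨?_⟩
    simp only [m, Measure.smul_apply, Measure.coe_finsetSum, Finset.sum_apply, measure_univ,
      Finset.sum_const, Finset.card_range, smul_eq_mul, nsmul_eq_mul, mul_one]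
    push_cast
    exact ENNReal.inv_mul_cancel (by simp) (by simp)
  let a : (RP → ℝ) → ℕ → ℝ := fun f k => ∫ g, f (g • x₀) ∂(convPow μ k)
  have hint : ∀ (f : RP → ℝ), Continuous f → ∀ n, ∫ x, f x ∂(m n) =
      ((n : ℝ) + 1)⁻¹ * ∑ k ∈ Finset.range (n + 1), a f k := by
    intro f hf n
    obtain ⟨C, hC⟩ := isCompact_univ.exists_bound_of_continuousOn hf.continuousOn
    rw [integral_smul_measure, integral_finsetSum_measure]
    · congr 1
      · rw [ENNReal.toReal_inv, ENNReal.toReal_add (by simp) (by simp)]; simp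
      · exact Finset.sum_congr rfl fun k _ =>
          integral_map hmx.aemeasurable hf.aestronglyMeasurable
    · intro k _
      exact Integrable.of_bound hf.aestronglyMeasurable C (ae_of_all _ fun x => hC _ trivial)
  have hstep : ∀ (f : RP → ℝ), Continuous f → ∀ k, a (avg μ f) k = a f (k + 1) := by
    intro f hf k
    obtain ⟨C, hC⟩ := isCompact_univ.exists_bound_of_continuousOn hf.continuousOn
    have hfm : Measurable fun g : G => f (g • x₀) := hf.measurable.comp hmx
    simp only [a, avg]
    rw [add_comm k 1, convPow_add, convPow_one,
      integral_map measurable_mul.aemeasurable hfm.aestronglyMeasurable, integral_prod_symm]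
    · simp only [mul_smul]
    · exact Integrable.of_bound (hfm.comp measurable_mul).aestronglyMeasurable C
        (ae_of_all _ fun x => hC _ trivial)
  let U : Ultrafilter ℕ := Ultrafilter.of atTop
  have hU : (U : Filter ℕ) ≤ atTop := Ultrafilter.of_le _
  let M : ℕ → ProbabilityMeasure RP := fun n => ⟨m n, hm n⟩
  obtain ⟨ν, -, hν⟩ := (isCompact_univ (X := ProbabilityMeasure RP)).ultrafilter_le_nhds
    (U.map M) (by simp)
  have hν' : Tendsto M U (𝓝 ν) := hν
  rw [ProbabilityMeasure.tendsto_iff_forall_integral_tendsto] at hν'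
  refine ⟨ν, inferInstance, isStationary_of_integral_avg fun f => ?_⟩
  have h1 := hν' f
  have h2 := hν' (BoundedContinuousFunction.mkOfCompact ⟨avg μ f, continuous_avg μ f.continuous⟩)
  have h3 : Tendsto (fun n : ℕ => ((n : ℝ) + 1)⁻¹ * (a f (n + 1) - a f 0)) U (𝓝 0) := by
    refine Tendsto.mono_left ?_ hU
    have hb : ∀ k, |a f k| ≤ ‖f‖ := fun k => by
      have := norm_integral_le_of_norm_le_const (μ := convPow μ k) (C := ‖f‖)
        (f := fun g => f (g • x₀)) (ae_of_all _ fun g => f.norm_coe_le_norm _)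
      simpa using this
    refine squeeze_zero_norm (a := fun n : ℕ => ((n : ℝ) + 1)⁻¹ * (2 * ‖f‖)) (fun n => ?_) ?_
    · rw [norm_mul, Real.norm_of_nonneg (by positivity : (0 : ℝ) ≤ ((n : ℝ) + 1)⁻¹),
        Real.norm_eq_abs]
      gcongr
      refine (abs_sub _ _).trans ?_
      linarith [hb (n + 1), hb 0]
    · have := tendsto_one_div_add_atTop_nhds_zero_nat (𝕜 := ℝ)
      simpa using this.mul_const (2 * ‖f‖)
  refine tendsto_nhds_unique (h2.sub h1) ?_ |> sub_eq_zero.mp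
  refine h3.congr fun n => ?_
  have e1 := hint f f.continuous n
  have e2 := hint _ (continuous_avg μ f.continuous) n
  simp only [M, ProbabilityMeasure.coe_mk, BoundedContinuousFunction.mkOfCompact_apply,
    ContinuousMap.coe_mk]
  rw [e1, e2, ← mul_sub]
  congr 1
  simp only [hstep f f.continuous]
  rw [← Finset.sum_sub_distrib, Finset.sum_range_sub]

end

section

/-! ### Convergence to the boundary -/

/-- The integral of `f` against the push-forward `gν`. -/
def bar (ν : Measure RP) (f : RP → ℝ) (g : G) : ℝ := ∫ x, f (g • x) ∂ν

lemma exists_abs_le {f : RP → ℝ} (hf : Continuous f) : ∃ C, 0 ≤ C ∧ ∀ x, |f x| ≤ C := by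
  obtain ⟨C, hC⟩ := isCompact_univ.exists_bound_of_continuousOn hf.continuousOn
  exact ⟨C, (norm_nonneg _).trans (hC (dir 0) trivial), fun x => hC x trivial⟩

/-- The mean square displacement of `∫ f d(gν)` in one step. -/
def oneStep (μ : Measure G) (ν : Measure RP) (f : RP → ℝ) (g : G) : ℝ :=
  ∫ A, (bar ν f (g * A) - bar ν f g) ^ 2 ∂μ

lemma oneStep_nonneg {μ : Measure G} {ν : Measure RP} {f : RP → ℝ} (g : G) :
    0 ≤ oneStep μ ν f g := integral_nonneg fun _ => sq_nonneg _

section Bar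

variable {μ : Measure G} [IsProbabilityMeasure μ] {ν : Measure RP} [IsProbabilityMeasure ν]
  {f : RP → ℝ}

lemma continuous_bar (hf : Continuous f) : Continuous (bar ν f) := continuous_integral_smul ν hf

lemma abs_bar_le {C : ℝ} (hC : ∀ x, |f x| ≤ C) (g : G) : |bar ν f g| ≤ C := by
  have := norm_integral_le_of_norm_le_const (μ := ν) (C := C) (f := fun x => f (g • x))
    (ae_of_all _ fun x => hC _)
  simpa [bar] using this

lemma integrable_of_continuous_of_abs_le {X : Type*} [TopologicalSpace X]
    [MeasurableSpace X] [OpensMeasurableSpace X] {m : Measure X} [IsFiniteMeasure m] {F : X → ℝ}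
    {C : ℝ} (hF : Continuous F) (hC : ∀ x, |F x| ≤ C) : Integrable F m :=
  Integrable.of_bound hF.measurable.aestronglyMeasurable C (ae_of_all _ hC)

lemma integral_bar_mul {m : Measure G} [IsProbabilityMeasure m] (h : IsStationary m ν)
    (hf : Continuous f) (g : G) : ∫ A, bar ν f (g * A) ∂m = bar ν f g := by
  simp only [bar, mul_smul]
  exact h.integral_eq (f := fun x => f (g • x)) (hf.comp (continuous_smul_left g))

/-- Stationarity makes `bar ν f` a martingale along the walk, so the cross term cancels. -/
lemma integral_bar_sub_sq {m : Measure G} [IsProbabilityMeasure m] (h : IsStationary m ν)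
    (hf : Continuous f) (g : G) :
    ∫ A, (bar ν f (g * A) - bar ν f g) ^ 2 ∂m = ∫ A, bar ν f (g * A) ^ 2 ∂m - bar ν f g ^ 2 := by
  obtain ⟨C, hC0, hC⟩ := exists_abs_le hf
  have hc : Continuous fun A => bar ν f (g * A) := (continuous_bar hf).comp (by fun_prop)
  have i1 : Integrable (fun A => bar ν f (g * A)) m :=
    integrable_of_continuous_of_abs_le hc fun A => abs_bar_le hC _
  have i2 : Integrable (fun A => bar ν f (g * A) ^ 2) m :=
    integrable_of_continuous_of_abs_le (C := C ^ 2) (hc.pow 2) fun A => by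
      rw [abs_pow]; exact pow_le_pow_left₀ (abs_nonneg _) (abs_bar_le hC _) 2
  have e : ∀ A, (bar ν f (g * A) - bar ν f g) ^ 2 =
      bar ν f (g * A) ^ 2 - 2 * bar ν f g * bar ν f (g * A) + bar ν f g ^ 2 := fun A => by ring
  have i3 : Integrable (fun A => bar ν f (g * A) ^ 2 - 2 * bar ν f g * bar ν f (g * A)) m :=
    i2.sub (i1.const_mul _)
  simp only [e]
  rw [integral_add i3 (integrable_const _), integral_sub i2 (i1.const_mul _),
    integral_const_mul, integral_bar_mul h hf]
  simp
  ring

/-- The second moment of `∫ f d(gν)` under the `n`-th convolution power. -/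
def secondMoment (μ : Measure G) (ν : Measure RP) (f : RP → ℝ) (n : ℕ) : ℝ :=
  ∫ g, bar ν f g ^ 2 ∂(convPow μ n)

lemma integrable_bar_sq (hf : Continuous f) {m : Measure G} [IsProbabilityMeasure m] :
    Integrable (fun g => bar ν f g ^ 2) m := by
  obtain ⟨C, hC0, hC⟩ := exists_abs_le hf
  exact integrable_of_continuous_of_abs_le (C := C ^ 2) ((continuous_bar hf).pow 2) fun A => by
      rw [abs_pow]; exact pow_le_pow_left₀ (abs_nonneg _) (abs_bar_le hC _) 2

/-- Orthogonality of martingale increments. The second moments are thus bounded and increasing, and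
their successive differences tend to 0. -/
lemma integral_integral_bar_sub_sq (h : IsStationary μ ν) (hf : Continuous f) (n m : ℕ) :
    ∫ g, ∫ A, (bar ν f (g * A) - bar ν f g) ^ 2 ∂(convPow μ m) ∂(convPow μ n) =
      secondMoment μ ν f (n + m) - secondMoment μ ν f n := by
  have i1 : Integrable (fun p : G × G => bar ν f (p.1 * p.2) ^ 2)
      ((convPow μ n).prod (convPow μ m)) := by
    obtain ⟨C, hC0, hC⟩ := exists_abs_le hf
    refine integrable_of_continuous_of_abs_le (C := C ^ 2)
      (((continuous_bar hf).comp continuous_mul).pow 2) fun A => ?_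
    rw [abs_pow]; exact pow_le_pow_left₀ (abs_nonneg _) (abs_bar_le hC _) 2
  have hm : AEStronglyMeasurable (fun g => bar ν f g ^ 2)
      (((convPow μ n).prod (convPow μ m)).map fun p => p.1 * p.2) :=
    ((continuous_bar hf).pow 2).measurable.aestronglyMeasurable
  simp only [integral_bar_sub_sq (h.convPow m) hf]
  rw [integral_sub i1.integral_prod_left (integrable_bar_sq hf), secondMoment, secondMoment,
    convPow_add, integral_map measurable_mul.aemeasurable hm, integral_prod _ i1]

lemma secondMoment_mono (h : IsStationary μ ν) (hf : Continuous f) :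
    Monotone (secondMoment μ ν f) := by
  refine monotone_nat_of_le_succ fun n => ?_
  rw [← sub_nonneg, ← integral_integral_bar_sub_sq h hf]
  exact integral_nonneg fun g => integral_nonneg fun A => sq_nonneg _

lemma secondMoment_le {C : ℝ} (hf : Continuous f) (hC : ∀ x, |f x| ≤ C) (n : ℕ) :
    secondMoment μ ν f n ≤ C ^ 2 := by
  have : ∫ g, bar ν f g ^ 2 ∂(convPow μ n) ≤ ∫ _, C ^ 2 ∂(convPow μ n) :=
    integral_mono (integrable_bar_sq hf) (integrable_const _) fun g => by
      dsimp only
      rw [← sq_abs]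
      exact pow_le_pow_left₀ (abs_nonneg _) (abs_bar_le hC _) 2
  simpa [secondMoment] using this

lemma tendsto_secondMoment_sub (h : IsStationary μ ν) (hf : Continuous f) :
    Tendsto (fun n => secondMoment μ ν f (n + 1) - secondMoment μ ν f n) atTop (𝓝 0) := by
  obtain ⟨C, hC0, hC⟩ := exists_abs_le hf
  have h1 := tendsto_atTop_ciSup (secondMoment_mono h hf)
    ⟨C ^ 2, by rintro _ ⟨n, rfl⟩; exact secondMoment_le hf hC n⟩
  simpa using ((tendsto_add_atTop_iff_nat 1).mpr h1).sub h1

lemma continuous_oneStep (hf : Continuous f) : Continuous (oneStep μ ν f) := by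
  obtain ⟨C, hC0, hC⟩ := exists_abs_le hf
  have hb := continuous_bar (ν := ν) hf
  refine continuous_of_dominated (bound := fun _ => (2 * C) ^ 2) (fun g => ?_)
    (fun g => ae_of_all _ fun A => ?_) (integrable_const _) (ae_of_all _ fun A => ?_)
  · exact (((hb.comp (by fun_prop : Continuous fun A => g * A)).sub
      continuous_const).pow 2).measurable.aestronglyMeasurable
  · rw [Real.norm_eq_abs, abs_pow]
    refine pow_le_pow_left₀ (abs_nonneg _) ((abs_sub _ _).trans ?_) 2
    linarith [abs_bar_le (ν := ν) hC (g * A), abs_bar_le (ν := ν) hC g]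
  · exact ((hb.comp (by fun_prop : Continuous fun g => g * A)).sub hb).pow 2

lemma integrable_oneStep (hf : Continuous f) {m : Measure G} [IsFiniteMeasure m] :
    Integrable (oneStep μ ν f) m := by
  obtain ⟨C, hC0, hC⟩ := exists_abs_le hf
  refine integrable_of_continuous_of_abs_le (C := (2 * C) ^ 2) (continuous_oneStep hf) fun A => ?_
  have := norm_integral_le_of_norm_le_const (μ := μ) (C := (2 * C) ^ 2)
    (f := fun B => (bar ν f (A * B) - bar ν f A) ^ 2) (ae_of_all _ fun B => by
      rw [Real.norm_eq_abs, abs_pow]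
      refine pow_le_pow_left₀ (abs_nonneg _) ((abs_sub _ _).trans ?_) 2
      linarith [abs_bar_le (ν := ν) hC (A * B), abs_bar_le (ν := ν) hC A])
  rw [probReal_univ, mul_one] at this
  exact this

lemma push_injective (g : G) {ν₁ ν₂ : Measure RP} (h : push g ν₁ = push g ν₂) : ν₁ = ν₂ := by
  have := congrArg (push g⁻¹) h
  rwa [← push_mul, ← push_mul, inv_mul_cancel, push_one, push_one] at this

/-- If no test function moves in one step from g, then gAν = gν, hence Aν = ν, for every A in the
support. Working on the support avoids intersecting null sets over uncountably many test functions.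
-/
lemma exists_oneStep_pos (hinv : ¬ ∀ᵐ A ∂μ, push A ν = ν) (g : G) :
    ∃ f : BoundedContinuousFunction RP ℝ, 0 < oneStep μ ν f g := by
  by_contra hcon
  push Not at hcon
  apply hinv
  have h0 : ∀ f : BoundedContinuousFunction RP ℝ, ∀ A ∈ μ.support,
      bar ν f (g * A) = bar ν f g := by
    intro f
    obtain ⟨C, hC0, hC⟩ := exists_abs_le f.continuous
    have hb := continuous_bar (ν := ν) f.continuous
    have hcont : Continuous fun A => bar ν f (g * A) := hb.comp (by fun_prop)
    have h1 : oneStep μ ν f g = 0 := le_antisymm (hcon f) (oneStep_nonneg g)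
    have hi : Integrable (fun A => (bar ν f (g * A) - bar ν f g) ^ 2) μ :=
      integrable_of_continuous_of_abs_le (C := (2 * C) ^ 2)
        ((hcont.sub continuous_const).pow 2) fun A => by
          rw [abs_pow]
          refine pow_le_pow_left₀ (abs_nonneg _) ((abs_sub _ _).trans ?_) 2
          linarith [abs_bar_le (ν := ν) hC (g * A), abs_bar_le (ν := ν) hC g]
    rw [oneStep, integral_eq_zero_iff_of_nonneg (fun A => sq_nonneg _) hi] at h1
    refine fun A hA => Measure.support_subset_of_isClosed (isClosed_eq hcont continuous_const) ?_ hA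
    filter_upwards [h1] with A hA
    have : (bar ν f (g * A) - bar ν f g) ^ 2 = 0 := hA
    exact sub_eq_zero.mp (pow_eq_zero_iff two_ne_zero |>.mp this)
  filter_upwards [Measure.support_mem_ae (μ := μ)] with A hA
  apply push_injective g
  rw [← push_mul]
  refine ext_of_forall_integral_eq_of_IsFiniteMeasure fun f => ?_
  rw [integral_push _ _ f.continuous, integral_push _ _ f.continuous]
  exact h0 f A hA

lemma isCompact_setOf_N2_le (R : ℝ) : IsCompact {A : G | N2 A ≤ R} := by
  have hcl : IsClosedEmbedding fun A : G => (A : Matrix (Fin 2) (Fin 2) ℝ) := by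
    refine IsClosed.isClosedEmbedding_subtypeVal ?_
    exact isClosed_eq (Continuous.matrix_det continuous_id) continuous_const
  have hK : IsCompact (Set.pi Set.univ fun _ : Fin 2 => Set.pi Set.univ fun _ : Fin 2 =>
      Set.Icc (-(|R| + 1)) (|R| + 1)) :=
    isCompact_univ_pi fun _ => isCompact_univ_pi fun _ => isCompact_Icc
  refine (hcl.isCompact_preimage (K := _) hK).of_isClosed_subset
    (isClosed_le continuous_N2 continuous_const) fun A hA => ?_
  intro i _ j _
  rw [Set.mem_Icc, ← abs_le]
  have h1 : A.1 i j ^ 2 ≤ N2 A := by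
    unfold N2
    fin_cases i <;> fin_cases j <;> simp <;>
      nlinarith [sq_nonneg (A.1 0 0), sq_nonneg (A.1 0 1), sq_nonneg (A.1 1 0), sq_nonneg (A.1 1 1)]
  have h2 : A.1 i j ^ 2 ≤ R := h1.trans hA
  rw [← sq_abs] at h2
  change |A.1 i j| ≤ _
  nlinarith [abs_nonneg (A.1 i j), le_abs_self R, abs_nonneg R]

/-- By compactness finitely many test functions give a total displacement D bounded below on {`N2` ≤
R}. The mean of D under the n-th convolution power is a sum of second-moment increments and tends to
0, so the walk leaves the compact set in probability. -/
lemma tendsto_convPow_N2_le (h : IsStationary μ ν) (hinv : ¬ ∀ᵐ A ∂μ, push A ν = ν) (R : ℝ) :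
    Tendsto (fun n => (convPow μ n).real {A | N2 A ≤ R}) atTop (𝓝 0) := by
  choose f hf using exists_oneStep_pos (μ := μ) (ν := ν) hinv
  obtain ⟨t, ht⟩ := (isCompact_setOf_N2_le R).elim_finite_subcover
    (fun g : G => {A : G | 0 < oneStep μ ν (f g) A})
    (fun g => isOpen_lt continuous_const (continuous_oneStep (f g).continuous))
    (fun g _ => Set.mem_iUnion.mpr ⟨g, hf g⟩)
  set D : G → ℝ := fun A => ∑ g ∈ t, oneStep μ ν (f g) A with hD
  have hDc : Continuous D := continuous_finsetSum _ fun g _ => continuous_oneStep (f g).continuous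
  have hDn : ∀ A, 0 ≤ D A := fun A => Finset.sum_nonneg fun g _ => oneStep_nonneg A
  have hDp : ∀ A ∈ {A : G | N2 A ≤ R}, 0 < D A := by
    intro A hA
    obtain ⟨g, hg, hgA⟩ := Set.mem_iUnion₂.mp (ht hA)
    exact Finset.sum_pos' (fun g _ => oneStep_nonneg A) ⟨g, hg, hgA⟩
  have hDi : ∀ n, ∫ A, D A ∂(convPow μ n) =
      ∑ g ∈ t, (secondMoment μ ν (f g) (n + 1) - secondMoment μ ν (f g) n) := by
    intro n
    rw [hD, integral_finsetSum]
    · refine Finset.sum_congr rfl fun g _ => ?_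
      rw [← integral_integral_bar_sub_sq h (f g).continuous, convPow_one]
      rfl
    · intro g _
      exact integrable_oneStep (f g).continuous
  have hlim : Tendsto (fun n => ∫ A, D A ∂(convPow μ n)) atTop (𝓝 0) := by
    simp only [hDi]
    rw [← Finset.sum_const_zero (s := t) (ι := G) (M := ℝ)]
    exact tendsto_finsetSum _ fun g _ => tendsto_secondMoment_sub h (f g).continuous
  have hDint : ∀ n, Integrable D (convPow μ n) := fun n =>
    integrable_finsetSum _ fun g _ => integrable_oneStep (f g).continuous
  rcases Set.eq_empty_or_nonempty {A : G | N2 A ≤ R} with he | hne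
  · simp [he]
  obtain ⟨A₀, hA₀, hmin⟩ := (isCompact_setOf_N2_le R).exists_isMinOn hne hDc.continuousOn
  have hc := hDp A₀ hA₀
  refine squeeze_zero (fun n => measureReal_nonneg)
    (g := fun n => (D A₀)⁻¹ * ∫ A, D A ∂(convPow μ n)) (fun n => ?_)
    (by simpa using hlim.const_mul (D A₀)⁻¹)
  have h1 := mul_meas_ge_le_integral_of_nonneg (ae_of_all _ hDn) (hDint n) (D A₀)
  rw [← div_eq_inv_mul, le_div_iff₀ hc, mul_comm]
  refine le_trans ?_ h1
  exact mul_le_mul_of_nonneg_left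
    (measureReal_mono (μ := convPow μ n) (fun A hA => hmin hA) (measure_ne_top _ _)) hc.le

end Bar

/-! ### Barycentres of the translated measures -/

/-- The first coordinate of the embedding into the circle. -/
def eR (x : RP) : ℝ := (emb x).re

/-- The second coordinate of the embedding into the circle. -/
def eI (x : RP) : ℝ := (emb x).im

lemma continuous_eR : Continuous eR := Complex.continuous_re.comp continuous_emb

lemma continuous_eI : Continuous eI := Complex.continuous_im.comp continuous_emb

lemma eR_sq_add_eI_sq (x : RP) : eR x ^ 2 + eI x ^ 2 = 1 := by
  have := Complex.sq_norm (emb x)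
  rw [norm_emb, Complex.normSq_apply] at this
  simp only [eR, eI]
  linarith

lemma dist_sq_eq (x y : RP) : dist x y ^ 2 = 2 - 2 * (eR x * eR y + eI x * eI y) := by
  have hx := eR_sq_add_eI_sq x
  have hy := eR_sq_add_eI_sq y
  rw [dist_eq_norm_emb, Complex.sq_norm, Complex.normSq_apply]
  simp only [eR, eI, Complex.sub_re, Complex.sub_im] at *
  linarith

lemma abs_eR_le (x : RP) : |eR x| ≤ 1 := by
  rw [← sq_le_one_iff_abs_le_one]; nlinarith [eR_sq_add_eI_sq x, sq_nonneg (eI x)]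

lemma abs_eI_le (x : RP) : |eI x| ≤ 1 := by
  rw [← sq_le_one_iff_abs_le_one]; nlinarith [eR_sq_add_eI_sq x, sq_nonneg (eR x)]

lemma exists_eR_eI {a b : ℝ} (h : a ^ 2 + b ^ 2 = 1) : ∃ x, eR x = a ∧ eI x = b := by
  have hz : ‖(⟨a, b⟩ : ℂ)‖ = 1 := by
    have := Complex.sq_norm (⟨a, b⟩ : ℂ)
    rw [Complex.normSq_apply] at this
    have h1 : ‖(⟨a, b⟩ : ℂ)‖ ^ 2 = 1 := by rw [this]; simp only; linarith
    nlinarith [norm_nonneg (⟨a, b⟩ : ℂ)]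
  have hz0 : (⟨a, b⟩ : ℂ) ≠ 0 := fun h0 => by rw [h0, norm_zero] at hz; norm_num at hz
  set θ := (⟨a, b⟩ : ℂ).arg with hθ
  have hc : Real.cos θ = a := by rw [hθ, Complex.cos_arg hz0, hz]; simp
  have hs : Real.sin θ = b := by rw [hθ, Complex.sin_arg, hz]; simp
  have hn : nsq ![Real.cos (θ / 2), Real.sin (θ / 2)] = 1 := by simp [nsq]
  refine ⟨dir (θ / 2), ?_, ?_⟩
  · rw [eR, dir, emb_mk, hn]
    simp only [Matrix.cons_val_zero, Matrix.cons_val_one, div_one]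
    rw [← Real.cos_two_mul', ← hc]
    congr 1; ring
  · rw [eI, dir, emb_mk, hn]
    simp only [Matrix.cons_val_zero, Matrix.cons_val_one, div_one]
    rw [← hs, show θ = 2 * (θ / 2) by ring, Real.sin_two_mul]
    ring_nf

section Boundary

variable {μ : Measure G} [IsProbabilityMeasure μ] {ν : Measure RP} [IsProbabilityMeasure ν]
  {f : RP → ℝ}

lemma integrable_comp_smul (hf : Continuous f) (g : G) : Integrable (fun x => f (g • x)) ν := by
  obtain ⟨C, _, hC⟩ := exists_abs_le hf
  exact integrable_of_continuous_of_abs_le (hf.comp (continuous_smul_left g)) fun x => hC _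

lemma integral_dist_sq (g : G) (y : RP) :
    ∫ x, dist (g • x) y ^ 2 ∂ν = 2 - 2 * (bar ν eR g * eR y + bar ν eI g * eI y) := by
  have i1 : Integrable (fun x => eR (g • x)) ν := integrable_comp_smul continuous_eR g
  have i2 : Integrable (fun x => eI (g • x)) ν := integrable_comp_smul continuous_eI g
  have i3 : Integrable (fun x => eR (g • x) * eR y + eI (g • x) * eI y) ν :=
    (i1.mul_const _).add (i2.mul_const _)
  simp only [dist_sq_eq]
  rw [integral_sub (integrable_const _) (i3.const_mul 2), integral_const_mul,
    integral_add (i1.mul_const _) (i2.mul_const _), integral_mul_const, integral_mul_const]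
  simp [bar]

lemma integrable_dist_sq (g : G) (y : RP) : Integrable (fun x => dist (g • x) y ^ 2) ν :=
  integrable_comp_smul (f := fun x => dist x y ^ 2) (by fun_prop) g

lemma bar_sq_le (hf : Continuous f) (g : G) : bar ν f g ^ 2 ≤ bar ν (fun x => f x ^ 2) g := by
  have i1 : Integrable (fun x => f (g • x)) ν := integrable_comp_smul hf g
  have i2 : Integrable (fun x => f (g • x) ^ 2) ν :=
    integrable_comp_smul (f := fun x => f x ^ 2) (hf.pow 2) g
  have i3 : Integrable (fun x => f (g • x) ^ 2 - 2 * bar ν f g * f (g • x)) ν :=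
    i2.sub (i1.const_mul _)
  have h : 0 ≤ ∫ x, (f (g • x) - bar ν f g) ^ 2 ∂ν := integral_nonneg fun x => sq_nonneg _
  have e : ∀ x, (f (g • x) - bar ν f g) ^ 2 =
      f (g • x) ^ 2 - 2 * bar ν f g * f (g • x) + bar ν f g ^ 2 := fun x => by ring
  simp only [e] at h
  rw [integral_add i3 (integrable_const _), integral_sub i2 (i1.const_mul _),
    integral_const_mul] at h
  simp only [integral_const, probReal_univ, one_smul] at h
  change 0 ≤ bar ν (fun x => f x ^ 2) g - 2 * bar ν f g * bar ν f g + bar ν f g ^ 2 at h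
  linarith

/-- The squared length of the barycentre of `gν` in the disc. -/
def baryNormSq (ν : Measure RP) (g : G) : ℝ := bar ν eR g ^ 2 + bar ν eI g ^ 2

lemma baryNormSq_le_one (g : G) : baryNormSq ν g ≤ 1 := by
  have h1 := bar_sq_le (ν := ν) continuous_eR g
  have h2 := bar_sq_le (ν := ν) continuous_eI g
  have h3 : bar ν (fun x => eR x ^ 2) g + bar ν (fun x => eI x ^ 2) g = 1 := by
    simp only [bar]
    rw [← integral_add (integrable_comp_smul (f := fun x => eR x ^ 2) (continuous_eR.pow 2) g)
      (integrable_comp_smul (f := fun x => eI x ^ 2) (continuous_eI.pow 2) g)]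
    simp [eR_sq_add_eI_sq]
  simp only [baryNormSq]
  linarith

/-- The measure gν lies mostly within ε of some y, so its mean square distance to y is at most ε² +
4ε. That distance equals 2 - 2⟨b, y⟩ for the barycentre b, and 2⟨b, y⟩ ≤ |b|² + 1. -/
lemma exists_baryNormSq_ge [NullSingletonClass ν] {ε : ℝ} (hε : 0 < ε) :
    ∃ R, ∀ g, R ≤ N2 g → 1 - (ε ^ 2 + 4 * ε) ≤ baryNormSq ν g := by
  obtain ⟨R, hR⟩ := exists_concentration ν hε
  refine ⟨R, fun g hg => ?_⟩
  obtain ⟨y, hy⟩ := hR g hg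
  have hm : MeasurableSet {x : RP | ε < dist (g • x) y} :=
    (isOpen_lt continuous_const ((continuous_smul_left g).dist continuous_const)).measurableSet
  have h1 : ∫ x, dist (g • x) y ^ 2 ∂ν ≤
      ∫ x, (ε ^ 2 + {x : RP | ε < dist (g • x) y}.indicator (fun _ => (4 : ℝ)) x) ∂ν := by
    refine integral_mono (integrable_dist_sq g y)
      ((integrable_const _).add ((integrable_const _).indicator hm)) fun x => ?_
    by_cases hx : x ∈ {x : RP | ε < dist (g • x) y}
    · simp only [Set.indicator_of_mem hx]
      nlinarith [dist_le_two (g • x) y, dist_nonneg (x := g • x) (y := y), sq_nonneg ε]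
    · simp only [Set.indicator_of_notMem hx, add_zero]
      exact pow_le_pow_left₀ dist_nonneg (not_lt.mp hx) 2
  rw [integral_add (integrable_const _) ((integrable_const _).indicator hm),
    integral_indicator_const _ hm, integral_dist_sq] at h1
  simp only [integral_const, probReal_univ, smul_eq_mul] at h1
  have h2 : ν.real {x | ε < dist (g • x) y} ≤ ε := by
    rw [measureReal_def]
    exact ENNReal.toReal_le_of_le_ofReal hε.le hy
  have h3 := eR_sq_add_eI_sq y
  simp only [baryNormSq]
  nlinarith [sq_nonneg (bar ν eR g - eR y), sq_nonneg (bar ν eI g - eI y)]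

lemma integral_baryNormSq (n : ℕ) : ∫ g, baryNormSq ν g ∂(convPow μ n) =
    secondMoment μ ν eR n + secondMoment μ ν eI n :=
  integral_add (integrable_bar_sq continuous_eR) (integrable_bar_sq continuous_eI)

lemma integrable_baryNormSq {m : Measure G} [IsProbabilityMeasure m] :
    Integrable (baryNormSq ν) m :=
  (integrable_bar_sq continuous_eR).add (integrable_bar_sq continuous_eI)

lemma tendsto_integral_baryNormSq [NullSingletonClass ν] (h : IsStationary μ ν)
    (hinv : ¬ ∀ᵐ A ∂μ, push A ν = ν) :
    Tendsto (fun n => ∫ g, (1 - baryNormSq ν g) ∂(convPow μ n)) atTop (𝓝 0) := by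
  have hnn : ∀ n, 0 ≤ ∫ g, (1 - baryNormSq ν g) ∂(convPow μ n) := fun n =>
    integral_nonneg fun g => sub_nonneg.mpr (baryNormSq_le_one g)
  rw [Metric.tendsto_atTop]
  intro η hη
  set ε := min (η / 10) 1 with hε
  have hε0 : 0 < ε := by positivity
  have hε1 : ε ≤ 1 := min_le_right _ _
  have hε2 : ε ≤ η / 10 := min_le_left _ _
  obtain ⟨R, hR⟩ := exists_baryNormSq_ge (ν := ν) hε0
  obtain ⟨N, hN⟩ := (Metric.tendsto_atTop.mp (tendsto_convPow_N2_le h hinv R)) ε hε0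
  refine ⟨N, fun n hn => ?_⟩
  have h1 := hN n hn
  rw [Real.dist_eq, sub_zero, abs_of_nonneg measureReal_nonneg] at h1
  rw [Real.dist_eq, sub_zero, abs_of_nonneg (hnn n)]
  have hm : MeasurableSet {A : G | N2 A ≤ R} :=
    (isClosed_le continuous_N2 continuous_const).measurableSet
  have h2 : ∫ g, (1 - baryNormSq ν g) ∂(convPow μ n) ≤
      ∫ g, ((ε ^ 2 + 4 * ε) + {A : G | N2 A ≤ R}.indicator (fun _ => (1 : ℝ)) g)
        ∂(convPow μ n) := by
    refine integral_mono ((integrable_const _).sub integrable_baryNormSq)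
      ((integrable_const _).add ((integrable_const _).indicator hm)) fun g => ?_
    by_cases hg : g ∈ {A : G | N2 A ≤ R}
    · simp only [Set.indicator_of_mem hg]
      have : 0 ≤ baryNormSq ν g := add_nonneg (sq_nonneg _) (sq_nonneg _)
      nlinarith
    · simp only [Set.indicator_of_notMem hg, add_zero]
      linarith [hR g (not_le.mp hg).le]
  rw [integral_add (integrable_const _) ((integrable_const _).indicator hm),
    integral_indicator_const _ hm] at h2
  simp only [integral_const, probReal_univ, smul_eq_mul, mul_one] at h2
  nlinarith

/-- The weighted series with weights 2^j still has finite integral, so it is finite almost surely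
and bounds each of its terms. -/
lemma ae_exists_le_geometric {Ω : Type*} [MeasurableSpace Ω] {P : Measure Ω} {d : ℕ → Ω → ℝ}
    (hd : ∀ j ω, 0 ≤ d j ω) (hi : ∀ j, Integrable (d j) P) {C : ℝ}
    (hC : ∀ j, ∫ ω, d j ω ∂P ≤ C * (1 / 4) ^ j) :
    ∀ᵐ ω ∂P, ∃ K : ℝ, ∀ j, d j ω ≤ K * (1 / 2) ^ j := by
  have h1 : ∫⁻ ω, ∑' j, ENNReal.ofReal (2 ^ j * d j ω) ∂P ≠ ⊤ := by
    rw [lintegral_tsum fun j => ((hi j).const_mul _).aemeasurable.ennreal_ofReal]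
    have h2 : ∀ j, ∫⁻ ω, ENNReal.ofReal (2 ^ j * d j ω) ∂P ≤ ENNReal.ofReal (C * (1 / 2) ^ j) := by
      intro j
      rw [← ofReal_integral_eq_lintegral_ofReal ((hi j).const_mul _)
        (ae_of_all _ fun ω => mul_nonneg (by positivity) (hd j ω)), integral_const_mul]
      apply ENNReal.ofReal_le_ofReal
      calc (2 : ℝ) ^ j * ∫ ω, d j ω ∂P ≤ 2 ^ j * (C * (1 / 4) ^ j) := by gcongr; exact hC j
        _ = C * (2 * (1 / 4)) ^ j := by rw [mul_pow]; ring
        _ = C * (1 / 2) ^ j := by norm_num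
    refine ne_top_of_le_ne_top ?_ (ENNReal.tsum_le_tsum h2)
    exact (summable_geometric_two.mul_left C).tsum_ofReal_ne_top
  have hmeas : AEMeasurable (fun ω => ∑' j, ENNReal.ofReal (2 ^ j * d j ω)) P :=
    AEMeasurable.tsum fun j => ((hi j).const_mul _).aemeasurable.ennreal_ofReal
  filter_upwards [ae_lt_top' hmeas h1] with ω hω
  refine ⟨(∑' j, ENNReal.ofReal (2 ^ j * d j ω)).toReal, fun j => ?_⟩
  have h3 := (ENNReal.ofReal_le_iff_le_toReal hω.ne).mp
    (ENNReal.le_tsum (f := fun j => ENNReal.ofReal (2 ^ j * d j ω)) j)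
  have : (1 / 2 : ℝ) ^ j = (2 ^ j)⁻¹ := by simp
  rw [this, ← div_eq_mul_inv, le_div_iff₀ (by positivity), mul_comm]
  exact h3

/-- If the barycentres converge to a point z of the circle, the mean square distances to z tend to
0. The measures therefore converge weakly to the point mass at z. -/
lemma tendsto_bar_of_tendsto {g : ℕ → G} {z : RP}
    (h1 : Tendsto (fun j => bar ν eR (g j)) atTop (𝓝 (eR z)))
    (h2 : Tendsto (fun j => bar ν eI (g j)) atTop (𝓝 (eI z))) (hf : Continuous f) :
    Tendsto (fun j => bar ν f (g j)) atTop (𝓝 (f z)) := by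
  obtain ⟨C, hC0, hC⟩ := exists_abs_le hf
  have hd : Tendsto (fun j => ∫ x, dist (g j • x) z ^ 2 ∂ν) atTop (𝓝 0) := by
    simp only [integral_dist_sq]
    have := ((h1.mul_const (eR z)).add (h2.mul_const (eI z))).const_mul 2 |>.const_sub 2
    convert this using 2
    linarith [eR_sq_add_eI_sq z]
  rw [Metric.tendsto_atTop]
  intro ε hε
  obtain ⟨δ, hδ, hfδ⟩ := Metric.continuous_iff.mp hf z (ε / 2) (half_pos hε)
  have hpt : ∀ y, |f y - f z| ≤ ε / 2 + 2 * C / δ ^ 2 * dist y z ^ 2 := by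
    intro y
    by_cases hy : dist y z < δ
    · have := (hfδ y hy).le
      rw [Real.dist_eq] at this
      have h3 : 0 ≤ 2 * C / δ ^ 2 * dist y z ^ 2 := by positivity
      linarith
    · have h3 : 1 ≤ dist y z ^ 2 / δ ^ 2 := by
        rw [one_le_div (by positivity)]
        exact pow_le_pow_left₀ hδ.le (not_lt.mp hy) 2
      have h4 : |f y - f z| ≤ 2 * C := (abs_sub _ _).trans (by linarith [hC y, hC z])
      calc |f y - f z| ≤ 2 * C * 1 := by linarith
        _ ≤ 2 * C * (dist y z ^ 2 / δ ^ 2) := by gcongr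
        _ = 2 * C / δ ^ 2 * dist y z ^ 2 := by ring
        _ ≤ _ := by linarith
  have hb : ∀ j, |bar ν f (g j) - f z| ≤
      ε / 2 + 2 * C / δ ^ 2 * ∫ x, dist (g j • x) z ^ 2 ∂ν := by
    intro j
    have i1 := integrable_comp_smul (ν := ν) hf (g j)
    have e1 : bar ν f (g j) - f z = ∫ x, (f (g j • x) - f z) ∂ν := by
      rw [integral_sub i1 (integrable_const _)]; simp [bar]
    rw [e1]
    refine (abs_integral_le_integral_abs).trans ?_
    have e2 : ε / 2 + 2 * C / δ ^ 2 * ∫ x, dist (g j • x) z ^ 2 ∂ν =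
        ∫ x, (ε / 2 + 2 * C / δ ^ 2 * dist (g j • x) z ^ 2) ∂ν := by
      rw [integral_add (integrable_const _) ((integrable_dist_sq _ _).const_mul _),
        integral_const_mul]
      simp
    rw [e2]
    exact integral_mono (i1.sub (integrable_const _)).abs
      ((integrable_const _).add ((integrable_dist_sq _ _).const_mul _)) fun x => hpt _
  have hlim : Tendsto (fun j => ε / 2 + 2 * C / δ ^ 2 * ∫ x, dist (g j • x) z ^ 2 ∂ν) atTop
      (𝓝 (ε / 2)) := by
    simpa using (hd.const_mul (2 * C / δ ^ 2)).const_add (ε / 2)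
  obtain ⟨N, hN⟩ := eventually_atTop.mp (hlim.eventually (gt_mem_nhds (half_lt_self hε)))
  exact ⟨N, fun n hn => (hb n).trans_lt (hN n hn)⟩

end Boundary

end

/-! ### Construction of the boundary map -/

section

variable {μ : Measure G} [IsProbabilityMeasure μ] {ν : Measure RP} [IsProbabilityMeasure ν]

lemma measurePreserving_rp {μ : Measure G} (n : ℕ) : MeasurePreserving (rp n) (law μ) (convPow μ n) :=
  ⟨measurable_rp n, rfl⟩

lemma integral_bar_rp_sub_sq (h : IsStationary μ ν) {f : RP → ℝ} (hf : Continuous f) (n m : ℕ) :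
    ∫ ω, (bar ν f (rp (n + m) ω) - bar ν f (rp n ω)) ^ 2 ∂(law μ) =
      secondMoment μ ν f (n + m) - secondMoment μ ν f n := by
  obtain ⟨C, hC0, hC⟩ := exists_abs_le hf
  have hb := continuous_bar (ν := ν) hf
  have hmp : MeasurePreserving (Prod.map id (rp m) ∘ fun ω => (rp n ω, shift^[n] ω)) (law μ)
      ((convPow μ n).prod (convPow μ m)) :=
    ((MeasurePreserving.id _).prod (measurePreserving_rp m)).comp (measurePreserving_rp_shift μ n)
  have hc : Continuous fun p : G × G => (bar ν f (p.1 * p.2) - bar ν f p.1) ^ 2 :=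
    ((hb.comp continuous_mul).sub (hb.comp continuous_fst)).pow 2
  have hi : Integrable (fun p : G × G => (bar ν f (p.1 * p.2) - bar ν f p.1) ^ 2)
      ((convPow μ n).prod (convPow μ m)) :=
    integrable_of_continuous_of_abs_le (C := (2 * C) ^ 2) hc fun p => by
      rw [abs_pow]
      refine pow_le_pow_left₀ (abs_nonneg _) ((abs_sub _ _).trans ?_) 2
      linarith [abs_bar_le (ν := ν) hC (p.1 * p.2), abs_bar_le (ν := ν) hC p.1]
  rw [← integral_integral_bar_sub_sq h hf, ← integral_prod _ hi,
    ← integral_comp_measurePreserving hmp hi.aestronglyMeasurable]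
  simp [rp_add]

lemma integrable_bar_rp_sub_sq {f : RP → ℝ} (hf : Continuous f) (n m : ℕ) :
    Integrable (fun ω => (bar ν f (rp n ω) - bar ν f (rp m ω)) ^ 2) (law μ) := by
  obtain ⟨C, hC0, hC⟩ := exists_abs_le hf
  have hb := (continuous_bar (ν := ν) hf).measurable
  refine Integrable.of_bound (C := (2 * C) ^ 2) (((hb.comp (measurable_rp n)).sub
    (hb.comp (measurable_rp m))).pow_const 2).aestronglyMeasurable (ae_of_all _ fun ω => ?_)
  rw [Real.norm_eq_abs, abs_pow]
  refine pow_le_pow_left₀ (abs_nonneg _) ((abs_sub _ _).trans ?_) 2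
  linarith [abs_bar_le (ν := ν) hC (rp n ω), abs_bar_le (ν := ν) hC (rp m ω)]

lemma exists_tendsto_of_sq_le {u : ℕ → ℝ} {K : ℝ}
    (h : ∀ j, (u (j + 1) - u j) ^ 2 ≤ K * (1 / 2) ^ j) : ∃ l, Tendsto u atTop (𝓝 l) := by
  refine cauchySeq_tendsto_of_complete (cauchySeq_of_le_geometric (√(1 / 2)) (√K) ?_ fun j => ?_)
  · rw [Real.sqrt_lt' one_pos]; norm_num
  · have hK : 0 ≤ K := by
      have := (sq_nonneg _).trans (h 0)
      simpa using this
    have h1 : √(1 / 2 : ℝ) ^ j = √((1 / 2) ^ j) := by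
      rw [eq_comm, Real.sqrt_eq_iff_mul_self_eq (by positivity) (by positivity), ← mul_pow,
        Real.mul_self_sqrt (by norm_num)]
    rw [Real.dist_eq, abs_sub_comm, ← Real.sqrt_sq_eq_abs, h1, ← Real.sqrt_mul hK]
    exact Real.sqrt_le_sqrt (h j)

/-- The Furstenberg boundary map of a stationary measure. -/
theorem exists_boundary_map [NullSingletonClass ν] (h : IsStationary μ ν)
    (hinv : ¬ ∀ᵐ A ∂μ, push A ν = ν) :
    ∃ Z : (ℕ → G) → RP, Measurable Z ∧ (∀ᵐ ω ∂(law μ), Z ω = ω 0 • Z (shift ω)) ∧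
      (law μ).map Z = ν := by
  set u : ℕ → ℝ := fun n => ∫ g, (1 - baryNormSq ν g) ∂(convPow μ n) with hu
  have hu' : ∀ n, u n = 1 - (secondMoment μ ν eR n + secondMoment μ ν eI n) := fun n => by
    rw [hu]
    dsimp only
    rw [integral_sub (integrable_const _) integrable_baryNormSq, integral_baryNormSq]
    simp
  have hu0 : ∀ n, 0 ≤ u n := fun n => integral_nonneg fun g => sub_nonneg.mpr (baryNormSq_le_one g)
  -- A subsequence along which the expected deficits 1 - |b|² are geometrically small takes the
  -- place of the martingale convergence theorem.
  obtain ⟨φ, hφ, hφu⟩ : ∃ φ : ℕ → ℕ, StrictMono φ ∧ ∀ j, u (φ j) < (1 / 4) ^ j := by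
    refine extraction_forall_of_eventually' (P := fun j n => u n < (1 / 4) ^ j) fun j => ?_
    have hj : (0 : ℝ) < (1 / 4) ^ j := by positivity
    exact eventually_atTop.mp ((tendsto_integral_baryNormSq h hinv).eventually (gt_mem_nhds hj))
  have hR := continuous_eR
  have hI := continuous_eI
  -- The expected squared displacement after time φ j is an increment of a total second moment that
  -- never exceeds 1, so it is at most the deficit at φ j. The choice ψ j = φ (j + 1) gives
  -- convergence, and ψ j = φ j + 1 gives equivariance.
  have hbound : ∀ (ψ : ℕ → ℕ), (∀ j, φ j ≤ ψ j) → ∀ᵐ ω ∂(law μ), ∃ K : ℝ, ∀ j,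
      (bar ν eR (rp (ψ j) ω) - bar ν eR (rp (φ j) ω)) ^ 2 +
        (bar ν eI (rp (ψ j) ω) - bar ν eI (rp (φ j) ω)) ^ 2 ≤ K * (1 / 2) ^ j := by
    intro ψ hψ
    refine ae_exists_le_geometric (C := 1) (fun j ω => add_nonneg (sq_nonneg _) (sq_nonneg _))
      (fun j => (integrable_bar_rp_sub_sq hR _ _).add (integrable_bar_rp_sub_sq hI _ _))
      fun j => ?_
    rw [integral_add (integrable_bar_rp_sub_sq hR _ _) (integrable_bar_rp_sub_sq hI _ _)]
    obtain ⟨m, hm⟩ := Nat.exists_eq_add_of_le (hψ j)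
    rw [hm, integral_bar_rp_sub_sq h hR, integral_bar_rp_sub_sq h hI]
    have h1 := (hφu j).le
    have h2 := hu0 (φ j + m)
    rw [hu'] at h1 h2
    linarith
  have hnear : ∀ᵐ ω ∂(law μ), ∃ K : ℝ, ∀ j, 1 - baryNormSq ν (rp (φ j) ω) ≤ K * (1 / 2) ^ j := by
    refine ae_exists_le_geometric (C := 1) (fun j ω => sub_nonneg.mpr (baryNormSq_le_one _))
      (fun j => ?_) fun j => ?_
    · exact (measurePreserving_rp (φ j)).integrable_comp_of_integrable
        ((integrable_const (1 : ℝ)).sub integrable_baryNormSq)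
    · rw [integral_comp_measurePreserving (f := fun g => 1 - baryNormSq ν g)
        (measurePreserving_rp (φ j))
        ((integrable_const (1 : ℝ)).sub integrable_baryNormSq).aestronglyMeasurable, one_mul]
      exact (hφu j).le
  have hgeo : ∀ K : ℝ, Tendsto (fun j : ℕ => K * (1 / 2 : ℝ) ^ j) atTop (𝓝 0) := fun K => by
    simpa using (tendsto_pow_atTop_nhds_zero_of_lt_one (by norm_num : (0 : ℝ) ≤ 1 / 2)
      (by norm_num)).const_mul K
  have hbR := (continuous_bar (ν := ν) hR).measurable
  have hbI := (continuous_bar (ν := ν) hI).measurable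
  have hb1 := hbound (fun j => φ (j + 1)) fun j => hφ.monotone (Nat.le_succ j)
  obtain ⟨Y, hYm, hY⟩ := measurable_limit_of_tendsto_metrizable_ae (L := atTop) (μ := law μ)
    (f := fun (j : ℕ) ω => (bar ν eR (rp (φ j) ω), bar ν eI (rp (φ j) ω)))
    (fun j => ((hbR.comp (measurable_rp _)).prodMk (hbI.comp (measurable_rp _))).aemeasurable) (by
      filter_upwards [hb1] with ω hω
      obtain ⟨K, hK⟩ := hω
      obtain ⟨l1, hl1⟩ := exists_tendsto_of_sq_le (u := fun j => bar ν eR (rp (φ j) ω)) (K := K)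
        fun j => by nlinarith [hK j, sq_nonneg (bar ν eI (rp (φ (j + 1)) ω) - bar ν eI (rp (φ j) ω))]
      obtain ⟨l2, hl2⟩ := exists_tendsto_of_sq_le (u := fun j => bar ν eI (rp (φ j) ω)) (K := K)
        fun j => by nlinarith [hK j, sq_nonneg (bar ν eR (rp (φ (j + 1)) ω) - bar ν eR (rp (φ j) ω))]
      exact ⟨(l1, l2), hl1.prodMk_nhds hl2⟩)
  have hinj : Function.Injective fun x : RP => (eR x, eI x) := fun x y hxy => by
    apply emb_injective
    exact Complex.ext (congrArg Prod.fst hxy) (congrArg Prod.snd hxy)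
  have hemb : MeasurableEmbedding fun x : RP => (eR x, eI x) :=
    ((hR.prodMk hI).isClosedEmbedding hinj).measurableEmbedding
  obtain ⟨inv, hinvm, hinv'⟩ := hemb.exists_measurable_extend (g := id) measurable_id
    fun _ => ⟨dir 0⟩
  set Z : (ℕ → G) → RP := fun ω => inv (Y ω) with hZ
  have hZm : Measurable Z := hinvm.comp hYm
  have hconv : ∀ᵐ ω ∂(law μ), Tendsto (fun j => bar ν eR (rp (φ j) ω)) atTop (𝓝 (eR (Z ω))) ∧
      Tendsto (fun j => bar ν eI (rp (φ j) ω)) atTop (𝓝 (eI (Z ω))) := by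
    filter_upwards [hY, hnear] with ω hω hn
    have h1 : Tendsto (fun j => bar ν eR (rp (φ j) ω)) atTop (𝓝 (Y ω).1) :=
      (continuous_fst.tendsto _).comp hω
    have h2 : Tendsto (fun j => bar ν eI (rp (φ j) ω)) atTop (𝓝 (Y ω).2) :=
      (continuous_snd.tendsto _).comp hω
    obtain ⟨K, hK⟩ := hn
    have h3 : Tendsto (fun j => 1 - baryNormSq ν (rp (φ j) ω)) atTop (𝓝 0) :=
      squeeze_zero (fun j => sub_nonneg.mpr (baryNormSq_le_one _)) hK (hgeo K)
    have h4 : Tendsto (fun j => 1 - baryNormSq ν (rp (φ j) ω)) atTop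
        (𝓝 (1 - ((Y ω).1 ^ 2 + (Y ω).2 ^ 2))) := ((h1.pow 2).add (h2.pow 2)).const_sub 1
    have h5 : (Y ω).1 ^ 2 + (Y ω).2 ^ 2 = 1 := by linarith [tendsto_nhds_unique h3 h4]
    obtain ⟨x, hx1, hx2⟩ := exists_eR_eI h5
    have h6 : Z ω = x := by
      have := congrFun hinv' x
      simp only [Function.comp_apply, id] at this
      rw [hZ]
      dsimp only
      rw [← this, hx1, hx2]
    rw [h6, hx1, hx2]
    exact ⟨h1, h2⟩
  refine ⟨Z, hZm, ?_, ?_⟩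
  -- The product of φ j + 1 factors is ω 0 times the product of φ j factors of the shifted sequence,
  -- and the extra factor does not change the limit.
  · have hb2 := hbound (fun j => φ j + 1) fun j => Nat.le_succ _
    have hconv' := (measurePreserving_shift μ).quasiMeasurePreserving.ae hconv
    filter_upwards [hconv, hconv', hb2] with ω h1 h2 h3
    obtain ⟨K, hK⟩ := h3
    have key : ∀ e : RP → ℝ, Continuous e →
        (∀ j, (bar ν e (rp (φ j + 1) ω) - bar ν e (rp (φ j) ω)) ^ 2 ≤ K * (1 / 2) ^ j) →
        Tendsto (fun j => bar ν e (rp (φ j) ω)) atTop (𝓝 (e (Z ω))) →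
        e (Z ω) = e (ω 0 • Z (shift ω)) := by
      intro e he hej hlim
      have t1 : Tendsto (fun j => bar ν e (rp (φ j + 1) ω) - bar ν e (rp (φ j) ω)) atTop (𝓝 0) := by
        have : Tendsto (fun j => (bar ν e (rp (φ j + 1) ω) - bar ν e (rp (φ j) ω)) ^ 2) atTop
            (𝓝 0) := squeeze_zero (fun j => sq_nonneg _) hej (hgeo K)
        have := (Real.continuous_sqrt.tendsto 0).comp this
        simp only [Real.sqrt_zero, Function.comp_def, Real.sqrt_sq_eq_abs] at this
        exact (tendsto_zero_iff_abs_tendsto_zero _).mpr this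
      have t2 : Tendsto (fun j => bar ν e (rp (φ j + 1) ω)) atTop (𝓝 (e (Z ω))) := by
        simpa using t1.add hlim
      have t3 := tendsto_bar_of_tendsto h2.1 h2.2 (f := fun x => e (ω 0 • x))
        (he.comp (continuous_smul_left _))
      refine tendsto_nhds_unique t2 (t3.congr fun j => ?_)
      simp only [bar, rp, mul_smul]
    apply hinj
    refine Prod.ext (key eR hR (fun j => ?_) h1.1) (key eI hI (fun j => ?_) h1.2)
    · nlinarith [hK j, sq_nonneg (bar ν eI (rp (φ j + 1) ω) - bar ν eI (rp (φ j) ω))]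
    · nlinarith [hK j, sq_nonneg (bar ν eR (rp (φ j + 1) ω) - bar ν eR (rp (φ j) ω))]
  · have : IsProbabilityMeasure ((law μ).map Z) :=
      Measure.isProbabilityMeasure_map hZm.aemeasurable
    refine ext_of_forall_integral_eq_of_IsFiniteMeasure fun f => ?_
    obtain ⟨C, hC0, hC⟩ := exists_abs_le f.continuous
    rw [integral_map hZm.aemeasurable f.continuous.aestronglyMeasurable]
    -- By stationarity the integrals on the left all equal the ν-integral of f, so the law of Z is
    -- ν.
    have hlim : Tendsto (fun j => ∫ ω, bar ν f (rp (φ j) ω) ∂(law μ)) atTop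
        (𝓝 (∫ ω, f (Z ω) ∂(law μ))) := by
      refine tendsto_integral_of_dominated_convergence (fun _ => C) (fun j => ?_)
        (integrable_const _) (fun j => ae_of_all _ fun ω => abs_bar_le hC _) ?_
      · exact ((continuous_bar f.continuous).measurable.comp
          (measurable_rp _)).aestronglyMeasurable
      · filter_upwards [hconv] with ω hω
        exact tendsto_bar_of_tendsto hω.1 hω.2 f.continuous
    refine tendsto_nhds_unique hlim (tendsto_const_nhds.congr fun j => ?_)
    rw [integral_comp_measurePreserving (f := fun g => bar ν f g) (measurePreserving_rp (φ j))
      (continuous_bar f.continuous).measurable.aestronglyMeasurable]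
    exact ((h.convPow (φ j)).integral_eq f.continuous).symm

end

/-! ### Differentiation of measures along arcs -/

/-- Every finite family of arcs has a subfamily with the same union and overlap at most two. -/
lemma exists_subcover (s : Finset (ℝ × ℝ × ℝ)) : ∃ t ⊆ s, (⋃ Q ∈ t, arc Q) = (⋃ Q ∈ s, arc Q) ∧
    ∀ (p : RP) (u : Finset (ℝ × ℝ × ℝ)), u ⊆ t → (∀ Q ∈ u, p ∈ arc Q) → u.card ≤ 2 := by
  classical
  -- In a subfamily of least cardinality no arc is redundant, which three arcs with a common point
  -- would contradict.
  obtain ⟨t, ht, hmin⟩ := Finset.exists_min_image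
    (s.powerset.filter fun t => (⋃ Q ∈ t, arc Q) = (⋃ Q ∈ s, arc Q)) Finset.card
    ⟨s, by simp⟩
  simp only [Finset.mem_filter, Finset.mem_powerset] at ht hmin
  refine ⟨t, ht.1, ht.2, fun p u hu hp => ?_⟩
  by_contra hcard
  push Not at hcard
  obtain ⟨a, ha, b, hb, c, hc, hab, hac, hbc⟩ := Finset.two_lt_card.mp hcard
  have key : ∀ x ∈ t, ∀ y ∈ t, ∀ z ∈ t, x ≠ y → x ≠ z → ¬ arc x ⊆ arc y ∪ arc z := by
    intro x hx y hy z hz hxy hxz hsub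
    have h1 : (⋃ Q ∈ t.erase x, arc Q) = (⋃ Q ∈ s, arc Q) := by
      rw [← ht.2]
      refine Set.Subset.antisymm (Set.biUnion_subset_biUnion_left (Finset.erase_subset _ _)) ?_
      refine Set.iUnion₂_subset fun Q hQ => ?_
      by_cases hQx : Q = x
      · rw [hQx]
        refine hsub.trans (Set.union_subset ?_ ?_)
        · exact Set.subset_biUnion_of_mem (u := arc)
            (show y ∈ t.erase x from Finset.mem_erase.mpr ⟨hxy.symm, hy⟩)
        · exact Set.subset_biUnion_of_mem (u := arc)
            (show z ∈ t.erase x from Finset.mem_erase.mpr ⟨hxz.symm, hz⟩)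
      · exact Set.subset_biUnion_of_mem (u := arc)
            (show Q ∈ t.erase x from Finset.mem_erase.mpr ⟨hQx, hQ⟩)
    have h2 := hmin (t.erase x) ⟨(Finset.erase_subset _ _).trans ht.1, h1⟩
    have h3 := Finset.card_erase_lt_of_mem hx
    omega
  have h3 := arc_subset_union_of_common_point (Q := ![a, b, c]) (p := p) (by
    intro i
    fin_cases i
    exacts [hp a ha, hp b hb, hp c hc])
  simp only [Matrix.cons_val_zero, Matrix.cons_val_one, Matrix.cons_val] at h3
  rcases h3 with h3 | h3 | h3
  · exact key a (hu ha) b (hu hb) c (hu hc) hab hac h3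
  · exact key b (hu hb) a (hu ha) c (hu hc) hab.symm hbc h3
  · exact key c (hu hc) a (hu ha) b (hu hb) hac.symm hbc.symm h3

/-- The covering step of the maximal inequality. Overlap at most two gives the constant 2 for
arbitrary measures, with no doubling assumption. -/
lemma mul_measure_biUnion_finset_le {σ τ : Measure RP} {t : ENNReal} (s : Finset (ℝ × ℝ × ℝ))
    (h : ∀ Q ∈ s, t * τ (arc Q) ≤ σ (arc Q)) :
    t * τ (⋃ Q ∈ s, arc Q) ≤ 2 * σ (⋃ Q ∈ s, arc Q) := by
  classical
  obtain ⟨u, hus, hu, hcard⟩ := exists_subcover s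
  have hm : MeasurableSet (⋃ Q ∈ u, arc Q) :=
    Finset.measurableSet_biUnion _ fun Q _ => measurableSet_arc Q
  rw [← hu]
  calc t * τ (⋃ Q ∈ u, arc Q) ≤ t * ∑ Q ∈ u, τ (arc Q) := by
        gcongr; exact measure_biUnion_finset_le _ _
    _ = ∑ Q ∈ u, t * τ (arc Q) := Finset.mul_sum _ _ _
    _ ≤ ∑ Q ∈ u, σ (arc Q) := Finset.sum_le_sum fun Q hQ => h Q (hus hQ)
    _ = ∑ Q ∈ u, ∫⁻ x, (arc Q).indicator 1 x ∂σ :=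
        Finset.sum_congr rfl fun Q _ => (lintegral_indicator_one (measurableSet_arc Q)).symm
    _ = ∫⁻ x, ∑ Q ∈ u, (arc Q).indicator 1 x ∂σ :=
        (lintegral_finsetSum _ fun Q _ => measurable_one.indicator (measurableSet_arc Q)).symm
    _ ≤ ∫⁻ x, 2 * (⋃ Q ∈ u, arc Q).indicator 1 x ∂σ := by
        refine lintegral_mono fun x => ?_
        have e : ∑ Q ∈ u, (arc Q).indicator (1 : RP → ENNReal) x =
            ((u.filter fun Q => x ∈ arc Q).card : ENNReal) := by
          simp [Set.indicator_apply]
        dsimp only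
        rw [e]
        by_cases hx : x ∈ ⋃ Q ∈ u, arc Q
        · rw [Set.indicator_of_mem hx]
          simp only [Pi.one_apply, mul_one]
          exact_mod_cast hcard x _ (Finset.filter_subset _ _) fun Q hQ =>
            (Finset.mem_filter.mp hQ).2
        · have : (u.filter fun Q => x ∈ arc Q) = ∅ := by
            refine Finset.filter_eq_empty_iff.mpr fun Q hQ hxQ => hx ?_
            exact Set.mem_biUnion hQ hxQ
          simp [this]
    _ = 2 * σ (⋃ Q ∈ u, arc Q) := by
        rw [lintegral_const_mul _ (measurable_one.indicator hm), lintegral_indicator_one hm]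

/-- The form with the given rational coefficients. -/
def ratQ (q : ℚ × ℚ × ℚ) : ℝ × ℝ × ℝ := (q.1, q.2.1, q.2.2)

lemma mul_measure_biUnion_le {σ τ : Measure RP} {t : ENNReal} (S : Set (ℚ × ℚ × ℚ))
    (h : ∀ q ∈ S, t * τ (arc (ratQ q)) ≤ σ (arc (ratQ q))) :
    t * τ (⋃ q ∈ S, arc (ratQ q)) ≤ 2 * σ (⋃ q ∈ S, arc (ratQ q)) := by
  classical
  have e : (⋃ q ∈ S, arc (ratQ q)) = ⋃ F : Finset S, ⋃ q ∈ F, arc (ratQ q) := by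
    ext x
    simp only [Set.mem_iUnion]
    constructor
    · rintro ⟨q, hq, hx⟩
      exact ⟨{⟨q, hq⟩}, ⟨q, hq⟩, by simp, hx⟩
    · rintro ⟨F, q, _, hx⟩
      exact ⟨q, q.2, hx⟩
  have hdir : Directed (· ⊆ ·) fun F : Finset S => ⋃ q ∈ F, arc (ratQ q) := by
    intro F F'
    exact ⟨F ∪ F', Set.biUnion_subset_biUnion_left fun q hq => Finset.mem_union_left _ hq,
      Set.biUnion_subset_biUnion_left fun q hq => Finset.mem_union_right _ hq⟩
  conv_lhs => rw [e, hdir.measure_iUnion, ENNReal.mul_iSup]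
  refine iSup_le fun F => ?_
  have e2 : (⋃ q ∈ F, arc (ratQ q)) = ⋃ Q ∈ F.image (fun q : S => ratQ q), arc Q := by
    rw [Finset.set_biUnion_finset_image]
  have h1 := mul_measure_biUnion_finset_le (σ := σ) (τ := τ) (t := t)
    (F.image fun q : S => ratQ q) (by
      intro Q hQ
      obtain ⟨q, _, rfl⟩ := Finset.mem_image.mp hQ
      exact h q q.2)
  rw [← e2] at h1
  refine h1.trans ?_
  gcongr
  exact e ▸ Set.subset_iUnion (fun F : Finset S => ⋃ q ∈ F, arc (ratQ q)) F

/-! ### Maximal functions and derivatives along arcs -/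

/-- The arc defined by `Q` has diameter at most `δ`. -/
def Small (δ : ℝ) (Q : ℝ × ℝ × ℝ) : Prop := ∀ x ∈ arc Q, ∀ y ∈ arc Q, dist x y ≤ δ

/-- The maximal ratio `σ(I) / τ(I)` over arcs `I ∋ x` of diameter at most `δ`. -/
def Dsup (σ τ : Measure RP) (δ : ℝ) (x : RP) : ENNReal :=
  ⨆ q : ℚ × ℚ × ℚ, ⨆ (_ : x ∈ arc (ratQ q) ∧ Small δ (ratQ q)),
    σ (arc (ratQ q)) / τ (arc (ratQ q))

/-- The upper derivative of `σ` with respect to `τ` along arcs. -/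
def D0 (σ τ : Measure RP) (x : RP) : ENNReal := ⨅ n : ℕ, Dsup σ τ (1 / ((n : ℝ) + 1)) x

lemma Small.mono {δ δ' : ℝ} (h : δ ≤ δ') {Q : ℝ × ℝ × ℝ} (hQ : Small δ Q) : Small δ' Q :=
  fun x hx y hy => (hQ x hx y hy).trans h

lemma small_two (Q : ℝ × ℝ × ℝ) : Small 2 Q := fun x _ y _ => dist_le_two x y

lemma Dsup_mono (σ τ : Measure RP) {δ δ' : ℝ} (h : δ ≤ δ') (x : RP) :
    Dsup σ τ δ x ≤ Dsup σ τ δ' x :=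
  iSup_mono fun _ => iSup_mono' fun hq => ⟨⟨hq.1, hq.2.mono h⟩, le_rfl⟩

lemma le_Dsup_ratQ (σ τ : Measure RP) {δ : ℝ} {x : RP} {q : ℚ × ℚ × ℚ} (hx : x ∈ arc (ratQ q))
    (hq : Small δ (ratQ q)) : σ (arc (ratQ q)) / τ (arc (ratQ q)) ≤ Dsup σ τ δ x :=
  le_iSup₂_of_le q ⟨hx, hq⟩ le_rfl

lemma lt_Dsup_iff {σ τ : Measure RP} {δ : ℝ} {x : RP} {t : ENNReal} :
    t < Dsup σ τ δ x ↔ ∃ q : ℚ × ℚ × ℚ, (x ∈ arc (ratQ q) ∧ Small δ (ratQ q)) ∧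
      t < σ (arc (ratQ q)) / τ (arc (ratQ q)) := by
  simp only [Dsup, lt_iSup_iff, exists_prop]

/-- The weak-type maximal inequality. -/
lemma mul_measure_lt_Dsup_le (σ τ : Measure RP) (δ : ℝ) (t : ENNReal) :
    t * τ {x | t < Dsup σ τ δ x} ≤ 2 * σ Set.univ := by
  set S : Set (ℚ × ℚ × ℚ) := {q | t ≤ σ (arc (ratQ q)) / τ (arc (ratQ q))} with hS
  have h1 := mul_measure_biUnion_le (σ := σ) (τ := τ) (t := t) S
    fun q hq => ENNReal.mul_le_of_le_div hq
  have h2 : {x | t < Dsup σ τ δ x} ⊆ ⋃ q ∈ S, arc (ratQ q) := by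
    intro x hx
    obtain ⟨q, hq, hlt⟩ := lt_Dsup_iff.mp hx
    exact Set.mem_biUnion (show q ∈ S from hlt.le) hq.1
  calc t * τ {x | t < Dsup σ τ δ x} ≤ t * τ (⋃ q ∈ S, arc (ratQ q)) := by gcongr
    _ ≤ _ := h1
    _ ≤ 2 * σ Set.univ := by gcongr; exact Set.subset_univ _

/-- A measure has zero density at almost every point of a null set. -/
lemma ae_D0_eq_zero (σ τ : Measure RP) [IsFiniteMeasure σ] [IsFiniteMeasure τ] {E : Set RP}
    (hE : σ E = 0) : ∀ᵐ x ∂τ, x ∈ E → D0 σ τ x = 0 := by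
  have key : ∀ k : ℕ, τ {x | x ∈ E ∧ ((k : ENNReal) + 1)⁻¹ < D0 σ τ x} = 0 := by
    intro k
    set t : ENNReal := ((k : ENNReal) + 1)⁻¹ with ht
    have ht0 : t ≠ 0 := by simp [ht]
    have hle : ∀ ε : ENNReal, 0 < ε → t * τ {x | x ∈ E ∧ t < D0 σ τ x} ≤ 2 * ε := by
      intro ε hε
      -- Sufficiently short arcs through points of E stay inside U, so σ can be replaced by its
      -- small mass on U.
      obtain ⟨U, hEU, hU, hσU⟩ := E.exists_isOpen_lt_of_lt ε (hE ▸ hε)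
      set S : Set (ℚ × ℚ × ℚ) :=
        {q | t ≤ σ (arc (ratQ q)) / τ (arc (ratQ q)) ∧ arc (ratQ q) ⊆ U} with hS
      have h1 := mul_measure_biUnion_le (σ := σ) (τ := τ) (t := t) S
        fun q hq => ENNReal.mul_le_of_le_div hq.1
      have h2 : {x | x ∈ E ∧ t < D0 σ τ x} ⊆ ⋃ q ∈ S, arc (ratQ q) := by
        rintro x ⟨hxE, hx⟩
        obtain ⟨ρ, hρ, hball⟩ := Metric.isOpen_iff.mp hU x (hEU hxE)
        obtain ⟨n, hn⟩ := exists_nat_one_div_lt hρ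
        obtain ⟨q, hq, hlt⟩ := lt_Dsup_iff.mp (hx.trans_le (iInf_le _ n))
        refine Set.mem_biUnion (show q ∈ S from ⟨hlt.le, fun y hy => hball ?_⟩) hq.1
        exact (hq.2 y hy x hq.1).trans_lt hn
      calc t * τ {x | x ∈ E ∧ t < D0 σ τ x} ≤ t * τ (⋃ q ∈ S, arc (ratQ q)) := by gcongr
        _ ≤ _ := h1
        _ ≤ 2 * σ U := by
          gcongr
          exact Set.iUnion₂_subset fun q hq => hq.2
        _ ≤ 2 * ε := by gcongr
    have h0 : t * τ {x | x ∈ E ∧ t < D0 σ τ x} = 0 := by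
      refine le_antisymm (le_of_forall_gt fun c hc => ?_) zero_le
      rcases eq_or_ne c ⊤ with rfl | hct
      · exact (hle 1 one_pos).trans_lt (by simp)
      · refine (hle (c / 4) (ENNReal.div_pos hc.ne' (by simp))).trans_lt ?_
        rw [← mul_div_assoc, mul_comm, mul_div_assoc]
        have : (2 / 4 : ENNReal) < 1 := by
          rw [ENNReal.div_lt_iff (by simp) (by simp)]; norm_num
        calc c * (2 / 4) < c * 1 := ENNReal.mul_lt_mul_right hc.ne' hct this
          _ = c := mul_one c
    exact (mul_eq_zero.mp h0).resolve_left ht0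
  have hall : ∀ᵐ x ∂τ, ∀ k : ℕ, ¬ (x ∈ E ∧ ((k : ENNReal) + 1)⁻¹ < D0 σ τ x) :=
    ae_all_iff.mpr fun k => measure_eq_zero_iff_ae_notMem.mp (key k)
  filter_upwards [hall] with x hx hxE
  by_contra h0
  obtain ⟨k, hk⟩ := ENNReal.exists_inv_nat_lt h0
  refine hx k ⟨hxE, lt_of_le_of_lt ?_ hk⟩
  exact ENNReal.inv_le_inv.mpr le_self_add

lemma Dsup_le_add {σ σ' τ : Measure RP} {k : ENNReal} {δ : ℝ}
    (h : ∀ Q, σ (arc Q) ≤ σ' (arc Q) + k * τ (arc Q)) (x : RP) :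
    Dsup σ τ δ x ≤ Dsup σ' τ δ x + k := by
  refine iSup₂_le fun q hq => ?_
  calc σ (arc (ratQ q)) / τ (arc (ratQ q))
      ≤ (σ' (arc (ratQ q)) + k * τ (arc (ratQ q))) / τ (arc (ratQ q)) := by gcongr; exact h _
    _ = σ' (arc (ratQ q)) / τ (arc (ratQ q)) + k * (τ (arc (ratQ q)) / τ (arc (ratQ q))) := by
        rw [ENNReal.add_div, mul_div_assoc]
    _ ≤ Dsup σ' τ δ x + k * 1 := by
        gcongr
        · exact le_Dsup_ratQ σ' τ hq.1 hq.2
        · exact ENNReal.div_self_le_one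
    _ = _ := by rw [mul_one]

lemma D0_le_of_D0_eq_zero {σ σ' τ : Measure RP} {k : ENNReal}
    (h : ∀ Q, σ (arc Q) ≤ σ' (arc Q) + k * τ (arc Q)) {x : RP} (hx : D0 σ' τ x = 0) :
    D0 σ τ x ≤ k := by
  calc D0 σ τ x ≤ ⨅ n : ℕ, (Dsup σ' τ (1 / ((n : ℝ) + 1)) x + k) :=
        iInf_mono fun n => Dsup_le_add h x
    _ = D0 σ' τ x + k := ENNReal.iInf_add.symm
    _ = k := by rw [hx, zero_add]

/-- For each rational level k, the part of η on {φ < k} is at most kν, and the remaining part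
vanishes on that set, so it has zero density at almost every point of it. -/
lemma ae_D0_le_rnDeriv {η ν : Measure RP} [IsFiniteMeasure η] [IsFiniteMeasure ν] (h : η ≪ ν) :
    ∀ᵐ x ∂ν, D0 η ν x ≤ η.rnDeriv ν x := by
  set φ := η.rnDeriv ν with hφ
  have hφm : Measurable φ := Measure.measurable_rnDeriv η ν
  have hη : ν.withDensity φ = η := Measure.withDensity_rnDeriv_eq η ν h
  have hall : ∀ᵐ x ∂ν, ∀ c : ℚ, φ x < ((c : ℝ).toNNReal : ENNReal) →
      D0 η ν x ≤ ((c : ℝ).toNNReal : ENNReal) := by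
    refine ae_all_iff.mpr fun c => ?_
    set k : ENNReal := ((c : ℝ).toNNReal : ENNReal)
    have hm : MeasurableSet {x | φ x < k} := measurableSet_lt hφm measurable_const
    have h1 := ae_D0_eq_zero (η.restrict {x | φ x < k}ᶜ) ν (E := {x | φ x < k})
      (by rw [Measure.restrict_apply hm]; simp)
    filter_upwards [h1] with x hx hxk
    refine D0_le_of_D0_eq_zero (σ' := η.restrict {x | φ x < k}ᶜ) (fun Q => ?_) (hx hxk)
    rw [Measure.restrict_apply (measurableSet_arc Q),
      ← measure_inter_add_sdiff (arc Q) hm, add_comm, ← Set.sdiff_eq]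
    gcongr
    conv_lhs => rw [← hη]
    rw [withDensity_apply _ ((measurableSet_arc Q).inter hm)]
    calc ∫⁻ a in arc Q ∩ {x | φ x < k}, φ a ∂ν ≤ ∫⁻ a in arc Q ∩ {x | φ x < k}, k ∂ν :=
          setLIntegral_mono measurable_const fun a ha => le_of_lt ha.2
      _ = k * ν (arc Q ∩ {x | φ x < k}) := setLIntegral_const _ _
      _ ≤ k * ν (arc Q) := by gcongr; exact Set.inter_subset_left
  filter_upwards [hall] with x hx
  refine le_of_forall_gt_imp_ge_of_dense fun c hc => ?_
  obtain ⟨q, _, hq1, hq2⟩ := ENNReal.lt_iff_exists_rat_btwn.mp hc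
  exact (hx q hq1).trans hq2.le

/-- Here the part of ν on {φ > k} is at most η / k, and the remaining part is null for ν on that
set. -/
lemma ae_D0_le_inv_rnDeriv {η ν : Measure RP} [IsFiniteMeasure η] [IsFiniteMeasure ν]
    (h : η ≪ ν) : ∀ᵐ x ∂η, D0 ν η x ≤ (η.rnDeriv ν x)⁻¹ := by
  set φ := η.rnDeriv ν with hφ
  have hφm : Measurable φ := Measure.measurable_rnDeriv η ν
  have hη : ν.withDensity φ = η := Measure.withDensity_rnDeriv_eq η ν h
  have hall : ∀ᵐ x ∂η, ∀ c : ℚ, ((c : ℝ).toNNReal : ENNReal) < φ x →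
      D0 ν η x ≤ ((c : ℝ).toNNReal : ENNReal)⁻¹ := by
    refine ae_all_iff.mpr fun c => ?_
    set k : ENNReal := ((c : ℝ).toNNReal : ENNReal)
    rcases eq_or_ne k 0 with hk0 | hk0
    · exact ae_of_all _ fun x _ => by rw [hk0, ENNReal.inv_zero]; exact le_top
    have hkt : k ≠ ⊤ := ENNReal.coe_ne_top
    have hm : MeasurableSet {x | k < φ x} := measurableSet_lt measurable_const hφm
    have h1 := ae_D0_eq_zero (ν.restrict {x | k < φ x}ᶜ) η (E := {x | k < φ x})
      (by rw [Measure.restrict_apply hm]; simp)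
    filter_upwards [h1] with x hx hxk
    refine D0_le_of_D0_eq_zero (σ' := ν.restrict {x | k < φ x}ᶜ) (fun Q => ?_) (hx hxk)
    rw [Measure.restrict_apply (measurableSet_arc Q),
      ← measure_inter_add_sdiff (arc Q) hm, add_comm, ← Set.sdiff_eq]
    gcongr
    rw [← ENNReal.mul_le_iff_le_inv hk0 hkt]
    conv_rhs => rw [← hη]
    refine le_trans ?_ (measure_mono (Set.inter_subset_left (t := {x | k < φ x})))
    rw [withDensity_apply _ ((measurableSet_arc Q).inter hm)]
    calc k * ν (arc Q ∩ {x | k < φ x}) = ∫⁻ a in arc Q ∩ {x | k < φ x}, k ∂ν :=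
          (setLIntegral_const _ _).symm
      _ ≤ ∫⁻ a in arc Q ∩ {x | k < φ x}, φ a ∂ν :=
          setLIntegral_mono hφm fun a ha => le_of_lt ha.2
  filter_upwards [hall] with x hx
  rw [← inv_inv (D0 ν η x), ENNReal.inv_le_inv]
  refine le_of_forall_lt_imp_le_of_dense fun c hc => ?_
  obtain ⟨q, _, hq1, hq2⟩ := ENNReal.lt_iff_exists_rat_btwn.mp hc
  refine hq1.le.trans ?_
  rw [← ENNReal.inv_le_inv, inv_inv]
  exact hx q hq2

lemma exists_rat_approx (Q : ℝ × ℝ × ℝ) (n : ℕ) : ∃ q : ℚ × ℚ × ℚ, ∀ x,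
    nqf (ratQ q) x < nqf Q x ∧ nqf Q x < nqf (ratQ q) x + 4 / ((n : ℝ) + 1) := by
  have hn : (0 : ℝ) < 1 / ((n : ℝ) + 1) := by positivity
  set d := 1 / ((n : ℝ) + 1) with hd
  -- Lowering the outer coefficients by 2d to 3d lowers the normalized form by 2d to 3d, since their
  -- weights add up to 1. An error of at most d in the middle coefficient costs at most d / 2, so
  -- the total drop lies strictly between 0 and 4d.
  obtain ⟨a, ha1, ha2⟩ := exists_rat_btwn (show Q.1 - 3 * d < Q.1 - 2 * d by linarith)
  obtain ⟨b, hb1, hb2⟩ := exists_rat_btwn (show Q.2.1 - d < Q.2.1 + d by linarith)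
  obtain ⟨c, hc1, hc2⟩ := exists_rat_btwn (show Q.2.2 - 3 * d < Q.2.2 - 2 * d by linarith)
  refine ⟨(a, b, c), fun x => ?_⟩
  have e4 : 4 / ((n : ℝ) + 1) = 4 * d := by rw [hd]; ring
  have hx := eR_sq_add_eI_sq x
  have h1 := abs_le.mp (abs_eR_le x)
  have h2 := abs_le.mp (abs_eI_le x)
  rw [e4, nqf_eq, nqf_eq]
  change a * ((1 + eR x) / 2) + b * (eI x / 2) + c * ((1 - eR x) / 2) < Q.1 * ((1 + eR x) / 2) + Q.2.1 * (eI x / 2) + Q.2.2 * ((1 - eR x) / 2) ∧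
    Q.1 * ((1 + eR x) / 2) + Q.2.1 * (eI x / 2) + Q.2.2 * ((1 - eR x) / 2) <
    a * ((1 + eR x) / 2) + b * (eI x / 2) + c * ((1 - eR x) / 2) + 4 * d
  have p1 : 0 ≤ (1 + eR x) / 2 := by linarith
  have p2 : 0 ≤ (1 - eR x) / 2 := by linarith
  have hb : |Q.2.1 - b| ≤ d := abs_le.mpr ⟨by linarith, by linarith⟩
  have hbe : |(Q.2.1 - b) * (eI x / 2)| ≤ d / 2 := by
    rw [abs_mul, abs_div, abs_two]
    have := mul_le_mul hb (abs_eI_le x) (abs_nonneg _) hn.le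
    linarith
  have hbe' := abs_le.mp hbe
  have q1 := mul_le_mul_of_nonneg_right (show 2 * d ≤ Q.1 - a by linarith) p1
  have q2 := mul_le_mul_of_nonneg_right (show 2 * d ≤ Q.2.2 - c by linarith) p2
  have q3 := mul_le_mul_of_nonneg_right (show Q.1 - a ≤ 3 * d by linarith) p1
  have q4 := mul_le_mul_of_nonneg_right (show Q.2.2 - c ≤ 3 * d by linarith) p2
  constructor <;> nlinarith

/-- The maximal ratio over rational arcs controls the ratio over all arcs. -/
lemma measure_arc_le_Dsup_mul {σ τ : Measure RP} [IsFiniteMeasure τ] {δ : ℝ} {x : RP}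
    {Q : ℝ × ℝ × ℝ} (hx : x ∈ arc Q) (hQ : Small δ Q) (hfin : Dsup σ τ δ x ≠ ⊤) :
    σ (arc Q) ≤ Dsup σ τ δ x * τ (arc Q) := by
  set K : ℕ → Set RP := fun n => {y | 4 / ((n : ℝ) + 1) ≤ nqf Q y} with hK
  have hmono : Monotone K := by
    intro n m hnm y hy
    have h1 : 4 / ((n : ℝ) + 1) ≤ nqf Q y := hy
    refine le_trans ?_ h1
    gcongr
  have hU : arc Q = ⋃ n, K n := by
    ext y
    simp only [arc, hK, Set.mem_iUnion, Set.mem_ofPred_eq]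
    constructor
    · intro hy
      obtain ⟨n, hn⟩ := exists_nat_one_div_lt (show 0 < nqf Q y / 4 by positivity)
      refine ⟨n, ?_⟩
      have : 4 / ((n : ℝ) + 1) = 4 * (1 / ((n : ℝ) + 1)) := by ring
      rw [this]; linarith
    · rintro ⟨n, hn⟩
      exact lt_of_lt_of_le (by positivity) hn
  have hlim : Tendsto (fun n => σ (K n)) atTop (𝓝 (σ (arc Q))) := by
    rw [hU]; exact tendsto_measure_iUnion_atTop hmono
  obtain ⟨N, hN⟩ := Set.mem_iUnion.mp (hU ▸ hx)
  refine le_of_tendsto hlim ?_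
  filter_upwards [eventually_ge_atTop N] with n hn
  obtain ⟨q, hq⟩ := exists_rat_approx Q n
  have hsub : arc (ratQ q) ⊆ arc Q := fun y hy => lt_trans hy (hq y).1
  have hKq : K n ⊆ arc (ratQ q) := fun y hy => by
    have h1 := (hq y).2
    have h2 : 4 / ((n : ℝ) + 1) ≤ nqf Q y := hy
    simp only [arc, Set.mem_ofPred_eq]
    linarith
  have h1 := le_Dsup_ratQ σ τ (hKq (hmono hn hN))
    (fun y hy z hz => hQ y (hsub hy) z (hsub hz) : Small δ (ratQ q))
  have h2 : σ (arc (ratQ q)) ≤ Dsup σ τ δ x * τ (arc (ratQ q)) :=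
    (ENNReal.div_le_iff_le_mul (Or.inr hfin) (Or.inl (measure_ne_top _ _))).mp h1
  calc σ (K n) ≤ σ (arc (ratQ q)) := measure_mono hKq
    _ ≤ _ := h2
    _ ≤ _ := by gcongr

lemma exists_rat_small_arc (x : RP) {δ : ℝ} (hδ : 0 < δ) :
    ∃ q, x ∈ arc (ratQ q) ∧ Small δ (ratQ q) := by
  obtain ⟨Q, hQ⟩ := exists_arc_eq_ball x (half_pos hδ)
  have hx : x ∈ arc Q := hQ ▸ Metric.mem_ball_self (half_pos hδ)
  obtain ⟨n, hn⟩ := exists_nat_one_div_lt (show 0 < nqf Q x / 4 from div_pos hx (by norm_num))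
  obtain ⟨q, hq⟩ := exists_rat_approx Q n
  have hsub : arc (ratQ q) ⊆ arc Q := fun y hy => lt_trans hy (hq y).1
  refine ⟨q, ?_, fun y hy z hz => ?_⟩
  · have h1 := (hq x).2
    have : 4 / ((n : ℝ) + 1) = 4 * (1 / ((n : ℝ) + 1)) := by ring
    rw [this] at h1
    simp only [arc, Set.mem_ofPred_eq]
    linarith
  · have hy' := hQ ▸ hsub hy
    have hz' := hQ ▸ hsub hz
    rw [Metric.mem_ball] at hy' hz'
    linarith [dist_triangle_right y z x]

/-- A single short rational arc through x competes in both suprema; the support hypotheses keep its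
two masses positive. -/
lemma inv_Dsup_le {σ τ : Measure RP} [IsFiniteMeasure σ] [IsFiniteMeasure τ] {δ : ℝ} (hδ : 0 < δ)
    {x : RP} (hσ : x ∈ σ.support) (hτ : x ∈ τ.support) : (Dsup σ τ δ x)⁻¹ ≤ Dsup τ σ δ x := by
  obtain ⟨q, hxq, hq⟩ := exists_rat_small_arc x hδ
  have hn := (isOpen_arc (ratQ q)).mem_nhds hxq
  have h1 : σ (arc (ratQ q)) ≠ 0 := ((Measure.mem_support_iff_forall x).mp hσ _ hn).ne'
  have h2 : τ (arc (ratQ q)) ≠ 0 := ((Measure.mem_support_iff_forall x).mp hτ _ hn).ne'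
  calc (Dsup σ τ δ x)⁻¹ ≤ (σ (arc (ratQ q)) / τ (arc (ratQ q)))⁻¹ :=
        ENNReal.inv_le_inv.mpr (le_Dsup_ratQ σ τ hxq hq)
    _ = τ (arc (ratQ q)) / σ (arc (ratQ q)) :=
        ENNReal.inv_div (Or.inl (measure_ne_top _ _)) (Or.inl h2)
    _ ≤ _ := le_Dsup_ratQ τ σ hxq hq

lemma inv_D0_le {σ τ : Measure RP} [IsFiniteMeasure σ] [IsFiniteMeasure τ]
    {x : RP} (hσ : x ∈ σ.support) (hτ : x ∈ τ.support) : (D0 σ τ x)⁻¹ ≤ D0 τ σ x := by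
  rw [D0, ENNReal.inv_iInf]
  refine iSup_le fun n => le_iInf fun m => ?_
  have hk : ∀ a b : ℕ, a ≤ b → 1 / ((b : ℝ) + 1) ≤ 1 / ((a : ℝ) + 1) := fun a b hab => by gcongr
  calc (Dsup σ τ (1 / ((n : ℝ) + 1)) x)⁻¹ ≤ (Dsup σ τ (1 / (((max n m : ℕ) : ℝ) + 1)) x)⁻¹ :=
        ENNReal.inv_le_inv.mpr (Dsup_mono σ τ (hk _ _ (le_max_left _ _)) x)
    _ ≤ Dsup τ σ (1 / (((max n m : ℕ) : ℝ) + 1)) x := inv_Dsup_le (by positivity) hσ hτ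
    _ ≤ _ := Dsup_mono τ σ (hk _ _ (le_max_right _ _)) x

/-- For absolutely continuous measures the derivatives along arcs are the Radon-Nikodym ones. -/
lemma ae_D0_eq {η ν : Measure RP} [IsFiniteMeasure η] [IsFiniteMeasure ν] (h : η ≪ ν) :
    ∀ᵐ x ∂η, D0 η ν x = η.rnDeriv ν x ∧ D0 ν η x = (η.rnDeriv ν x)⁻¹ := by
  filter_upwards [h.ae_le (ae_D0_le_rnDeriv h), ae_D0_le_inv_rnDeriv h,
    Measure.support_mem_ae (μ := η), h.ae_le (Measure.support_mem_ae (μ := ν))] with x h1 h2 h3 h4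
  have h5 := inv_D0_le (σ := ν) (τ := η) h4 h3
  refine ⟨le_antisymm h1 ?_, le_antisymm h2 ?_⟩
  · refine le_trans ?_ h5
    rw [← inv_inv (η.rnDeriv ν x)]
    exact ENNReal.inv_le_inv.mpr h2
  · rw [← inv_inv (D0 ν η x)]
    exact ENNReal.inv_le_inv.mpr (h5.trans h1)

/-- Restricting `Dsup` to rational arcs makes it a countable supremum, hence jointly measurable in
the matrix and the point. -/
lemma measurable_Dsup_of {X : Type*} [MeasurableSpace X] {σ τ : X → Measure RP} {p : X → RP}
    (hσ : ∀ E, MeasurableSet E → Measurable fun a => σ a E)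
    (hτ : ∀ E, MeasurableSet E → Measurable fun a => τ a E) (hp : Measurable p) (δ : ℝ) :
    Measurable fun a => Dsup (σ a) (τ a) δ (p a) := by
  classical
  refine Measurable.iSup fun q => ?_
  simp only [iSup_eq_if]
  refine Measurable.ite ?_ ((hσ _ (measurableSet_arc _)).div (hτ _ (measurableSet_arc _)))
    measurable_const
  by_cases hq : Small δ (ratQ q)
  · simp only [hq, and_true]
    exact hp (measurableSet_arc _)
  · simp [hq]

lemma measurable_Dsup_push_left (ν : Measure RP) [IsFiniteMeasure ν] (δ : ℝ) :
    Measurable fun p : G × RP => Dsup (push p.1 ν) ν δ p.2 :=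
  measurable_Dsup_of (fun _ hE => (measurable_push_apply ν hE).comp measurable_fst)
    (fun _ _ => measurable_const) measurable_snd δ

lemma measurable_Dsup_push_right (ν : Measure RP) [IsFiniteMeasure ν] (δ : ℝ) :
    Measurable fun p : G × RP => Dsup ν (push p.1 ν) δ p.2 :=
  measurable_Dsup_of (fun _ _ => measurable_const)
    (fun _ hE => (measurable_push_apply ν hE).comp measurable_fst) measurable_snd δ

section

/-! ### The Lyapunov exponent -/

/-- The logarithm of the squared Hilbert–Schmidt norm. -/
def logN (A : G) : ℝ := Real.logb 2 (N2 A)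

/-- The logarithmic expansion of the squared norm in a given direction. -/
def logExp (A : G) (x : RP) : ℝ := Real.logb 2 (nrm2 A x)

lemma one_le_logN (A : G) : 1 ≤ logN A := by
  rw [logN, Real.le_logb_iff_rpow_le one_lt_two (N2_pos A), Real.rpow_one]
  exact two_le_N2 A

lemma logN_mul_le (A B : G) : logN (A * B) ≤ logN A + logN B := by
  rw [logN, logN, logN, ← Real.logb_mul (N2_pos A).ne' (N2_pos B).ne']
  exact Real.logb_le_logb_of_le one_lt_two (N2_pos _) (N2_mul_le A B)

lemma logN_one : logN 1 = 1 := by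
  have : N2 1 = 2 := by simp [N2]; norm_num
  rw [logN, this, Real.logb_self_eq_one one_lt_two]

lemma logN_inv (A : G) : logN A⁻¹ = logN A := by rw [logN, N2_inv, logN]

lemma measurable_logb_two : Measurable (Real.logb 2) := Real.measurable_log.div_const _

lemma measurable_logN : Measurable logN := measurable_logb_two.comp continuous_N2.measurable

lemma measurable_logExp : Measurable fun p : G × RP => logExp p.1 p.2 :=
  measurable_logb_two.comp continuous_nrm2.measurable

lemma logExp_mul (A B : G) (x : RP) : logExp (A * B) x = logExp A (B • x) + logExp B x := by
  rw [logExp, nrm2_mul, Real.logb_mul (nrm2_pos _ _).ne' (nrm2_pos _ _).ne', logExp, logExp]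

lemma logExp_le (A : G) (x : RP) : logExp A x ≤ logN A :=
  Real.logb_le_logb_of_le one_lt_two (nrm2_pos _ _) (nrm2_le_N2 A x)

lemma neg_logN_le (A : G) (x : RP) : -logN A ≤ logExp A x := by
  have h := Real.logb_le_logb_of_le one_lt_two one_pos (one_le_N2_mul_nrm2 A x)
  rw [Real.logb_one, Real.logb_mul (N2_pos A).ne' (nrm2_pos A x).ne'] at h
  rw [logN, logExp]
  linarith

lemma abs_logExp_le (A : G) (x : RP) : |logExp A x| ≤ logN A :=
  abs_le.mpr ⟨neg_logN_le A x, logExp_le A x⟩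

lemma opNorm_pos (A : G) : 0 < opNorm A := by
  have h1 := N2_le_opNorm_sq A
  have h2 := two_le_N2 A
  have h3 : 0 ≤ opNorm A := norm_nonneg _
  rcases h3.lt_or_eq with h | h
  · exact h
  · rw [← h] at h1
    norm_num at h1
    linarith

lemma two_mul_logb_opNorm_le (A : G) : 2 * Real.logb 2 (opNorm A) ≤ logN A := by
  have h := Real.logb_le_logb_of_le one_lt_two (pow_pos (opNorm_pos A) 2) (opNorm_sq_le_N2 A)
  rwa [Real.logb_pow] at h

lemma logN_le (A : G) : logN A ≤ 1 + 2 * Real.logb 2 (opNorm A) := by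
  have h := Real.logb_le_logb_of_le one_lt_two (N2_pos A) (N2_le_opNorm_sq A)
  rw [Real.logb_mul two_ne_zero (pow_pos (opNorm_pos A) 2).ne', Real.logb_pow,
    Real.logb_self_eq_one one_lt_two] at h
  exact h

lemma integrable_logN {μ : Measure G} [IsProbabilityMeasure μ]
    (h : Integrable (fun A : G => Real.logb 2 (opNorm A)) μ) : Integrable logN μ := by
  refine ((integrable_const 1).add (h.const_mul 2)).mono' measurable_logN.aestronglyMeasurable
    (ae_of_all _ fun A => ?_)
  rw [Real.norm_of_nonneg (by linarith [one_le_logN A])]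
  exact logN_le A

/-- The sum of the logarithmic norms of the first `n` factors, plus one. -/
def logSum (n : ℕ) (ω : ℕ → G) : ℝ := 1 + ∑ i ∈ Finset.range n, logN (ω i)

lemma logN_rp_le (n : ℕ) (ω : ℕ → G) : logN (rp n ω) ≤ logSum n ω := by
  induction n with
  | zero => simp [rp, logN_one, logSum]
  | succ n ih =>
    rw [rp_succ, logSum, Finset.sum_range_succ]
    rw [logSum] at ih
    linarith [logN_mul_le (rp n ω) (ω n)]

lemma logSum_mono {n m : ℕ} (h : n ≤ m) (ω : ℕ → G) : logSum n ω ≤ logSum m ω := by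
  rw [logSum, logSum]
  have := Finset.sum_le_sum_of_subset_of_nonneg (Finset.range_mono h)
    (f := fun i => logN (ω i)) fun i _ _ => by linarith [one_le_logN (ω i)]
  linarith

variable {μ : Measure G} [IsProbabilityMeasure μ] {ν : Measure RP} [IsProbabilityMeasure ν]

lemma measurePreserving_eval (n : ℕ) : MeasurePreserving (fun ω : ℕ → G => ω n) (law μ) μ :=
  measurePreserving_eval_infinitePi (fun _ : ℕ => μ) n

lemma measurable_logSum (n : ℕ) : Measurable (logSum n) := by
  refine measurable_const.add (Finset.measurable_sum _ fun i _ => ?_)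
  exact measurable_logN.comp (measurable_pi_apply i)

lemma integrable_logSum (hμ : Integrable logN μ) (n : ℕ) : Integrable (logSum n) (law μ) := by
  refine (integrable_const 1).add (integrable_finsetSum _ fun i _ => ?_)
  exact (measurePreserving_eval i).integrable_comp_of_integrable hμ

lemma integrable_logN_rp (hμ : Integrable logN μ) (n : ℕ) :
    Integrable (fun ω => logN (rp n ω)) (law μ) := by
  refine (integrable_logSum hμ n).mono' (measurable_logN.comp (measurable_rp n)).aestronglyMeasurable
    (ae_of_all _ fun ω => ?_)
  rw [Real.norm_of_nonneg (by linarith [one_le_logN (rp n ω)])]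
  exact logN_rp_le n ω

lemma integrable_logN_convPow (hμ : Integrable logN μ) (n : ℕ) : Integrable logN (convPow μ n) :=
  ((measurePreserving_rp n).integrable_comp measurable_logN.aestronglyMeasurable).mp
    (integrable_logN_rp hμ n)

/-- The expected logarithmic norm of a product of `n` independent matrices. -/
def meanLog (μ : Measure G) (n : ℕ) : ℝ := ∫ g, logN g ∂(convPow μ n)

lemma integral_logN_rp {μ : Measure G} (n : ℕ) : ∫ ω, logN (rp n ω) ∂(law μ) = meanLog μ n :=
  integral_comp_measurePreserving (measurePreserving_rp n) measurable_logN.aestronglyMeasurable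

lemma subadditive_meanLog (hμ : Integrable logN μ) : Subadditive (meanLog μ) := by
  intro n m
  have hT := (measurePreserving_shift μ).iterate n
  have i1 := integrable_logN_rp hμ m
  have i2 : Integrable (fun ω => logN (rp m (shift^[n] ω))) (law μ) :=
    hT.integrable_comp_of_integrable i1
  have e : ∫ ω, logN (rp m (shift^[n] ω)) ∂(law μ) = meanLog μ m :=
    (integral_comp_measurePreserving (f := fun ω => logN (rp m ω)) hT i1.aestronglyMeasurable).trans
      (integral_logN_rp m)
  rw [← integral_logN_rp, ← integral_logN_rp n, ← e, ← integral_add (integrable_logN_rp hμ n) i2]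
  refine integral_mono (integrable_logN_rp hμ _) ((integrable_logN_rp hμ n).add i2) fun ω => ?_
  dsimp only
  rw [rp_add]
  exact logN_mul_le _ _

lemma exists_tendsto_meanLog (hμ : Integrable logN μ) :
    ∃ Λ : ℝ, 0 ≤ Λ ∧ Tendsto (fun n : ℕ => meanLog μ n / n) atTop (𝓝 Λ) := by
  have h0 : ∀ n : ℕ, 0 ≤ meanLog μ n / n := fun n => div_nonneg
    (integral_nonneg fun g => zero_le_one.trans (one_le_logN g)) (Nat.cast_nonneg n)
  have h := (subadditive_meanLog hμ).tendsto_lim ⟨0, by rintro _ ⟨n, rfl⟩; exact h0 n⟩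
  exact ⟨_, ge_of_tendsto' h h0, h⟩

lemma logN_rp_mul_le (m q : ℕ) (ω : ℕ → G) :
    logN (rp (m * q) ω) ≤ 1 + birkhoffSum (shift^[m]) (fun ω => logN (rp m ω)) q ω := by
  induction q with
  | zero => simp [rp, logN_one]
  | succ q ih =>
    rw [Nat.mul_succ, rp_add, birkhoffSum_succ, ← Function.iterate_mul]
    linarith [logN_mul_le (rp (m * q) ω) (rp m (shift^[m * q] ω))]

/-- The easy half of the subadditive ergodic theorem. A block length m is chosen with mean below c'
m, and Birkhoff's theorem for the m-th power of the shift controls the full blocks. The remainder of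
fewer than m factors is bounded by `logSum m`, which is sublinear along the orbit. -/
lemma ae_eventually_logN_rp_le (hμ : Integrable logN μ) {Λ c : ℝ}
    (hΛ : Tendsto (fun n : ℕ => meanLog μ n / n) atTop (𝓝 Λ)) (hΛ0 : 0 ≤ Λ) (hc : Λ < c) :
    ∀ᵐ ω ∂(law μ), ∀ᶠ n : ℕ in atTop, logN (rp n ω) ≤ n * c := by
  obtain ⟨c', h1, h2⟩ := exists_between hc
  obtain ⟨m, hm, hm0⟩ := ((hΛ.eventually (gt_mem_nhds h1)).and (eventually_gt_atTop 0)).exists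
  have hm0' : (0 : ℝ) < m := by exact_mod_cast hm0
  have hE := ergodic_shift_iterate μ hm0
  have hcm : ∫ ω, logN (rp m ω) ∂(law μ) < c' * m := by
    rw [integral_logN_rp]
    exact (div_lt_iff₀ hm0').mp hm
  filter_upwards [ae_eventually_birkhoffSum_le hE (measurable_logN.comp (measurable_rp m))
      (integrable_logN_rp hμ m) hcm,
    ae_tendsto_comp_iterate_div hE (measurable_logSum m) (integrable_logSum hμ m)] with ω hω1 hω2
  have hε : 0 < m * (c - c') / 2 := by have := sub_pos.mpr h2; positivity
  have hq : Tendsto (fun n : ℕ => n / m) atTop atTop := Nat.tendsto_div_const_atTop hm0.ne'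
  have hbig : ∀ᶠ q : ℕ in atTop, (1 : ℝ) ≤ q * (m * (c - c') / 2) :=
    (tendsto_natCast_atTop_atTop.atTop_mul_const hε).eventually_ge_atTop 1
  filter_upwards [hq.eventually hω1, hq.eventually (hω2.eventually (gt_mem_nhds hε)),
    hq.eventually hbig, hq.eventually (eventually_gt_atTop 0)] with n e1 e2 e3 e4
  set q := n / m with hqdef
  have hn : n = m * q + n % m := (Nat.div_add_mod n m).symm
  have hq0 : (0 : ℝ) < q := by exact_mod_cast e4
  rw [div_lt_iff₀ hq0] at e2
  have e5 : logN (rp n ω) ≤ logN (rp (m * q) ω) + logSum m (shift^[m * q] ω) := by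
    conv_lhs => rw [hn]
    rw [rp_add]
    refine (logN_mul_le _ _).trans (add_le_add le_rfl ((logN_rp_le _ _).trans ?_))
    exact logSum_mono (Nat.mod_lt _ hm0).le _
  have e6 := logN_rp_mul_le m q ω
  rw [Function.iterate_mul] at e5
  have e7 : (m : ℝ) * q ≤ n := by exact_mod_cast Nat.mul_div_le n m
  have e8 : (m : ℝ) * q * c ≤ n * c := mul_le_mul_of_nonneg_right e7 (hΛ0.trans hc.le)
  simp only [Function.comp_def] at e1
  linarith

/-- `Z` is a boundary map for the stationary measure `ν`. -/
structure IsBoundary (μ : Measure G) (ν : Measure RP) (Z : (ℕ → G) → RP) : Prop where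
  measurable : Measurable Z
  equivariant : ∀ᵐ ω ∂(law μ), ∀ n, Z (shift^[n] ω) = ω n • Z (shift^[n + 1] ω)
  map_eq : (law μ).map Z = ν

lemma exists_isBoundary [NullSingletonClass ν] (h : IsStationary μ ν)
    (hinv : ¬ ∀ᵐ A ∂μ, push A ν = ν) : ∃ Z, IsBoundary μ ν Z := by
  obtain ⟨Z, h1, h2, h3⟩ := exists_boundary_map h hinv
  refine ⟨Z, h1, ?_, h3⟩
  rw [ae_all_iff]
  intro n
  have := ((measurePreserving_shift μ).iterate n).quasiMeasurePreserving.ae h2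
  filter_upwards [this] with ω hω
  rw [hω, Function.iterate_succ_apply', shift_iterate]
  simp

lemma IsBoundary.measurePreserving {μ : Measure G} {ν : Measure RP} {Z : (ℕ → G) → RP}
    (hZ : IsBoundary μ ν Z) : MeasurePreserving Z (law μ) ν := ⟨hZ.measurable, hZ.map_eq⟩

variable {Z : (ℕ → G) → RP}

lemma IsBoundary.measurePreserving_rp {ν : Measure RP} (hZ : IsBoundary μ ν Z) (n : ℕ) :
    MeasurePreserving (fun ω => (rp n ω, Z (shift^[n] ω))) (law μ) ((convPow μ n).prod ν) :=
  ((MeasurePreserving.id _).prod hZ.measurePreserving).comp (measurePreserving_rp_shift μ n)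

lemma IsBoundary.measurePreserving_zero {ν : Measure RP} (hZ : IsBoundary μ ν Z) :
    MeasurePreserving (fun ω => (ω 0, Z (shift ω))) (law μ) (μ.prod ν) :=
  ((MeasurePreserving.id _).prod hZ.measurePreserving).comp (measurePreserving_split μ)

/-- Equivariance turns the cocycle, evaluated at the receding point Z(σⁿω), into an additive
Birkhoff sum. -/
lemma IsBoundary.ae_logExp_rp {μ : Measure G} {ν : Measure RP} {Z : (ℕ → G) → RP}
    (hZ : IsBoundary μ ν Z) : ∀ᵐ ω ∂(law μ), ∀ n, logExp (rp n ω) (Z (shift^[n] ω)) =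
    birkhoffSum shift (fun ω => logExp (ω 0) (Z (shift ω))) n ω := by
  filter_upwards [hZ.equivariant] with ω hω n
  induction n with
  | zero => simp [rp, logExp, nrm2_one]
  | succ n ih =>
    rw [rp_succ, logExp_mul, ← hω n, ih, birkhoffSum_succ,
      ← Function.iterate_succ_apply' shift, shift_iterate n]
    simp

lemma integrable_logExp_prod {m : Measure G} [IsProbabilityMeasure m] (hm : Integrable logN m) :
    Integrable (fun p : G × RP => logExp p.1 p.2) (m.prod ν) :=
  (hm.comp_fst ν).mono' measurable_logExp.aestronglyMeasurable
    (ae_of_all _ fun p => abs_logExp_le p.1 p.2)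

lemma IsBoundary.integral_logExp (hZ : IsBoundary μ ν Z) (hμ : Integrable logN μ) (n : ℕ) :
    ∫ p, logExp p.1 p.2 ∂((convPow μ n).prod ν) = n * ∫ p, logExp p.1 p.2 ∂(μ.prod ν) := by
  have i1 : Integrable (fun ω => logExp (ω 0) (Z (shift ω))) (law μ) :=
    hZ.measurePreserving_zero.integrable_comp_of_integrable (integrable_logExp_prod hμ)
  rw [← integral_comp_measurePreserving (hZ.measurePreserving_rp n)
    measurable_logExp.aestronglyMeasurable, ← integral_comp_measurePreserving
    hZ.measurePreserving_zero measurable_logExp.aestronglyMeasurable]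
  rw [integral_congr_ae (g := fun ω => ∑ k ∈ Finset.range n,
    (fun ω => logExp (ω 0) (Z (shift ω))) (shift^[k] ω))
    (by filter_upwards [hZ.ae_logExp_rp] with ω hω using hω n)]
  have hT := fun k => (measurePreserving_shift μ).iterate k
  have i2 : ∀ k, Integrable (fun ω => (fun ω => logExp (ω 0) (Z (shift ω))) (shift^[k] ω)) (law μ) :=
    fun k => (hT k).integrable_comp_of_integrable i1
  rw [integral_finsetSum _ fun k _ => i2 k, Finset.sum_congr rfl fun k _ => integral_comp_measurePreserving (hT k) i1.aestronglyMeasurable]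
  simp

lemma measurable_nrm2_left (A : G) : Measurable fun x => nrm2 A x :=
  (continuous_nrm2.comp (continuous_const.prodMk continuous_id)).measurable

lemma measurable_logExp_left (A : G) : Measurable fun x => logExp A x :=
  measurable_logb_two.comp (measurable_nrm2_left A)

/-- A diffuse measure sees the norm of a matrix up to a bounded loss. -/
lemma exists_logN_le_integral [NullSingletonClass ν] {ε : ℝ} (hε : 0 < ε) :
    ∃ C : ℝ, ∀ A, logN A ≤ C + 2 * ε * logN A + ∫ x, logExp A x ∂ν := by
  obtain ⟨κ, hκ, h⟩ := exists_measure_nrm2_lt_le ν (ε := ENNReal.ofReal ε) (by simpa using hε)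
  refine ⟨|Real.logb 2 κ|, fun A => ?_⟩
  obtain ⟨S, hS⟩ : ∃ S, S = {x | nrm2 A x < κ * N2 A} := ⟨_, rfl⟩
  have hmA : Measurable (logExp A) := measurable_logExp_left A
  have hSm : MeasurableSet S := by
    rw [hS]
    exact measurableSet_lt (measurable_nrm2_left A) measurable_const
  have hνS : ν.real S ≤ ε := by
    rw [Measure.real, hS]
    exact ENNReal.toReal_le_of_le_ofReal hε.le (h A)
  have hA := one_le_logN A
  have i1 : Integrable (logExp A) ν := (integrable_const (logN A)).mono' hmA.aestronglyMeasurable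
    (ae_of_all _ fun x => abs_logExp_le A x)
  have i2 : Integrable (S.indicator fun _ => 2 * logN A) ν :=
    (integrable_const _).indicator hSm
  have hle : ∀ x, logN A - |Real.logb 2 κ| ≤ logExp A x + S.indicator (fun _ => 2 * logN A) x := by
    intro x
    by_cases hx : x ∈ S
    · rw [Set.indicator_of_mem hx]
      linarith [neg_logN_le A x, abs_nonneg (Real.logb 2 κ)]
    · rw [Set.indicator_of_notMem hx]
      rw [hS] at hx
      have h1 : κ * N2 A ≤ nrm2 A x := not_lt.mp hx
      have h2 := Real.logb_le_logb_of_le one_lt_two (mul_pos hκ (N2_pos A)) h1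
      rw [Real.logb_mul hκ.ne' (N2_pos A).ne'] at h2
      have h3 := neg_abs_le (Real.logb 2 κ)
      rw [logN, logExp]
      linarith
  have key := integral_mono (integrable_const (μ := ν) (logN A - |Real.logb 2 κ|)) (i1.add i2) hle
  rw [integral_const, integral_add' i1 i2, integral_indicator_const _ hSm] at key
  simp only [probReal_univ, smul_eq_mul] at key
  have h4 : ν.real S * (2 * logN A) ≤ ε * (2 * logN A) :=
    mul_le_mul_of_nonneg_right hνS (by linarith)
  linarith

/-- Averaging over directions, which are independent of the product and have diffuse law ν, loses
only a constant and a proportion 2ε of the logarithmic norm. Dividing by n and letting ε tend to 0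
gives the bound. -/
lemma IsBoundary.le_integral_logExp [NullSingletonClass ν] (hZ : IsBoundary μ ν Z)
    (hμ : Integrable logN μ) {Λ : ℝ}
    (hΛ : Tendsto (fun n : ℕ => meanLog μ n / n) atTop (𝓝 Λ)) :
    Λ ≤ ∫ p, logExp p.1 p.2 ∂(μ.prod ν) := by
  set I := ∫ p, logExp p.1 p.2 ∂(μ.prod ν) with hI
  have key : ∀ ε : ℝ, 0 < ε → Λ ≤ 2 * ε * Λ + I := by
    intro ε hε
    obtain ⟨C, hC⟩ := exists_logN_le_integral (ν := ν) hε
    have h1 : ∀ n : ℕ, meanLog μ n ≤ C + 2 * ε * meanLog μ n + n * I := by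
      intro n
      have i1 := integrable_logN_convPow hμ n
      have i2 := (integrable_logExp_prod (ν := ν) i1)
      rw [hI, ← hZ.integral_logExp hμ n, integral_prod _ i2]
      have i3 : Integrable (fun g => C + 2 * ε * logN g) (convPow μ n) :=
        (integrable_const C).add (i1.const_mul _)
      have := integral_mono i1 (i3.add i2.integral_prod_left) hC
      rw [integral_add' i3 i2.integral_prod_left, integral_add (integrable_const C) (i1.const_mul _),
        integral_const_mul, integral_const] at this
      simpa [meanLog] using this
    have h2 : Tendsto (fun n : ℕ => C / n + 2 * ε * (meanLog μ n / n) + I) atTop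
        (𝓝 (0 + 2 * ε * Λ + I)) :=
      ((tendsto_const_div_atTop_nhds_zero_nat C).add (hΛ.const_mul _)).add_const I
    rw [zero_add] at h2
    refine le_of_tendsto_of_tendsto hΛ h2 ?_
    filter_upwards [eventually_gt_atTop 0] with n hn
    have hn' : (0 : ℝ) < n := by exact_mod_cast hn
    calc meanLog μ n / n ≤ (C + 2 * ε * meanLog μ n + n * I) / n := by gcongr; exact h1 n
      _ = _ := by field_simp
  have h3 : Tendsto (fun ε : ℝ => 2 * ε * Λ + I) (𝓝[>] 0) (𝓝 (2 * 0 * Λ + I)) :=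
    tendsto_nhdsWithin_of_tendsto_nhds (Continuous.tendsto (by fun_prop) 0)
  have h4 := ge_of_tendsto h3 (eventually_mem_nhdsWithin.mono fun ε hε => key ε hε)
  simpa using h4

lemma tendsto_div_of_eventually_le {u v : ℕ → ℝ} {Λ I : ℝ} (hI : Λ ≤ I)
    (hv : Tendsto (fun n : ℕ => v n / n) atTop (𝓝 I)) (hvu : ∀ n, v n ≤ u n)
    (hu : ∀ j : ℕ, ∀ᶠ n : ℕ in atTop, u n ≤ n * (Λ + 1 / ((j : ℝ) + 1))) :
    Tendsto (fun n : ℕ => u n / n) atTop (𝓝 Λ) := by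
  rw [tendsto_order]
  constructor
  · intro a ha
    filter_upwards [hv.eventually (lt_mem_nhds (ha.trans_le hI)), eventually_gt_atTop 0] with n h1 h2
    have hn' : (0 : ℝ) < n := by exact_mod_cast h2
    exact h1.trans_le (by gcongr; exact hvu n)
  · intro a ha
    obtain ⟨j, hj⟩ := exists_nat_one_div_lt (sub_pos.mpr ha)
    filter_upwards [hu j, eventually_gt_atTop 0] with n h1 h2
    have hn' : (0 : ℝ) < n := by exact_mod_cast h2
    rw [div_lt_iff₀ hn']
    nlinarith

lemma IsBoundary.ae_tendsto_logExp (hZ : IsBoundary μ ν Z) (hμ : Integrable logN μ) :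
    ∀ᵐ ω ∂(law μ), Tendsto (fun n : ℕ => logExp (rp n ω) (Z (shift^[n] ω)) / n) atTop
      (𝓝 (∫ p, logExp p.1 p.2 ∂(μ.prod ν))) := by
  have i1 : Integrable (fun ω => logExp (ω 0) (Z (shift ω))) (law μ) :=
    hZ.measurePreserving_zero.integrable_comp_of_integrable (integrable_logExp_prod hμ)
  have h2 := ae_tendsto_birkhoffSum_div (ergodic_shift μ)
    (measurable_logExp.comp hZ.measurePreserving_zero.measurable) i1
  simp only [Function.comp_def] at h2
  rw [integral_comp_measurePreserving hZ.measurePreserving_zero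
    measurable_logExp.aestronglyMeasurable] at h2
  filter_upwards [h2, hZ.ae_logExp_rp] with ω e2 e3
  exact e2.congr fun n => by rw [e3 n]

/-- The exponential growth rate of the norms of the products `ω 0 * ⋯ * ω (n - 1)`. -/
theorem ae_tendsto_logN_rp (hfin : NoFiniteInvariant μ) (hinv : NoInvariantMeasure μ)
    (hμ : Integrable logN μ) {Λ : ℝ} (hΛ : Tendsto (fun n : ℕ => meanLog μ n / n) atTop (𝓝 Λ)) :
    ∀ᵐ ω ∂(law μ), Tendsto (fun n : ℕ => logN (rp n ω) / n) atTop (𝓝 Λ) := by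
  -- The growth rate does not involve ν; any stationary measure serves to bound it from below.
  obtain ⟨ν, hν, hst⟩ := exists_isStationary μ
  have := nullSingletonClass_of_isStationary hfin hst
  obtain ⟨Z, hZ⟩ := exists_isBoundary hst (hinv ν hν this)
  have hΛ0 : 0 ≤ Λ := ge_of_tendsto' hΛ fun n => div_nonneg
    (integral_nonneg fun g => zero_le_one.trans (one_le_logN g)) (Nat.cast_nonneg n)
  have h1 : ∀ᵐ ω ∂(law μ), ∀ j : ℕ, ∀ᶠ n : ℕ in atTop,
      logN (rp n ω) ≤ n * (Λ + 1 / ((j : ℝ) + 1)) :=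
    ae_all_iff.mpr fun j => ae_eventually_logN_rp_le hμ hΛ hΛ0
      (lt_add_of_pos_right _ Nat.one_div_pos_of_nat)
  filter_upwards [h1, hZ.ae_tendsto_logExp hμ] with ω e1 e2
  exact tendsto_div_of_eventually_le (hZ.le_integral_logExp hμ hΛ) e2 (fun n => logExp_le _ _) e1

/-! ### Products in the reverse order -/

/-- Inversion reverses the order of the factors and preserves `N2`. Results on `rp` for the inverted
law therefore transfer to `leftProd`. -/
lemma inv_leftProd (X : ℕ → G) (n : ℕ) : (leftProd X n)⁻¹ = rp n (fun i => (X i)⁻¹) := by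
  induction n with
  | zero => simp [leftProd, rp]
  | succ n ih => rw [leftProd, mul_inv_rev, ih, rp_succ]

lemma leftProd_succ' (X : ℕ → G) (n : ℕ) : leftProd X (n + 1) = leftProd (shift X) n * X 0 := by
  induction n with
  | zero => simp [leftProd]
  | succ n ih => rw [leftProd, ih, leftProd, mul_assoc, shift]

lemma measurable_leftProd (n : ℕ) : Measurable fun X : ℕ → G => leftProd X n := by
  induction n with
  | zero => exact measurable_const
  | succ n ih => exact (measurable_pi_apply n).mul ih

lemma map_leftProd (n : ℕ) : (law μ).map (fun X => leftProd X n) = convPow μ n := by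
  induction n with
  | zero => rfl
  | succ n ih =>
    have e1 : (fun X : ℕ → G => leftProd X (n + 1)) = (fun p : G × G => p.2 * p.1) ∘
        (Prod.map id fun X => leftProd X n) ∘ fun X => (X 0, shift X) :=
      funext fun X => leftProd_succ' X n
    have hm := measurable_leftProd n
    rw [e1, ← Measure.map_map (by fun_prop) ((measurable_id.prodMap hm).comp
      (measurePreserving_split μ).measurable), ← Measure.map_map (measurable_id.prodMap hm)
      (measurePreserving_split μ).measurable, (measurePreserving_split μ).map_eq,
      ← Measure.map_prod_map _ _ measurable_id hm, ih, Measure.map_id, convPow_add, convPow_one,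
      ← Measure.prod_swap, Measure.map_map (by fun_prop) measurable_swap]
    rfl

lemma map_inv_law : (law μ).map (fun X i => (X i)⁻¹) = law (μ.map Inv.inv) :=
  Measure.infinitePi_map_pi (μ := fun _ : ℕ => μ) fun _ => measurable_inv

lemma NoFiniteInvariant.map_inv {μ : Measure G} (h : NoFiniteInvariant μ) : NoFiniteInvariant (μ.map Inv.inv) := by
  intro F hF hF' hae
  refine h F hF hF' ?_
  filter_upwards [ae_of_ae_map measurable_inv.aemeasurable hae] with A hA
  conv_lhs => rw [← hA]
  rw [Set.image_image]
  simp

lemma NoInvariantMeasure.map_inv {μ : Measure G} (h : NoInvariantMeasure μ) :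
    NoInvariantMeasure (μ.map Inv.inv) := by
  intro ν h1 h2 hae
  refine h ν h1 h2 ?_
  filter_upwards [ae_of_ae_map measurable_inv.aemeasurable hae] with A hA
  have := push_inv_of_push_eq hA
  rwa [inv_inv] at this

lemma meanLog_map_inv (n : ℕ) : meanLog (μ.map Inv.inv) n = meanLog μ n := by
  have hm : MeasurePreserving (fun (X : ℕ → G) i => (X i)⁻¹) (law μ) (law (μ.map Inv.inv)) :=
    ⟨measurable_pi_lambda _ fun i => (measurable_pi_apply i).inv, map_inv_law⟩
  have hL : MeasurePreserving (fun X : ℕ → G => leftProd X n) (law μ) (convPow μ n) :=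
    ⟨measurable_leftProd n, map_leftProd n⟩
  rw [← integral_logN_rp, meanLog, ← integral_comp_measurePreserving (f := fun ω => logN (rp n ω)) hm
    (measurable_logN.comp (measurable_rp n)).aestronglyMeasurable,
    ← integral_comp_measurePreserving hL measurable_logN.aestronglyMeasurable]
  refine integral_congr_ae (ae_of_all _ fun X => ?_)
  dsimp only
  rw [← inv_leftProd, logN_inv]

/-- The factor 1/2 appears because `logN` uses squared norms; passing to the operator norm costs an
additive constant, which vanishes after division by n. -/
theorem isLyapunovExponent_of_tendsto (hfin : NoFiniteInvariant μ) (hinv : NoInvariantMeasure μ)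
    (hμ : Integrable logN μ) {Λ : ℝ} (hΛ : Tendsto (fun n : ℕ => meanLog μ n / n) atTop (𝓝 Λ)) :
    IsLyapunovExponent μ (Λ / 2) := by
  have : IsProbabilityMeasure (μ.map Inv.inv) :=
    Measure.isProbabilityMeasure_map measurable_inv.aemeasurable
  have hμ' : Integrable logN (μ.map Inv.inv) := by
    rw [integrable_map_measure measurable_logN.aestronglyMeasurable measurable_inv.aemeasurable]
    exact hμ.congr (ae_of_all _ fun A => (logN_inv A).symm)
  have h := ae_tendsto_logN_rp hfin.map_inv hinv.map_inv hμ' (Λ := Λ) (by simpa [meanLog_map_inv])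
  rw [← map_inv_law] at h
  have hm : Measurable fun (X : ℕ → G) (i : ℕ) => (X i)⁻¹ :=
    measurable_pi_lambda _ fun i => (measurable_pi_apply i).inv
  have h' := ae_of_ae_map hm.aemeasurable h
  filter_upwards [h'] with X hX
  have h1 : Tendsto (fun n : ℕ => logN (leftProd X n) / n) atTop (𝓝 Λ) := by
    refine hX.congr fun n => ?_
    rw [← inv_leftProd, logN_inv]
  refine tendsto_of_tendsto_of_tendsto_of_le_of_le (g := fun n : ℕ => logN (leftProd X n) / n / 2 -
    1 / 2 / n) (h := fun n : ℕ => logN (leftProd X n) / n / 2) ?_ (h1.div_const 2) ?_ ?_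
  · have := (h1.div_const 2).sub (tendsto_const_div_atTop_nhds_zero_nat (1 / 2))
    rwa [sub_zero] at this
  · intro n
    have := logN_le (leftProd X n)
    dsimp only
    rw [div_right_comm, ← sub_div]
    gcongr
    linarith
  · intro n
    have := two_mul_logb_opNorm_le (leftProd X n)
    dsimp only
    rw [div_right_comm]
    gcongr
    linarith

end

section

/-! ### Logarithmic integrability of maximal functions -/

/-- The number of powers of `2 ^ b` below `D`. -/
def logCount (b : ℕ) (D : ENNReal) : ENNReal := ∑' n : ℕ, if (2 : ENNReal) ^ (b * n) < D then 1 else 0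

lemma measurable_logCount (b : ℕ) : Measurable (logCount b) :=
  Measurable.tsum fun _ => Measurable.ite measurableSet_Ioi measurable_const measurable_const

lemma pow_lt_iff_lt_logb {D : ENNReal} (hD : D ≠ ⊤) (hD0 : 0 < D.toReal) (k : ℕ) :
    (2 : ENNReal) ^ k < D ↔ (k : ℝ) < Real.logb 2 D.toReal := by
  rw [Real.lt_logb_iff_rpow_lt one_lt_two hD0, Real.rpow_natCast,
    ← ENNReal.toReal_lt_toReal (by finiteness) hD]
  simp

lemma ofReal_logb_le_logCount {b : ℕ} (hb : 0 < b) (D : ENNReal) :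
    ENNReal.ofReal (Real.logb 2 D.toReal) ≤ b * logCount b D := by
  rcases le_or_gt (Real.logb 2 D.toReal) 0 with h | h
  · rw [ENNReal.ofReal_of_nonpos h]
    exact zero_le
  have hD : D ≠ ⊤ := by rintro rfl; simp at h
  have hD0 : 0 < D.toReal := by
    rcases ENNReal.toReal_nonneg.lt_or_eq with h' | h'
    · exact h'
    · rw [← h'] at h; simp at h
  have hb' : (0 : ℝ) < b := by exact_mod_cast hb
  set N := ⌈Real.logb 2 D.toReal / b⌉₊ with hN
  have h1 : (N : ENNReal) ≤ logCount b D := by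
    refine le_trans ?_ (ENNReal.sum_le_tsum (Finset.range N))
    rw [Finset.sum_congr rfl (g := fun _ => 1)]
    · simp
    · intro n hn
      rw [if_pos]
      rw [pow_lt_iff_lt_logb hD hD0]
      have := Nat.lt_ceil.mp (Finset.mem_range.mp hn)
      rw [lt_div_iff₀ hb'] at this
      push_cast
      linarith
  calc ENNReal.ofReal (Real.logb 2 D.toReal) ≤ ENNReal.ofReal (b * N) := by
        refine ENNReal.ofReal_le_ofReal ?_
        have := Nat.le_ceil (Real.logb 2 D.toReal / b)
        rw [div_le_iff₀ hb'] at this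
        linarith
    _ = b * N := by rw [ENNReal.ofReal_mul hb'.le]; simp
    _ ≤ _ := by gcongr

lemma logCount_one_le {D : ENNReal} (hD : D ≠ ⊤) :
    logCount 1 D ≤ ENNReal.ofReal |Real.logb 2 D.toReal| + 1 := by
  rcases ENNReal.toReal_nonneg.lt_or_eq with hD0 | hD0
  swap
  · have : D = 0 := by
      rcases (ENNReal.toReal_eq_zero_iff D).mp hD0.symm with h | h
      · exact h
      · exact absurd h hD
    simp [logCount, this]
  set N := ⌈Real.logb 2 D.toReal⌉₊ with hN
  have h1 : logCount 1 D ≤ N := by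
    rw [logCount, tsum_eq_sum (s := Finset.range N)]
    · refine (Finset.sum_le_card_nsmul _ _ 1 fun n _ => ?_).trans (by simp)
      split_ifs <;> simp
    · intro n hn
      rw [if_neg]
      rw [one_mul, pow_lt_iff_lt_logb hD hD0, ← Nat.lt_ceil, ← hN]
      exact fun h => hn (Finset.mem_range.mpr h)
  refine h1.trans ?_
  rw [← ENNReal.ofReal_one, ← ENNReal.ofReal_add (abs_nonneg _) zero_le_one,
    ← ENNReal.ofReal_natCast]
  refine ENNReal.ofReal_le_ofReal ?_
  rcases le_or_gt (Real.logb 2 D.toReal) 0 with h | h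
  · rw [hN, Nat.ceil_eq_zero.mpr h, Nat.cast_zero]
    positivity
  · rw [abs_of_pos h]
    exact (Nat.ceil_lt_add_one h.le).le

lemma lintegral_logCount {X : Type*} [MeasurableSpace X] (η : Measure X) {D : X → ENNReal}
    (hD : Measurable D) (b : ℕ) :
    ∫⁻ x, logCount b (D x) ∂η = ∑' n : ℕ, η {x | (2 : ENNReal) ^ (b * n) < D x} := by
  have hS : ∀ n : ℕ, MeasurableSet {x | (2 : ENNReal) ^ (b * n) < D x} := fun n =>
    measurableSet_lt measurable_const hD
  simp only [logCount]
  rw [lintegral_tsum fun n => (Measurable.ite (hS n) measurable_const measurable_const).aemeasurable]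
  refine tsum_congr fun n => ?_
  rw [← lintegral_indicator_one (hS n)]
  refine lintegral_congr fun x => ?_
  simp [Set.indicator_apply]

lemma tsum_two_mul_inv_pow : ∑' n : ℕ, 2 * ((2 : ENNReal) ^ n)⁻¹ = 4 := by
  simp_rw [ENNReal.inv_pow]
  rw [ENNReal.tsum_mul_left, ENNReal.tsum_geometric, ENNReal.one_sub_inv_two, inv_inv]
  norm_num

lemma measurable_Dsup (σ τ : Measure RP) (δ : ℝ) : Measurable (Dsup σ τ δ) :=
  measurable_Dsup_of (σ := fun _ => σ) (τ := fun _ => τ) (p := id) (fun _ _ => measurable_const)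
    (fun _ _ => measurable_const) measurable_id δ

/-- The maximal inequality gives {`Dsup` > 2^n} mass at most 2 / 2^n under the denominator measure;
these bounds sum to 4. -/
lemma lintegral_logCount_Dsup_le (σ τ : Measure RP) [IsProbabilityMeasure σ] (δ : ℝ) :
    ∫⁻ x, logCount 1 (Dsup σ τ δ x) ∂τ ≤ 4 := by
  rw [lintegral_logCount τ (measurable_Dsup σ τ δ), ← tsum_two_mul_inv_pow]
  refine ENNReal.tsum_le_tsum fun n => ?_
  have h := mul_measure_lt_Dsup_le σ τ δ (2 ^ (1 * n))
  rw [measure_univ, mul_one] at h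
  rw [one_mul] at h ⊢
  rw [← div_eq_mul_inv, ENNReal.le_div_iff_mul_le (by simp) (by simp), mul_comm]
  exact h

/-- The maximal inequality controls the ν-mass, while the η-mass is wanted. Where the density is at
most 2^n, passing from ν to η costs a factor 2^n, so the thresholds are 2^(2n) and the base is
`logCount 2`. -/
lemma lintegral_logCount_Dsup_le_of_ac {η ν : Measure RP} [IsProbabilityMeasure η]
    [IsProbabilityMeasure ν] (h : η ≪ ν) (δ : ℝ) :
    ∫⁻ x, logCount 2 (Dsup η ν δ x) ∂η ≤ ∫⁻ x, logCount 1 (η.rnDeriv ν x) ∂η + 4 := by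
  rw [lintegral_logCount η (measurable_Dsup η ν δ), lintegral_logCount η (η.measurable_rnDeriv ν),
    ← tsum_two_mul_inv_pow, ← ENNReal.tsum_add]
  refine ENNReal.tsum_le_tsum fun n => ?_
  set S := {x | (2 : ENNReal) ^ (2 * n) < Dsup η ν δ x} with hS
  have hSm : MeasurableSet S := measurableSet_lt measurable_const (measurable_Dsup η ν δ)
  have hTm : MeasurableSet {x | (2 : ENNReal) ^ (1 * n) < η.rnDeriv ν x} :=
    measurableSet_lt measurable_const (η.measurable_rnDeriv ν)
  set T := {x | (2 : ENNReal) ^ (1 * n) < η.rnDeriv ν x} with hT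
  have h1 : (2 : ENNReal) ^ (2 * n) * ν S ≤ 2 := by
    simpa using mul_measure_lt_Dsup_le η ν δ (2 ^ (2 * n))
  have h2 : η (S \ T) ≤ 2 ^ n * ν S := by
    rw [← Measure.setLIntegral_rnDeriv h]
    calc ∫⁻ x in S \ T, η.rnDeriv ν x ∂ν ≤ ∫⁻ _ in S \ T, 2 ^ n ∂ν := by
          refine setLIntegral_mono measurable_const fun x hx => ?_
          have := hx.2
          rw [hT, Set.mem_ofPred_eq, not_lt, one_mul] at this
          exact this
      _ = 2 ^ n * ν (S \ T) := setLIntegral_const _ _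
      _ ≤ 2 ^ n * ν S := by gcongr; exact Set.sdiff_subset
  have h3 : (2 : ENNReal) ^ n * ν S ≤ 2 * (2 ^ n)⁻¹ := by
    rw [← div_eq_mul_inv, ENNReal.le_div_iff_mul_le (by simp) (by simp)]
    calc (2 : ENNReal) ^ n * ν S * 2 ^ n = 2 ^ (2 * n) * ν S := by ring
      _ ≤ 2 := h1
  calc η S ≤ η (T ∪ S \ T) := measure_mono (by intro x hx; by_cases hxT : x ∈ T <;> simp [hx, hxT])
    _ ≤ η T + η (S \ T) := measure_union_le _ _
    _ ≤ _ := by gcongr; exact h2.trans h3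

/-- Convergence of logarithmic integrals between integrable bounds. -/
lemma tendsto_integral_logb {X : Type*} [MeasurableSpace X] {m : Measure X} {D : ℕ → X → ENNReal}
    {L U : X → ENNReal} (hD : ∀ n, Measurable (D n)) (hL : ∀ᵐ x ∂m, L x ≠ 0)
    (hU : ∀ᵐ x ∂m, U x ≠ ⊤) (hLD : ∀ n x, L x ≤ D n x) (hDU : ∀ n x, D n x ≤ U x)
    (hlim : ∀ x, Tendsto (fun n => D n x) atTop (𝓝 (L x)))
    (iL : Integrable (fun x => Real.logb 2 (L x).toReal) m)
    (iU : Integrable (fun x => Real.logb 2 (U x).toReal) m) :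
    (∀ n, Integrable (fun x => Real.logb 2 (D n x).toReal) m) ∧
      Tendsto (fun n => ∫ x, Real.logb 2 (D n x).toReal ∂m) atTop
        (𝓝 (∫ x, Real.logb 2 (L x).toReal ∂m)) := by
  have hm : ∀ n, AEStronglyMeasurable (fun x => Real.logb 2 (D n x).toReal) m := fun n =>
    (measurable_logb_two.comp (hD n).ennreal_toReal).aestronglyMeasurable
  have ib := iL.abs.add iU.abs
  have hb : ∀ n, ∀ᵐ x ∂m, ‖Real.logb 2 (D n x).toReal‖ ≤
      |Real.logb 2 (L x).toReal| + |Real.logb 2 (U x).toReal| := by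
    intro n
    filter_upwards [hL, hU] with x h1 h2
    have hDt : D n x ≠ ⊤ := ne_top_of_le_ne_top h2 (hDU n x)
    have hLp : 0 < (L x).toReal := ENNReal.toReal_pos h1 (ne_top_of_le_ne_top hDt (hLD n x))
    have e1 : (L x).toReal ≤ (D n x).toReal := ENNReal.toReal_mono hDt (hLD n x)
    have e2 : (D n x).toReal ≤ (U x).toReal := ENNReal.toReal_mono h2 (hDU n x)
    have e3 := Real.logb_le_logb_of_le one_lt_two hLp e1
    have e4 := Real.logb_le_logb_of_le one_lt_two (hLp.trans_le e1) e2
    rw [Real.norm_eq_abs, abs_le]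
    constructor
    · linarith [neg_abs_le (Real.logb 2 (L x).toReal), abs_nonneg (Real.logb 2 (U x).toReal)]
    · linarith [le_abs_self (Real.logb 2 (U x).toReal), abs_nonneg (Real.logb 2 (L x).toReal)]
  refine ⟨fun n => ib.mono' (hm n) (hb n), ?_⟩
  refine tendsto_integral_of_dominated_convergence _ hm ib hb ?_
  filter_upwards [hL, hU] with x h1 h2
  have hLt : L x ≠ ⊤ := ne_top_of_le_ne_top h2 ((hLD 0 x).trans (hDU 0 x))
  have hLp : 0 < (L x).toReal := ENNReal.toReal_pos h1 hLt
  have e := (ENNReal.tendsto_toReal hLt).comp (hlim x)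
  exact (Real.continuousAt_logb hLp.ne').tendsto.comp e

/-! ### The skew product measure -/

lemma measurableEmbedding_smul (A : G) : MeasurableEmbedding fun x : RP => A • x :=
  (Homeomorph.mk (MulAction.toPerm A) (continuous_smul_left A)
    (continuous_smul_left A⁻¹)).measurableEmbedding

lemma ae_push_iff {A : G} {ν : Measure RP} {P : RP → Prop} :
    (∀ᵐ x ∂(push A ν), P x) ↔ ∀ᵐ x ∂ν, P (A • x) := (measurableEmbedding_smul A).ae_map_iff

lemma measurable_skew : Measurable fun p : G × RP => (p.1, p.1 • p.2) :=
  measurable_fst.prodMk measurable_action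

/-- The law of `(A, A • x)` for independent `A` and `x` with laws `μ` and `ν`. -/
def skew (μ : Measure G) (ν : Measure RP) : Measure (G × RP) :=
  (μ.prod ν).map fun p : G × RP => (p.1, p.1 • p.2)

variable {μ : Measure G} [IsProbabilityMeasure μ] {ν : Measure RP} [IsProbabilityMeasure ν]

instance instIsProbabilityMeasureSkew : IsProbabilityMeasure (skew μ ν) :=
  Measure.isProbabilityMeasure_map measurable_skew.aemeasurable

lemma lintegral_skew {μ : Measure G} {F : G × RP → ENNReal} (hF : Measurable F) :
    ∫⁻ p, F p ∂(skew μ ν) = ∫⁻ A, ∫⁻ x, F (A, x) ∂(push A ν) ∂μ := by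
  rw [skew, lintegral_map hF measurable_skew,
    lintegral_prod (fun p : G × RP => F (p.1, p.1 • p.2)) (hF.comp measurable_skew).aemeasurable]
  refine lintegral_congr fun A => ?_
  rw [push, lintegral_map (f := fun x => F (A, x)) (hF.comp measurable_prodMk_left)
    (measurable_smul_left A)]

lemma ae_ae_push_of_ae_skew {μ : Measure G} {P : G × RP → Prop} (h : ∀ᵐ p ∂(skew μ ν), P p) :
    ∀ᵐ A ∂μ, ∀ᵐ x ∂(push A ν), P (A, x) := by
  filter_upwards [Measure.ae_ae_of_ae_prod (ae_of_ae_map measurable_skew.aemeasurable h)] with A hA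
  exact ae_push_iff.mpr hA

lemma ae_skew_of_ae_ae_push {μ : Measure G} {P : G × RP → Prop} (hP : MeasurableSet {p | P p})
    (h : ∀ᵐ A ∂μ, ∀ᵐ x ∂(push A ν), P (A, x)) : ∀ᵐ p ∂(skew μ ν), P p := by
  rw [skew, ae_map_iff measurable_skew.aemeasurable hP,
    Measure.ae_prod_iff_ae_ae (p := fun p : G × RP => P (p.1, p.1 • p.2)) (measurable_skew hP)]
  filter_upwards [h] with A hA
  exact ae_push_iff.mp hA

/-- Z(σω) is independent of ω 0 with law ν, and Z ω = ω 0 • Z(σω). -/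
lemma IsBoundary.measurePreserving_skew {ν : Measure RP} {Z : (ℕ → G) → RP} (hZ : IsBoundary μ ν Z) :
    MeasurePreserving (fun ω => (ω 0, Z ω)) (law μ) (skew μ ν) := by
  refine ⟨(measurable_pi_apply 0).prodMk hZ.measurable, ?_⟩
  rw [skew, ← hZ.measurePreserving_zero.map_eq, Measure.map_map measurable_skew
    hZ.measurePreserving_zero.measurable]
  refine Measure.map_congr ?_
  filter_upwards [hZ.equivariant] with ω hω
  have := hω 0
  simp only [Function.iterate_zero, id_eq, zero_add, Function.iterate_one] at this
  simp only [Function.comp_def, ← this]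

end

/-! ### Pulling back arcs along the random walk -/

/-- This makes masses telescope: on the k-th pulled-back arc, the mass for the push-forward of ν by
the next matrix is the ν-mass of the next pulled-back arc. -/
lemma push_arc (A B : G) (ν : Measure RP) (Q : ℝ × ℝ × ℝ) :
    push B ν (arc (pull A Q)) = ν (arc (pull (A * B) Q)) := by
  rw [push_apply B ν (measurableSet_arc _)]
  congr 1
  ext x
  rw [Set.mem_preimage, mem_arc_pull, mem_arc_pull, mul_smul]

lemma pull_one (Q : ℝ × ℝ × ℝ) : arc (pull 1 Q) = arc Q := by
  ext x
  rw [mem_arc_pull, one_smul]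

lemma rp_smul_of_equivariant {Z : (ℕ → G) → RP} {ω : ℕ → G}
    (hω : ∀ n, Z (shift^[n] ω) = ω n • Z (shift^[n + 1] ω)) (n : ℕ) :
    rp n ω • Z (shift^[n] ω) = Z ω := by
  induction n with
  | zero => simp [rp]
  | succ n ih => rw [rp_succ, mul_smul, ← hω n, ih]

/-- The preimage of a ball under `A` has diameter controlled by the norm of `A`. -/
lemma small_pull (A : G) {Q : ℝ × ℝ × ℝ} {z : RP} {r δ : ℝ} (hQ : arc Q = Metric.ball z r)
    (h : 2 * r * N2 A ≤ δ) : Small δ (pull A Q) := by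
  intro x hx y hy
  rw [mem_arc_pull, hQ, Metric.mem_ball] at hx hy
  have hr : dist (A • x) (A • y) ≤ 2 * r := by
    linarith [dist_triangle_right (A • x) (A • y) z]
  have h0 : 0 ≤ 2 * r := dist_nonneg.trans hr
  refine le_trans (abs_le_of_sq_le_sq' ?_ (by have := N2_pos A; positivity)).2 h
  rw [← dist_smul_sq A x y, mul_pow, pow_two (N2 A)]
  have := nrm2_le_N2 A x
  have := nrm2_le_N2 A y
  have := (nrm2_pos A x).le
  have := (nrm2_pos A y).le
  have := (N2_pos A).le
  gcongr

/-- Points that are strongly expanded by `A` are mapped close to each other. -/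
lemma dist_smul_le (A : G) (x y : RP) {a b : ℝ} (ha : 0 < a) (hb : 0 < b) (hx : a ≤ nrm2 A x)
    (hy : b ≤ nrm2 A y) : dist (A • x) (A • y) ^ 2 ≤ 4 / (a * b) := by
  rw [le_div_iff₀ (mul_pos ha hb)]
  have := (nrm2_pos A x).le
  calc dist (A • x) (A • y) ^ 2 * (a * b) ≤ dist (A • x) (A • y) ^ 2 * (nrm2 A x * nrm2 A y) := by
        gcongr
    _ = dist x y ^ 2 := dist_smul_sq A x y
    _ ≤ 2 ^ 2 := by gcongr; exact dist_le_two x y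
    _ = 4 := by norm_num

/-- The integrand `ω ↦ F (ω 0, Z ω)` along the orbit. -/
lemma birkhoffSum_eq {F : G × RP → ℝ} {Z : (ℕ → G) → RP} (n : ℕ) (ω : ℕ → G) :
    birkhoffSum shift (fun ω => F (ω 0, Z ω)) n ω =
      ∑ k ∈ Finset.range n, F (ω k, Z (shift^[k] ω)) := by
  simp only [birkhoffSum]
  refine Finset.sum_congr rfl fun k _ => ?_
  rw [shift_iterate]
  simp

/-- Each step costs at most a factor `Dsup`, and the last mass is at most 1. The truncation at c
keeps the logarithms bounded below while the density is not yet known to be nonzero. -/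
lemma measure_arc_le_sum {ν : Measure RP} [IsProbabilityMeasure ν] {Z : (ℕ → G) → RP} {ω : ℕ → G}
    (hω : ∀ n, Z (shift^[n] ω) = ω n • Z (shift^[n + 1] ω)) {δ : ℝ} {c : ENNReal} (hc : c ≠ 0)
    (hc' : c ≠ ⊤) (hfin : ∀ k, Dsup ν (push (ω k) ν) δ (Z (shift^[k] ω)) ≠ ⊤) {Q : ℝ × ℝ × ℝ}
    (hQ : Z ω ∈ arc Q) (hpos : ν (arc Q) ≠ 0) {n : ℕ} (hs : ∀ k < n, Small δ (pull (rp k ω) Q)) :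
    Real.logb 2 (ν (arc Q)).toReal ≤ ∑ k ∈ Finset.range n,
      Real.logb 2 (max c (Dsup ν (push (ω k) ν) δ (Z (shift^[k] ω)))).toReal := by
  suffices h : ν (arc (pull (rp n ω) Q)) ≠ 0 ∧ Real.logb 2 (ν (arc Q)).toReal ≤
      Real.logb 2 (ν (arc (pull (rp n ω) Q))).toReal + ∑ k ∈ Finset.range n,
      Real.logb 2 (max c (Dsup ν (push (ω k) ν) δ (Z (shift^[k] ω)))).toReal by
    have h1 : Real.logb 2 (ν (arc (pull (rp n ω) Q))).toReal ≤ 0 :=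
      Real.logb_nonpos one_lt_two ENNReal.toReal_nonneg
        (ENNReal.toReal_le_of_le_ofReal zero_le_one (by simpa using prob_le_one))
    linarith [h.2]
  induction n with
  | zero => simpa [rp, pull_one] using hpos
  | succ n ih =>
    obtain ⟨h0, ih⟩ := ih fun k hk => hs k (by omega)
    have hz : Z (shift^[n] ω) ∈ arc (pull (rp n ω) Q) := by
      rw [mem_arc_pull, rp_smul_of_equivariant hω]
      exact hQ
    have h1 := measure_arc_le_Dsup_mul hz (hs n (by omega)) (hfin n)
    rw [push_arc, ← rp_succ] at h1
    set u := max c (Dsup ν (push (ω n) ν) δ (Z (shift^[n] ω))) with hu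
    have hu0 : u ≠ 0 := (lt_of_lt_of_le (pos_iff_ne_zero.mpr hc) (le_max_left _ _)).ne'
    have hut : u ≠ ⊤ := by rw [hu]; simp [hc', hfin n]
    have h2 : ν (arc (pull (rp n ω) Q)) ≤ u * ν (arc (pull (rp (n + 1) ω) Q)) :=
      h1.trans (by gcongr; exact le_max_right _ _)
    have h3 : ν (arc (pull (rp (n + 1) ω) Q)) ≠ 0 := by
      intro h
      rw [h, mul_zero] at h2
      exact h0 (le_antisymm h2 zero_le)
    refine ⟨h3, ?_⟩
    have h4 : Real.logb 2 (ν (arc (pull (rp n ω) Q))).toReal ≤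
        Real.logb 2 u.toReal + Real.logb 2 (ν (arc (pull (rp (n + 1) ω) Q))).toReal := by
      rw [← Real.logb_mul (ENNReal.toReal_pos hu0 hut).ne'
        (ENNReal.toReal_pos h3 (measure_ne_top _ _)).ne', ← ENNReal.toReal_mul]
      exact Real.logb_le_logb_of_le one_lt_two (ENNReal.toReal_pos h0 (measure_ne_top _ _))
        (ENNReal.toReal_mono (by finiteness) h2)
    rw [Finset.sum_range_succ]
    linarith

/-- The telescoping in the other direction: one step forward multiplies the mass by at most `Dsup`
of the push-forward against ν. It is stated from an arbitrary time n because sharp and crude blocks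
will be concatenated. -/
lemma le_measure_arc_of_sum {ν : Measure RP} [IsProbabilityMeasure ν] {Z : (ℕ → G) → RP}
    {ω : ℕ → G} (hω : ∀ n, Z (shift^[n] ω) = ω n • Z (shift^[n + 1] ω)) {δ : ℝ}
    (hfin : ∀ k, Dsup (push (ω k) ν) ν δ (Z (shift^[k] ω)) ≠ ⊤) {Q : ℝ × ℝ × ℝ}
    (hQ : Z ω ∈ arc Q) {n m : ℕ} (hs : ∀ k < n + m, n ≤ k → Small δ (pull (rp k ω) Q))
    (hpos : ν (arc (pull (rp (n + m) ω) Q)) ≠ 0) :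
    ν (arc (pull (rp n ω) Q)) ≠ 0 ∧ Real.logb 2 (ν (arc (pull (rp (n + m) ω) Q))).toReal ≤
      Real.logb 2 (ν (arc (pull (rp n ω) Q))).toReal +
      ∑ k ∈ Finset.Ico n (n + m), Real.logb 2 (Dsup (push (ω k) ν) ν δ (Z (shift^[k] ω))).toReal := by
  induction m with
  | zero => simpa using hpos
  | succ m ih =>
    have hz : Z (shift^[n + m] ω) ∈ arc (pull (rp (n + m) ω) Q) := by
      rw [mem_arc_pull, rp_smul_of_equivariant hω]
      exact hQ
    have h1 := measure_arc_le_Dsup_mul hz (hs (n + m) (by omega) (by omega)) (hfin (n + m))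
    rw [push_arc, ← rp_succ] at h1
    set u := Dsup (push (ω (n + m)) ν) ν δ (Z (shift^[n + m] ω)) with hu
    rw [← add_assoc] at hpos ⊢
    have h2 : u * ν (arc (pull (rp (n + m) ω) Q)) ≠ 0 := fun h => by
      rw [h] at h1
      exact hpos (le_antisymm h1 zero_le)
    obtain ⟨hu0, h3⟩ := mul_ne_zero_iff.mp h2
    obtain ⟨h5, ih⟩ := ih (fun k hk => hs k (by omega)) h3
    refine ⟨h5, ?_⟩
    have h4 : Real.logb 2 (ν (arc (pull (rp (n + m + 1) ω) Q))).toReal ≤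
        Real.logb 2 u.toReal + Real.logb 2 (ν (arc (pull (rp (n + m) ω) Q))).toReal := by
      rw [← Real.logb_mul (ENNReal.toReal_pos hu0 (hfin _)).ne'
        (ENNReal.toReal_pos h3 (measure_ne_top _ _)).ne', ← ENNReal.toReal_mul]
      exact Real.logb_le_logb_of_le one_lt_two (ENNReal.toReal_pos hpos (measure_ne_top _ _))
        (ENNReal.toReal_mono (by have := hfin (n + m); finiteness) h1)
    rw [Finset.sum_Ico_succ_top (by omega)]
    linarith

section

/-! ### Balls have at least linear mass -/

lemma ae_measure_ball_ne_zero (ν : Measure RP) : ∀ᵐ x ∂ν, ∀ r : ℝ, 0 < r → ν (Metric.ball x r) ≠ 0 := by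
  filter_upwards [ν.support_mem_ae] with x hx r hr
  exact pos_iff_ne_zero.mp
    ((Measure.mem_support_iff_forall x).mp hx _ (Metric.ball_mem_nhds x hr))

/-- The image of the length measure under the parametrization by angles. -/
def lenMeasure : Measure RP :=
  (volume.restrict (Set.Icc (-Real.pi - 1) (Real.pi + 1))).map dir

instance instIsFiniteMeasureLen : IsFiniteMeasure lenMeasure := by
  unfold lenMeasure
  infer_instance

lemma le_lenMeasure_ball (x : RP) {r : ℝ} (hr1 : r ≤ 1) :
    ENNReal.ofReal r ≤ lenMeasure (Metric.ball x r) := by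
  obtain ⟨θ, hθ, rfl⟩ := exists_dir_eq x
  rw [lenMeasure, Measure.map_apply continuous_dir.measurable measurableSet_ball,
    Measure.restrict_apply (continuous_dir.measurable measurableSet_ball)]
  -- `dir` is 2-Lipschitz, which explains r / 2. The extra unit at both ends of the parameter
  -- interval leaves room for angles near ±π.
  have h : Set.Ioo (θ - r / 2) (θ + r / 2) ⊆
      dir ⁻¹' Metric.ball (dir θ) r ∩ Set.Icc (-Real.pi - 1) (Real.pi + 1) := by
    intro t ht
    refine ⟨?_, ?_, ?_⟩
    · rw [Set.mem_preimage, Metric.mem_ball]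
      refine (dist_dir_le t θ).trans_lt ?_
      have : |t - θ| < r / 2 := abs_lt.mpr ⟨by linarith [ht.1], by linarith [ht.2]⟩
      linarith
    · linarith [ht.1, hθ.1]
    · linarith [ht.2, hθ.2]
  refine le_trans ?_ (measure_mono h)
  rw [Real.volume_Ioo]
  exact ENNReal.ofReal_le_ofReal (by linarith)

/-- The maximal function of length against ν is finite ν-almost everywhere, and a ball of radius r
has length at least r. -/
lemma ae_logb_measure_ball_ge (ν : Measure RP) [IsProbabilityMeasure ν] :
    ∀ᵐ x ∂ν, ∃ C : ℝ, ∀ r : ℝ, 0 < r → r ≤ 1 →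
      Real.logb 2 r - C ≤ Real.logb 2 (ν (Metric.ball x r)).toReal := by
  have hfin : ∀ᵐ x ∂ν, Dsup lenMeasure ν 2 x ≠ ⊤ := by
    rw [ae_iff]
    simp only [not_not]
    have h : ∀ n : ℕ, (n : ENNReal) * ν {x | Dsup lenMeasure ν 2 x = ⊤} ≤
        2 * lenMeasure Set.univ := by
      intro n
      refine le_trans ?_ (mul_measure_lt_Dsup_le lenMeasure ν 2 n)
      gcongr
      intro h
      rw [h]
      exact ENNReal.natCast_lt_top n
    by_contra h0
    obtain ⟨n, hn⟩ := ENNReal.exists_nat_mul_gt h0 (b := 2 * lenMeasure Set.univ) (by finiteness)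
    exact absurd (h n) (not_le.mpr hn)
  filter_upwards [hfin, ae_measure_ball_ne_zero ν] with x hx hpos
  refine ⟨Real.logb 2 (Dsup lenMeasure ν 2 x).toReal, fun r hr hr1 => ?_⟩
  obtain ⟨Q, hQ⟩ := exists_arc_eq_ball x hr
  have h1 := measure_arc_le_Dsup_mul (σ := lenMeasure) (τ := ν) (x := x) (Q := Q)
    (by rw [hQ]; exact Metric.mem_ball_self hr) (small_two Q) hx
  rw [hQ] at h1
  have h2 := (le_lenMeasure_ball x hr1).trans h1
  have h3 : Dsup lenMeasure ν 2 x ≠ 0 := by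
    intro h
    rw [h, zero_mul] at h2
    exact absurd (ENNReal.ofReal_pos.mpr hr) (not_lt.mpr h2)
  have h4 := ENNReal.toReal_mono (by finiteness) h2
  rw [ENNReal.toReal_ofReal hr.le, ENNReal.toReal_mul] at h4
  have h5 := Real.logb_le_logb_of_le one_lt_two hr h4
  rw [Real.logb_mul (ENNReal.toReal_pos h3 hx).ne'
    (ENNReal.toReal_pos (hpos r hr) (measure_ne_top _ _)).ne'] at h5
  linarith

/-! ### Shrinking of the pulled back balls -/

lemma exists_le_add_mul {u : ℕ → ℝ} {Λ c : ℝ} (h : Tendsto (fun n : ℕ => u n / n) atTop (𝓝 Λ))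
    (hc : Λ < c) : ∃ C, ∀ n : ℕ, u n ≤ C + n * c := by
  have h1 : ∀ᶠ n : ℕ in atTop, u n - n * c ≤ 0 := by
    filter_upwards [h.eventually (gt_mem_nhds hc), eventually_gt_atTop 0] with n h1 h2
    have hn' : (0 : ℝ) < n := by exact_mod_cast h2
    rw [div_lt_iff₀ hn'] at h1
    linarith
  obtain ⟨C, hC⟩ := (isBoundedUnder_of_eventually_le h1).bddAbove_range
  refine ⟨C, fun n => ?_⟩
  have := hC ⟨n, rfl⟩
  dsimp only at this
  linarith

lemma N2_eq_rpow (A : G) : N2 A = (2 : ℝ) ^ logN A := by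
  rw [logN, Real.rpow_logb two_pos one_lt_two.ne' (N2_pos A)]

lemma nrm2_eq_rpow (A : G) (x : RP) : nrm2 A x = (2 : ℝ) ^ logExp A x := by
  rw [logExp, Real.rpow_logb two_pos one_lt_two.ne' (nrm2_pos A x)]

lemma tendsto_two_rpow_neg {b : ℝ} (hb : 0 < b) (C : ℝ) :
    Tendsto (fun n : ℕ => (2 : ℝ) ^ (C - n * b)) atTop (𝓝 0) := by
  have h1 : Tendsto (fun n : ℕ => C - (n : ℝ) * b) atTop atBot :=
    tendsto_atBot_add_const_left _ C
      (tendsto_neg_atTop_atBot.comp (tendsto_natCast_atTop_atTop.atTop_mul_const hb))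
  exact (tendsto_rpow_atBot_of_base_gt_one 2 one_lt_two).comp h1

/-- By time k ≤ Kj the norm has grown at most to 2^(C + kc) with Kc < t, too little to compensate
the radius 2^(-jt). The constant C makes the bound uniform over all these k. -/
lemma eventually_mul_N2_le {ω : ℕ → G} {Λ : ℝ} (hΛ0 : 0 ≤ Λ)
    (hω : Tendsto (fun n : ℕ => logN (rp n ω) / n) atTop (𝓝 Λ)) {K : ℕ} (hK : 0 < K) {t δ : ℝ}
    (ht : K * Λ < t) (hδ : 0 < δ) :
    ∀ᶠ j : ℕ in atTop, ∀ k ≤ K * j, 2 * (2 : ℝ) ^ (-(j * t)) * N2 (rp k ω) ≤ δ := by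
  have hK' : (0 : ℝ) < K := by exact_mod_cast hK
  obtain ⟨c, h1, h2⟩ := exists_between ((lt_div_iff₀ hK').mpr (by linarith : Λ * K < t))
  rw [lt_div_iff₀ hK'] at h2
  obtain ⟨C, hC⟩ := exists_le_add_mul hω h1
  filter_upwards [(tendsto_two_rpow_neg (sub_pos.mpr h2) (C + 1)).eventually (ge_mem_nhds hδ)]
    with j hj k hk
  refine le_trans ?_ hj
  have h5 : 2 * (2 : ℝ) ^ (-(j * t)) = 2 ^ (1 + -(j * t)) := by
    rw [Real.rpow_add two_pos, Real.rpow_one]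
  rw [N2_eq_rpow, h5, ← Real.rpow_add two_pos]
  refine Real.rpow_le_rpow_of_exponent_le one_le_two ?_
  have h3 : (k : ℝ) ≤ K * j := by exact_mod_cast hk
  have h4 : (k : ℝ) * c ≤ K * j * c := mul_le_mul_of_nonneg_right h3 (hΛ0.trans h1.le)
  linarith [hC k]

/-! ### Upper bounds for the mass of small balls -/

variable {μ : Measure G} [IsProbabilityMeasure μ] {ν : Measure RP} [IsProbabilityMeasure ν]
  {Z : (ℕ → G) → RP} {Λ : ℝ}

lemma IsBoundary.ae_forall_skew (hZ : IsBoundary μ ν Z) {P : G × RP → Prop}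
    (h : ∀ᵐ p ∂(skew μ ν), P p) : ∀ᵐ ω ∂(law μ), ∀ k, P (ω k, Z (shift^[k] ω)) := by
  rw [ae_all_iff]
  intro k
  have h1 := hZ.measurePreserving_skew.quasiMeasurePreserving.ae h
  have h2 := ((measurePreserving_shift μ).iterate k).quasiMeasurePreserving.ae h1
  filter_upwards [h2] with ω hω
  rw [shift_iterate] at hω ⊢
  simpa using hω

lemma IsBoundary.ae_of_ae {μ : Measure G} {ν : Measure RP} (hZ : IsBoundary μ ν Z) {P : RP → Prop} (h : ∀ᵐ x ∂ν, P x) :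
    ∀ᵐ ω ∂(law μ), P (Z ω) := hZ.measurePreserving.quasiMeasurePreserving.ae h

lemma IsBoundary.ae_tendsto_sum (hZ : IsBoundary μ ν Z) {F : G × RP → ℝ} (hF : Measurable F)
    (hi : Integrable F (skew μ ν)) : ∀ᵐ ω ∂(law μ), Tendsto (fun n : ℕ =>
      (∑ k ∈ Finset.range n, F (ω k, Z (shift^[k] ω))) / n) atTop (𝓝 (∫ p, F p ∂(skew μ ν))) := by
  have h := ae_tendsto_birkhoffSum_div (ergodic_shift μ) (f := fun ω : ℕ → G => F (ω 0, Z ω))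
    (hF.comp hZ.measurePreserving_skew.measurable)
    (hZ.measurePreserving_skew.integrable_comp_of_integrable hi)
  rw [integral_comp_measurePreserving hZ.measurePreserving_skew hi.aestronglyMeasurable] at h
  filter_upwards [h] with ω hω
  simpa only [birkhoffSum_eq] using hω

/-- As s > Λ, the ball of radius 2^(-ns) stays δ-small for n steps. The telescoping sum is then a
Birkhoff sum of a fixed function of (ω_k, Z(σ^k ω)). -/
lemma IsBoundary.ae_eventually_logb_ball_le (hZ : IsBoundary μ ν Z) (hΛ0 : 0 ≤ Λ)
    (hΛ : ∀ᵐ ω ∂(law μ), Tendsto (fun n : ℕ => logN (rp n ω) / n) atTop (𝓝 Λ)) {s : ℝ} (hs : Λ < s)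
    {δ : ℝ} (hδ : 0 < δ) {c : ENNReal} (hc : c ≠ 0) (hc' : c ≠ ⊤)
    (hfin : ∀ᵐ p ∂(skew μ ν), Dsup ν (push p.1 ν) δ p.2 ≠ ⊤)
    (hi : Integrable (fun p : G × RP => Real.logb 2 (max c (Dsup ν (push p.1 ν) δ p.2)).toReal)
      (skew μ ν)) {a : ℝ}
    (ha : ∫ p, Real.logb 2 (max c (Dsup ν (push p.1 ν) δ p.2)).toReal ∂(skew μ ν) < a) :
    ∀ᵐ ω ∂(law μ), ∀ᶠ n : ℕ in atTop,
      Real.logb 2 (ν (Metric.ball (Z ω) (2 ^ (-(n * s))))).toReal ≤ n * a := by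
  have hFm : Measurable fun p : G × RP =>
      Real.logb 2 (max c (Dsup ν (push p.1 ν) δ p.2)).toReal :=
    measurable_logb_two.comp
      (measurable_const.max (measurable_Dsup_push_right ν δ)).ennreal_toReal
  filter_upwards [hZ.ae_tendsto_sum hFm hi, hZ.equivariant, hΛ, hZ.ae_forall_skew hfin,
    hZ.ae_of_ae (ae_measure_ball_ne_zero ν)] with ω h1 h2 h3 h4 h5
  filter_upwards [eventually_mul_N2_le hΛ0 h3 one_pos (by simpa using hs) hδ,
    h1.eventually (gt_mem_nhds ha), eventually_gt_atTop 0] with n e1 e2 e3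
  have hr : (0 : ℝ) < 2 ^ (-(n * s)) := by positivity
  obtain ⟨Q, hQ⟩ := exists_arc_eq_ball (Z ω) hr
  have hn : (0 : ℝ) < n := by exact_mod_cast e3
  rw [div_lt_iff₀ hn] at e2
  rw [← hQ]
  have := measure_arc_le_sum h2 hc hc' h4 (n := n) (Q := Q)
    (by rw [hQ]; exact Metric.mem_ball_self hr) (by rw [hQ]; exact h5 _ hr)
    fun k hk => small_pull _ hQ (e1 k (by omega))
  linarith

lemma logCount_top (b : ℕ) : logCount b ⊤ = ⊤ := by
  rw [logCount]
  simp

lemma logCount_max_le {c D : ENNReal} (hc : c ≤ 1) : logCount 1 (max c D) ≤ logCount 1 D := by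
  refine ENNReal.tsum_le_tsum fun n => ?_
  have h1 : ¬ (2 : ENNReal) ^ (1 * n) < c := not_lt.mpr (hc.trans (one_le_pow₀ one_le_two))
  simp only [lt_max_iff, h1, false_or, le_refl]

lemma logCount_mono (b : ℕ) {D D' : ENNReal} (h : D ≤ D') : logCount b D ≤ logCount b D' := by
  refine ENNReal.tsum_le_tsum fun n => ?_
  split_ifs with h1 h2
  · exact le_rfl
  · exact absurd (h1.trans_le h) h2
  · exact zero_le_one
  · exact le_rfl

lemma ae_ne_top_of_lintegral_logCount {X : Type*} [MeasurableSpace X] {m : Measure X}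
    {D : X → ENNReal} (hD : Measurable D) {b : ℕ} (h : ∫⁻ x, logCount b (D x) ∂m ≠ ⊤) :
    ∀ᵐ x ∂m, D x ≠ ⊤ := by
  filter_upwards [ae_lt_top ((measurable_logCount b).comp hD) h] with x hx hx'
  simp [hx', logCount_top] at hx

lemma integrable_logb_max {X : Type*} [MeasurableSpace X] {m : Measure X} [IsFiniteMeasure m]
    {D : X → ENNReal} (hD : Measurable D) (h : ∫⁻ x, logCount 1 (D x) ∂m ≠ ⊤) {c : ENNReal}
    (hc : c ≠ 0) (hc1 : c ≤ 1) : Integrable (fun x => Real.logb 2 (max c (D x)).toReal) m := by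
  have hi : Integrable (fun x => (logCount 1 (D x)).toReal) m :=
    integrable_toReal_of_lintegral_ne_top ((measurable_logCount 1).comp hD).aemeasurable h
  refine (hi.add (integrable_const |Real.logb 2 c.toReal|)).mono'
    (measurable_logb_two.comp (measurable_const.max hD).ennreal_toReal).aestronglyMeasurable ?_
  filter_upwards [ae_ne_top_of_lintegral_logCount hD h,
    ae_lt_top ((measurable_logCount 1).comp hD) h] with x hx hx'
  have hct : c ≠ ⊤ := ne_top_of_le_ne_top ENNReal.one_ne_top hc1
  rw [Real.norm_eq_abs, abs_le, Pi.add_apply]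
  have h0 : 0 ≤ (logCount 1 (D x)).toReal := ENNReal.toReal_nonneg
  have h0' := abs_nonneg (Real.logb 2 c.toReal)
  constructor
  · have := Real.logb_le_logb_of_le one_lt_two (ENNReal.toReal_pos hc hct)
      (ENNReal.toReal_mono (b := max c (D x)) (by simp [hct, hx]) (le_max_left _ _))
    linarith [neg_abs_le (Real.logb 2 c.toReal)]
  · have h1 := ofReal_logb_le_logCount one_pos (max c (D x))
    rw [Nat.cast_one, one_mul] at h1
    have := (ENNReal.ofReal_le_iff_le_toReal (b := logCount 1 (D x)) hx'.ne).mp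
      (h1.trans (logCount_max_le hc1))
    linarith

lemma lintegral_logCount_skew_le (δ : ℝ) :
    ∫⁻ p, logCount 1 (Dsup ν (push p.1 ν) δ p.2) ∂(skew μ ν) ≤ 4 := by
  rw [lintegral_skew (F := fun p => logCount 1 (Dsup ν (push p.1 ν) δ p.2))
    ((measurable_logCount 1).comp (measurable_Dsup_push_right ν δ))]
  calc _ ≤ ∫⁻ _ : G, 4 ∂μ := lintegral_mono fun A => lintegral_logCount_Dsup_le ν (push A ν) δ
    _ = 4 := by simp

lemma measurable_D0_push_right (ν : Measure RP) [IsFiniteMeasure ν] :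
    Measurable fun p : G × RP => D0 ν (push p.1 ν) p.2 :=
  Measurable.iInf fun _ => measurable_Dsup_push_right ν _

lemma measurable_D0_push_left (ν : Measure RP) [IsFiniteMeasure ν] :
    Measurable fun p : G × RP => D0 (push p.1 ν) ν p.2 :=
  Measurable.iInf fun _ => measurable_Dsup_push_left ν _

lemma tendsto_Dsup (σ τ : Measure RP) (x : RP) :
    Tendsto (fun n : ℕ => Dsup σ τ (1 / ((n : ℝ) + 1)) x) atTop (𝓝 (D0 σ τ x)) := by
  refine tendsto_atTop_iInf fun n n' h => Dsup_mono σ τ ?_ x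
  exact Nat.one_div_le_one_div h

lemma D0_le_Dsup (σ τ : Measure RP) (n : ℕ) (x : RP) :
    D0 σ τ x ≤ Dsup σ τ (1 / ((n : ℝ) + 1)) x := iInf_le _ n

lemma Dsup_le_Dsup_two (σ τ : Measure RP) (n : ℕ) (x : RP) :
    Dsup σ τ (1 / ((n : ℝ) + 1)) x ≤ Dsup σ τ 2 x := by
  refine Dsup_mono σ τ ?_ x
  rw [div_le_iff₀ (by positivity)]
  linarith [(Nat.cast_nonneg n : (0 : ℝ) ≤ n)]

lemma lintegral_logCount_D0_skew_le :
    ∫⁻ p, logCount 1 (D0 ν (push p.1 ν) p.2) ∂(skew μ ν) ≤ 4 := by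
  refine le_trans (lintegral_mono fun p => ?_) (lintegral_logCount_skew_le (1 / (((0 : ℕ) : ℝ) + 1)))
  exact logCount_mono 1 (D0_le_Dsup ν (push p.1 ν) 0 p.2)

/-- The upper bound for the mass of balls, with truncated local densities. -/
lemma IsBoundary.ae_eventually_logb_ball_le_trunc (hZ : IsBoundary μ ν Z) (hΛ0 : 0 ≤ Λ)
    (hΛ : ∀ᵐ ω ∂(law μ), Tendsto (fun n : ℕ => logN (rp n ω) / n) atTop (𝓝 Λ)) {s : ℝ} (hs : Λ < s)
    {c : ENNReal} (hc : c ≠ 0) (hc1 : c ≤ 1) {a : ℝ}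
    (ha : ∫ p, Real.logb 2 (max c (D0 ν (push p.1 ν) p.2)).toReal ∂(skew μ ν) < a) :
    ∀ᵐ ω ∂(law μ), ∀ᶠ n : ℕ in atTop,
      Real.logb 2 (ν (Metric.ball (Z ω) (2 ^ (-(n * s))))).toReal ≤ n * a := by
  have hct : c ≠ ⊤ := ne_top_of_le_ne_top ENNReal.one_ne_top hc1
  have hC : ∀ δ, ∫⁻ p, logCount 1 (Dsup ν (push p.1 ν) δ p.2) ∂(skew μ ν) ≠ ⊤ := fun δ =>
    ne_top_of_le_ne_top (by simp) (lintegral_logCount_skew_le δ)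
  have hC0 : ∫⁻ p, logCount 1 (D0 ν (push p.1 ν) p.2) ∂(skew μ ν) ≠ ⊤ :=
    ne_top_of_le_ne_top (by simp) lintegral_logCount_D0_skew_le
  obtain ⟨i1, h1⟩ := tendsto_integral_logb (m := skew μ ν)
    (D := fun n p => max c (Dsup ν (push p.1 ν) (1 / ((n : ℝ) + 1)) p.2))
    (L := fun p => max c (D0 ν (push p.1 ν) p.2)) (U := fun p => max c (Dsup ν (push p.1 ν) 2 p.2))
    (fun n => measurable_const.max (measurable_Dsup_push_right ν _))
    (ae_of_all _ fun p => ((pos_iff_ne_zero.mpr hc).trans_le (le_max_left _ _)).ne')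
    (by
      filter_upwards [ae_ne_top_of_lintegral_logCount (measurable_Dsup_push_right ν 2) (hC 2)]
        with p hp
      simp [hct, hp])
    (fun n p => max_le_max le_rfl (D0_le_Dsup _ _ _ _))
    (fun n p => max_le_max le_rfl (Dsup_le_Dsup_two _ _ _ _))
    (fun p => tendsto_const_nhds.max (tendsto_Dsup _ _ _))
    (integrable_logb_max (measurable_D0_push_right ν) hC0 hc hc1)
    (integrable_logb_max (measurable_Dsup_push_right ν 2) (hC 2) hc hc1)
  obtain ⟨n, hn⟩ := (h1.eventually (gt_mem_nhds ha)).exists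
  exact hZ.ae_eventually_logb_ball_le hΛ0 hΛ hs Nat.one_div_pos_of_nat hc hct
    (ae_ne_top_of_lintegral_logCount (measurable_Dsup_push_right ν _) (hC _)) (i1 n) hn

/-- If the integral were below a, balls of radius 2^(-ns) would have mass at most 2^(na), whereas
typical balls have at least linear mass. Hence -a ≤ s for every s > Λ. -/
lemma IsBoundary.neg_le_integral_trunc (hZ : IsBoundary μ ν Z) (hΛ0 : 0 ≤ Λ)
    (hΛ : ∀ᵐ ω ∂(law μ), Tendsto (fun n : ℕ => logN (rp n ω) / n) atTop (𝓝 Λ))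
    {c : ENNReal} (hc : c ≠ 0) (hc1 : c ≤ 1) :
    -Λ ≤ ∫ p, Real.logb 2 (max c (D0 ν (push p.1 ν) p.2)).toReal ∂(skew μ ν) := by
  refine le_of_forall_gt_imp_ge_of_dense fun a ha => ?_
  suffices h : ∀ s, Λ < s → -a ≤ s by
    have := le_of_forall_gt_imp_ge_of_dense h
    linarith
  intro s hs
  obtain ⟨ω, h1, C, h2⟩ := ((hZ.ae_eventually_logb_ball_le_trunc hΛ0 hΛ hs hc hc1 ha).and
    (hZ.ae_of_ae (ae_logb_measure_ball_ge ν))).exists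
  have h3 : ∀ᶠ n : ℕ in atTop, -a ≤ s + C / n := by
    filter_upwards [h1, eventually_gt_atTop 0] with n e1 e2
    have hn : (0 : ℝ) < n := by exact_mod_cast e2
    have hs0 : 0 < s := hΛ0.trans_lt hs
    have e3 := h2 (2 ^ (-(n * s))) (by positivity)
      (Real.rpow_le_one_of_one_le_of_nonpos one_le_two (by simp; positivity))
    rw [Real.logb_rpow two_pos one_lt_two.ne'] at e3
    have e4 : -a * n ≤ (s + C / n) * n := by
      rw [add_mul, div_mul_cancel₀ _ hn.ne']
      linarith
    exact le_of_mul_le_mul_right e4 hn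
  have h4 : Tendsto (fun n : ℕ => s + C / (n : ℝ)) atTop (𝓝 (s + 0)) :=
    tendsto_const_nhds.add (tendsto_const_div_atTop_nhds_zero_nat C)
  rw [add_zero] at h4
  exact ge_of_tendsto h4 h3

end

section

/-! ### Finiteness and positivity of the entropy -/

/-- The positive parts are dominated by `logCount 1`, so the lower bound on the truncated integrals
bounds the integrals of the negative parts uniformly, and Fatou's lemma passes to the limit. On {D =
0} the n-th truncated logarithm is -n, so this set must be null. -/
lemma integrable_logb_of_trunc {X : Type*} [MeasurableSpace X] {m : Measure X}
    [IsProbabilityMeasure m] {D : X → ENNReal} (hD : Measurable D)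
    (hC : ∫⁻ x, logCount 1 (D x) ∂m ≠ ⊤) {Λ : ℝ}
    (hΛ : ∀ n : ℕ, -Λ ≤ ∫ x, Real.logb 2 (max (2⁻¹ ^ n) (D x)).toReal ∂m) :
    (∀ᵐ x ∂m, D x ≠ 0) ∧ Integrable (fun x => Real.logb 2 (D x).toReal) m ∧
      Tendsto (fun n : ℕ => ∫ x, Real.logb 2 (max (2⁻¹ ^ n) (D x)).toReal ∂m) atTop
        (𝓝 (∫ x, Real.logb 2 (D x).toReal ∂m)) := by
  have hc1 : ∀ n : ℕ, (2⁻¹ : ENNReal) ^ n ≤ 1 := fun n =>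
    pow_le_one₀ zero_le (ENNReal.inv_le_one.mpr one_le_two)
  have hc0 : ∀ n : ℕ, (2⁻¹ : ENNReal) ^ n ≠ 0 := fun n => by simp
  have hi := fun n : ℕ => integrable_logb_max hD hC (hc0 n) (hc1 n)
  have hFm : ∀ n : ℕ, Measurable fun x => Real.logb 2 (max (2⁻¹ ^ n) (D x)).toReal := fun n =>
    measurable_logb_two.comp (measurable_const.max hD).ennreal_toReal
  set K := (∫⁻ x, logCount 1 (D x) ∂m).toReal with hK
  have hneg : ∀ n : ℕ, ∫⁻ x, ENNReal.ofReal (-Real.logb 2 (max (2⁻¹ ^ n) (D x)).toReal) ∂m ≤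
      ENNReal.ofReal (Λ + K) := by
    intro n
    have h1 := integral_eq_lintegral_pos_part_sub_lintegral_neg_part (hi n)
    have h2 : ∫⁻ x, ENNReal.ofReal (Real.logb 2 (max (2⁻¹ ^ n) (D x)).toReal) ∂m ≤
        ∫⁻ x, logCount 1 (D x) ∂m := lintegral_mono fun x => by
      have h1 := ofReal_logb_le_logCount one_pos (max (2⁻¹ ^ n) (D x))
      rw [Nat.cast_one, one_mul] at h1
      exact h1.trans (logCount_max_le (hc1 n))
    have h3 := ENNReal.toReal_mono hC h2
    have h4 : ∫⁻ x, ENNReal.ofReal (-Real.logb 2 (max (2⁻¹ ^ n) (D x)).toReal) ∂m ≠ ⊤ :=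
      ((hi n).neg.lintegral_lt_top).ne
    rw [← ENNReal.ofReal_toReal h4]
    exact ENNReal.ofReal_le_ofReal (by linarith [hΛ n])
  have hnm : ∀ n : ℕ, Measurable fun x =>
      ENNReal.ofReal (-Real.logb 2 (max (2⁻¹ ^ n) (D x)).toReal) := fun n =>
    (hFm n).neg.ennreal_ofReal
  have hfatou : ∫⁻ x, liminf (fun n : ℕ =>
      ENNReal.ofReal (-Real.logb 2 (max (2⁻¹ ^ n) (D x)).toReal)) atTop ∂m ≤
      ENNReal.ofReal (Λ + K) := by
    refine (lintegral_liminf_le hnm).trans (liminf_le_of_le (by isBoundedDefault) fun b hb => ?_)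
    obtain ⟨n, hn⟩ := hb.exists
    exact hn.trans (hneg n)
  have hfin := ae_lt_top (.liminf hnm)
    (ne_top_of_le_ne_top ENNReal.ofReal_ne_top hfatou)
  have htop := ae_ne_top_of_lintegral_logCount hD hC
  have hne : ∀ᵐ x ∂m, D x ≠ 0 := by
    filter_upwards [hfin] with x hx hx0
    refine hx.ne (Tendsto.liminf_eq ?_)
    have : ∀ n : ℕ, -Real.logb 2 (max (2⁻¹ ^ n) (D x)).toReal = n := by
      intro n
      rw [hx0, max_eq_left zero_le, ENNReal.toReal_pow, ENNReal.toReal_inv, Real.logb_pow,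
        Real.logb_inv]
      simp
    simp only [this]
    exact ENNReal.tendsto_ofReal_atTop.comp tendsto_natCast_atTop_atTop
  have hlim : ∀ x, Tendsto (fun n : ℕ => max (2⁻¹ ^ n) (D x)) atTop (𝓝 (D x)) := by
    intro x
    have h1 : Tendsto (fun n : ℕ => (2⁻¹ : ENNReal) ^ n) atTop (𝓝 0) :=
      ENNReal.tendsto_pow_atTop_nhds_zero_of_lt_one (by simp)
    simpa using h1.max (tendsto_const_nhds (x := D x))
  have hint : Integrable (fun x => Real.logb 2 (D x).toReal) m := by
    refine ⟨(measurable_logb_two.comp hD.ennreal_toReal).aestronglyMeasurable, ?_⟩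
    have h1 : ∫⁻ x, ENNReal.ofReal (-Real.logb 2 (D x).toReal) ∂m ≠ ⊤ := by
      refine ne_top_of_le_ne_top ENNReal.ofReal_ne_top (le_trans (lintegral_mono_ae ?_) hfatou)
      filter_upwards [hne, htop] with x h0 h1
      refine (Tendsto.liminf_eq ?_).ge
      refine (ENNReal.continuous_ofReal.tendsto _).comp ?_
      refine ((Real.continuousAt_logb (ENNReal.toReal_pos h0 h1).ne').tendsto.comp
        ((ENNReal.tendsto_toReal h1).comp (hlim x))).neg
    have h2 : ∫⁻ x, ENNReal.ofReal (Real.logb 2 (D x).toReal) ∂m ≠ ⊤ := by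
      refine ne_top_of_le_ne_top hC (lintegral_mono fun x => ?_)
      simpa using ofReal_logb_le_logCount one_pos (D x)
    rw [hasFiniteIntegral_iff_norm]
    refine lt_of_le_of_lt (lintegral_mono (g := fun x => ENNReal.ofReal (Real.logb 2 (D x).toReal) +
      ENNReal.ofReal (-Real.logb 2 (D x).toReal)) fun x => ?_) ?_
    · dsimp only
      rw [Real.norm_eq_abs]
      rcases abs_cases (Real.logb 2 (D x).toReal) with ⟨h, _⟩ | ⟨h, _⟩ <;> rw [h]
      · exact le_self_add
      · exact le_add_self
    · rw [lintegral_add_left (f := fun x => ENNReal.ofReal (Real.logb 2 (D x).toReal))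
        (measurable_logb_two.comp hD.ennreal_toReal).ennreal_ofReal]
      exact ENNReal.add_lt_top.mpr ⟨h2.lt_top, h1.lt_top⟩
  refine ⟨hne, hint, ?_⟩
  refine (tendsto_integral_logb (fun n => measurable_const.max hD) hne ?_
    (fun n x => le_max_right _ _) (fun n x => max_le_max (hc1 n) le_rfl) hlim hint
    (integrable_logb_max hD hC one_ne_zero le_rfl)).2
  filter_upwards [htop] with x hx
  simp [hx]

variable {μ : Measure G} [IsProbabilityMeasure μ] {ν : Measure RP} [IsProbabilityMeasure ν]
  {Z : (ℕ → G) → RP} {Λ : ℝ}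

/-- On a ν-null set the density of ν against Aν vanishes Aν-almost everywhere. Since that density is
almost everywhere nonzero, the set is Aν-null. -/
lemma ae_push_absolutelyContinuous {μ : Measure G}
    (h : ∀ᵐ p ∂(skew μ ν), D0 ν (push p.1 ν) p.2 ≠ 0) : ∀ᵐ A ∂μ, push A ν ≪ ν := by
  filter_upwards [ae_ae_push_of_ae_skew h] with A hA
  refine Measure.AbsolutelyContinuous.mk fun E _ hE0 => ?_
  rw [measure_eq_zero_iff_ae_notMem]
  filter_upwards [ae_D0_eq_zero ν (push A ν) hE0, hA] with x h1 h2 hx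
  exact h2 (h1 hx)

/-- The logarithmic density `-log D0 ν (Aν)`, jointly measurable. -/
def logDens (ν : Measure RP) (p : G × RP) : ℝ := -Real.logb 2 (D0 ν (push p.1 ν) p.2).toReal

lemma measurable_logDens (ν : Measure RP) [IsFiniteMeasure ν] : Measurable (logDens ν) :=
  (measurable_logb_two.comp (measurable_D0_push_right ν).ennreal_toReal).neg

/-- Radon–Nikodym derivatives are chosen separately for every A; `logDens` is a jointly measurable
version of their logarithms. -/
lemma ae_logDens_eq {A : G} (h : push A ν ≪ ν) : ∀ᵐ x ∂(push A ν),
    logDens ν (A, x) = Real.logb 2 ((push A ν).rnDeriv ν x).toReal := by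
  filter_upwards [ae_D0_eq h] with x hx
  rw [logDens, hx.2, ENNReal.toReal_inv, Real.logb_inv, neg_neg]

lemma ae_integral_logDens {μ : Measure G} (hac : ∀ᵐ A ∂μ, push A ν ≪ ν) :
    ∀ᵐ A ∂μ, ∫ x, logDens ν (A, A • x) ∂ν = entropyAt ν A := by
  filter_upwards [hac] with A hA
  rw [entropyAt, ← integral_congr_ae (ae_logDens_eq hA), push,
    (measurableEmbedding_smul A).integral_map]

lemma entropyConverges_of_integrable (hac : ∀ᵐ A ∂μ, push A ν ≪ ν)
    (hi : Integrable (logDens ν) (skew μ ν)) :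
    FurstenbergEntropyConverges μ ν ∧ furstenbergEntropy μ ν = ∫ p, logDens ν p ∂(skew μ ν) := by
  have h1 : Integrable (fun p : G × RP => logDens ν (p.1, p.1 • p.2)) (μ.prod ν) :=
    (integrable_map_measure hi.aestronglyMeasurable measurable_skew.aemeasurable).mp hi
  have h2 := ae_integral_logDens hac
  refine ⟨⟨?_, h1.integral_prod_left.congr h2⟩, ?_⟩
  · filter_upwards [hac, h1.prod_right_ae] with A e1 e2
    refine ⟨e1, Integrable.congr ?_ (ae_logDens_eq e1)⟩
    exact (measurableEmbedding_smul A).integrable_map_iff.mpr e2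
  · rw [furstenbergEntropy, ← integral_congr_ae h2, skew,
      integral_map measurable_skew.aemeasurable hi.aestronglyMeasurable, integral_prod _ h1]

lemma entropyAt_eq_klDiv {A : G} (hac : push A ν ≪ ν) :
    entropyAt ν A = (InformationTheory.klDiv (push A ν) ν).toReal / Real.log 2 := by
  rw [InformationTheory.toReal_klDiv_of_measure_eq hac (by simp), entropyAt, ← integral_div]
  rfl

/-- The entropy is an average of relative entropies of Aν against ν. If it vanished, Aν = ν would
hold for almost every A. -/
lemma furstenbergEntropy_pos {μ : Measure G} [NullSingletonClass ν] (hinv : NoInvariantMeasure μ)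
    (h : FurstenbergEntropyConverges μ ν) : 0 < furstenbergEntropy μ ν := by
  have hlog : 0 < Real.log 2 := Real.log_pos one_lt_two
  have h0 : 0 ≤ᵐ[μ] entropyAt ν := by
    filter_upwards [h.1] with A hA
    rw [Pi.zero_apply, entropyAt_eq_klDiv hA.1]
    positivity
  refine lt_of_le_of_ne (integral_nonneg_of_ae h0) fun he => ?_
  refine hinv ν inferInstance inferInstance ?_
  filter_upwards [(integral_eq_zero_iff_of_nonneg_ae h0 h.2).mp he.symm, h.1] with A h1 h2
  rw [Pi.zero_apply, entropyAt_eq_klDiv h2.1, div_eq_zero_iff, or_iff_left hlog.ne'] at h1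
  have h3 : Integrable (llr (push A ν) ν) (push A ν) := by
    refine (h2.2.mul_const (Real.log 2)).congr (ae_of_all _ fun x => ?_)
    dsimp only
    rw [Real.logb, div_mul_cancel₀ _ hlog.ne']
    rfl
  rw [ENNReal.toReal_eq_zero_iff, or_iff_left (InformationTheory.klDiv_ne_top h2.1 h3)] at h1
  exact InformationTheory.klDiv_eq_zero_iff.mp h1

/-- The entropy converges and is at most the exponent of the squared norms; moreover it bounds the
mass of balls from above. -/
lemma IsBoundary.entropy (hZ : IsBoundary μ ν Z) (hΛ0 : 0 ≤ Λ)
    (hΛ : ∀ᵐ ω ∂(law μ), Tendsto (fun n : ℕ => logN (rp n ω) / n) atTop (𝓝 Λ)) :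
    Integrable (logDens ν) (skew μ ν) ∧ FurstenbergEntropyConverges μ ν ∧
    furstenbergEntropy μ ν = ∫ p, logDens ν p ∂(skew μ ν) ∧ furstenbergEntropy μ ν ≤ Λ ∧
    ∀ s b : ℝ, Λ < s → b < furstenbergEntropy μ ν → ∀ᵐ ω ∂(law μ), ∀ᶠ n : ℕ in atTop,
      Real.logb 2 (ν (Metric.ball (Z ω) (2 ^ (-(n * s))))).toReal ≤ n * -b := by
  have hc1 : ∀ n : ℕ, (2⁻¹ : ENNReal) ^ n ≤ 1 := fun n =>
    pow_le_one₀ zero_le (ENNReal.inv_le_one.mpr one_le_two)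
  have hc0 : ∀ n : ℕ, (2⁻¹ : ENNReal) ^ n ≠ 0 := fun n => by simp
  have hge := fun n : ℕ => hZ.neg_le_integral_trunc hΛ0 hΛ (hc0 n) (hc1 n)
  obtain ⟨h1, h2, h3⟩ := integrable_logb_of_trunc (measurable_D0_push_right ν)
    (ne_top_of_le_ne_top (by simp) lintegral_logCount_D0_skew_le) hge
  have hi : Integrable (logDens ν) (skew μ ν) := h2.neg
  obtain ⟨h4, h5⟩ := entropyConverges_of_integrable (ae_push_absolutelyContinuous h1) hi
  have h6 : furstenbergEntropy μ ν = -∫ p, Real.logb 2 (D0 ν (push p.1 ν) p.2).toReal ∂(skew μ ν) := by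
    rw [h5, ← integral_neg]
    rfl
  refine ⟨hi, h4, h5, ?_, fun s b hs hb => ?_⟩
  · rw [h6]
    linarith [ge_of_tendsto' h3 hge]
  · have hb' : ∫ p, Real.logb 2 (D0 ν (push p.1 ν) p.2).toReal ∂(skew μ ν) < -b := by linarith
    obtain ⟨n, hn⟩ := (h3.eventually (gt_mem_nhds hb')).exists
    exact hZ.ae_eventually_logb_ball_le_trunc hΛ0 hΛ hs (hc0 n) (hc1 n) hn

end

section

/-! ### Lower bounds for the mass of small balls -/

variable {μ : Measure G} [IsProbabilityMeasure μ] {ν : Measure RP} [IsProbabilityMeasure ν]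
  {Z : (ℕ → G) → RP} {Λ : ℝ}

lemma ae_D0_push_left_eq {μ : Measure G} (hac : ∀ᵐ A ∂μ, push A ν ≪ ν) :
    ∀ᵐ p ∂(skew μ ν), D0 (push p.1 ν) ν p.2 ≠ 0 ∧ D0 (push p.1 ν) ν p.2 ≠ ⊤ ∧
      Real.logb 2 (D0 (push p.1 ν) ν p.2).toReal = logDens ν p := by
  have hm := measurable_D0_push_left ν
  refine ae_skew_of_ae_ae_push ?_ ?_
  · refine (measurableSet_eq_fun hm measurable_const).compl.inter
      ((measurableSet_eq_fun hm measurable_const).compl.inter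
      (measurableSet_eq_fun (measurable_logb_two.comp hm.ennreal_toReal) (measurable_logDens ν)))
  · filter_upwards [hac] with A hA
    filter_upwards [ae_D0_eq hA, ae_logDens_eq hA, Measure.rnDeriv_pos hA,
      hA.ae_le (Measure.rnDeriv_ne_top (push A ν) ν)] with x h1 h2 h3 h4
    rw [h1.1, h2]
    exact ⟨h3.ne', h4, rfl⟩

lemma lintegral_logCount_push_left_ne_top (hac : ∀ᵐ A ∂μ, push A ν ≪ ν)
    (hi : Integrable (logDens ν) (skew μ ν)) (δ : ℝ) :
    ∫⁻ p, logCount 2 (Dsup (push p.1 ν) ν δ p.2) ∂(skew μ ν) ≠ ⊤ := by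
  have hm := (measurable_logCount 2).comp (measurable_Dsup_push_left ν δ)
  have hm0 := (measurable_logCount 1).comp (measurable_D0_push_left ν)
  have h1 : ∫⁻ p, logCount 2 (Dsup (push p.1 ν) ν δ p.2) ∂(skew μ ν) ≤
      ∫⁻ p, logCount 1 (D0 (push p.1 ν) ν p.2) ∂(skew μ ν) + 4 := by
    rw [lintegral_skew (F := fun p => logCount 2 (Dsup (push p.1 ν) ν δ p.2)) hm,
      lintegral_skew (F := fun p => logCount 1 (D0 (push p.1 ν) ν p.2)) hm0]
    calc _ ≤ ∫⁻ A, (∫⁻ x, logCount 1 (D0 (push A ν) ν x) ∂(push A ν) + 4) ∂μ := by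
          refine lintegral_mono_ae ?_
          filter_upwards [hac] with A hA
          refine (lintegral_logCount_Dsup_le_of_ac hA δ).trans (le_of_eq ?_)
          congr 1
          refine lintegral_congr_ae ?_
          filter_upwards [ae_D0_eq hA] with x hx
          rw [hx.1]
      _ = _ := by rw [lintegral_add_right _ measurable_const]; simp
  have h2 : ∫⁻ p, logCount 1 (D0 (push p.1 ν) ν p.2) ∂(skew μ ν) ≤
      ∫⁻ p, ENNReal.ofReal |logDens ν p| ∂(skew μ ν) + 1 := by
    calc _ ≤ ∫⁻ p, (ENNReal.ofReal |logDens ν p| + 1) ∂(skew μ ν) := by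
          refine lintegral_mono_ae ?_
          filter_upwards [ae_D0_push_left_eq hac] with p hp
          rw [← hp.2.2]
          exact logCount_one_le hp.2.1
      _ = _ := by rw [lintegral_add_right _ measurable_const]; simp
  have h3 : ∫⁻ p, ENNReal.ofReal |logDens ν p| ∂(skew μ ν) < ⊤ := hi.abs.lintegral_lt_top
  exact ne_top_of_le_ne_top (by finiteness) (h1.trans (add_le_add_left h2 4))

lemma integrable_logb_Dsup_push_left (hac : ∀ᵐ A ∂μ, push A ν ≪ ν)
    (hi : Integrable (logDens ν) (skew μ ν)) :
    Integrable (fun p : G × RP => Real.logb 2 (Dsup (push p.1 ν) ν 2 p.2).toReal) (skew μ ν) := by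
  have hC := lintegral_logCount_push_left_ne_top hac hi 2
  have hm := (measurable_logCount 2).comp (measurable_Dsup_push_left ν 2)
  have hi2 : Integrable (fun p : G × RP => (logCount 2 (Dsup (push p.1 ν) ν 2 p.2)).toReal)
      (skew μ ν) := integrable_toReal_of_lintegral_ne_top hm.aemeasurable hC
  refine (hi.abs.add (hi2.const_mul 2)).mono'
    (measurable_logb_two.comp (measurable_Dsup_push_left ν 2).ennreal_toReal).aestronglyMeasurable ?_
  filter_upwards [ae_D0_push_left_eq hac, ae_lt_top hm hC,
    ae_ne_top_of_lintegral_logCount (measurable_Dsup_push_left ν 2) hC] with p h1 h2 h3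
  have e1 : D0 (push p.1 ν) ν p.2 ≤ Dsup (push p.1 ν) ν 2 p.2 :=
    (D0_le_Dsup _ _ 0 _).trans (Dsup_le_Dsup_two _ _ 0 _)
  have e2 := Real.logb_le_logb_of_le one_lt_two (ENNReal.toReal_pos h1.1 h1.2.1)
    (ENNReal.toReal_mono h3 e1)
  rw [h1.2.2] at e2
  have e3 := ofReal_logb_le_logCount two_pos (Dsup (push p.1 ν) ν 2 p.2)
  have h2' : logCount 2 (Dsup (push p.1 ν) ν 2 p.2) ≠ ⊤ := h2.ne
  rw [ENNReal.ofReal_le_iff_le_toReal (by finiteness), ENNReal.toReal_mul] at e3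
  simp only [Nat.cast_ofNat, ENNReal.toReal_ofNat] at e3
  have e4 : 0 ≤ (logCount 2 (Dsup (push p.1 ν) ν 2 p.2)).toReal := ENNReal.toReal_nonneg
  rw [Real.norm_eq_abs, abs_le, Pi.add_apply]
  constructor
  · linarith [neg_abs_le (logDens ν p)]
  · linarith [abs_nonneg (logDens ν p)]

/-- Long preimages of balls around the boundary point have large mass. -/
lemma eventually_half_le [NullSingletonClass ν] {ω : ℕ → G}
    (hω : ∀ n, Z (shift^[n] ω) = ω n • Z (shift^[n + 1] ω))
    (h1 : Tendsto (fun n : ℕ => logN (rp n ω) / n) atTop (𝓝 Λ)) {I : ℝ} (hI : Λ ≤ I)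
    (h2 : Tendsto (fun n : ℕ => logExp (rp n ω) (Z (shift^[n] ω)) / n) atTop (𝓝 I))
    {q : ℕ} (hq : 0 < q) {t : ℝ} (ht : t < q * Λ) :
    ∀ᶠ j : ℕ in atTop, ∀ Q, arc Q = Metric.ball (Z ω) (2 ^ (-(j * t))) →
      1 / 2 ≤ ν (arc (pull (rp (q * j) ω) Q)) := by
  have hq' : (0 : ℝ) < q := by exact_mod_cast hq
  -- Any rate s with t / q < s < Λ: after qj steps both `N2` and the expansion at Z(σ^(qj) ω) exceed
  -- 2^(sqj).
  obtain ⟨s, hs1, hs2⟩ := exists_between ((div_lt_iff₀ hq').mpr (by linarith : t < Λ * q))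
  rw [div_lt_iff₀ hq'] at hs1
  obtain ⟨κ, hκ, hν⟩ := exists_measure_nrm2_lt_le ν (ε := 1 / 2) (by simp)
  have hqj : Tendsto (fun j : ℕ => q * j) atTop atTop := tendsto_id.const_mul_atTop' hq
  have hb : 0 < 2 * (s * q - t) := by linarith
  filter_upwards [hqj.eventually (h1.eventually (lt_mem_nhds hs2)),
    hqj.eventually (h2.eventually (lt_mem_nhds (hs2.trans_le hI))),
    (tendsto_two_rpow_neg hb (Real.logb 2 (4 / κ))).eventually (gt_mem_nhds one_pos),
    eventually_gt_atTop 0] with j e1 e2 e3 e4 Q hQ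
  have hn : (0 : ℝ) < ((q * j : ℕ) : ℝ) := by exact_mod_cast Nat.mul_pos hq e4
  rw [lt_div_iff₀ hn] at e1 e2
  set g := rp (q * j) ω with hg
  set z := Z (shift^[q * j] ω) with hz
  have hgz : g • z = Z ω := rp_smul_of_equivariant hω _
  set v : ℝ := 2 ^ (s * ((q * j : ℕ) : ℝ)) with hv
  have hv0 : 0 < v := by positivity
  have hN : v ≤ N2 g := by
    rw [N2_eq_rpow]
    exact Real.rpow_le_rpow_of_exponent_le one_le_two e1.le
  have hz2 : v ≤ nrm2 g z := by
    rw [nrm2_eq_rpow]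
    exact Real.rpow_le_rpow_of_exponent_le one_le_two e2.le
  -- Well-expanded directions x and the expanded direction z are sent within 2 / (√κ v) of each
  -- other, eventually less than the radius. As g z = Z ω, all such x lie in the pulled-back ball,
  -- and they have mass at least 1/2.
  have key : {x | nrm2 g x < κ * N2 g}ᶜ ⊆ arc (pull g Q) := by
    intro x hx
    rw [Set.mem_compl_iff, Set.mem_ofPred_eq, not_lt] at hx
    rw [mem_arc_pull, hQ, Metric.mem_ball, ← hgz]
    have hx' : κ * v ≤ nrm2 g x := (mul_le_mul_of_nonneg_left hN hκ.le).trans hx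
    have h3 := dist_smul_le g x z (mul_pos hκ hv0) hv0 hx' hz2
    refine lt_of_pow_lt_pow_left₀ 2 (by positivity) (h3.trans_lt ?_)
    have h4 : (4 / (κ * v * v) : ℝ) = 2 ^ (Real.logb 2 (4 / κ) - j * (2 * (s * q - t))) *
        (2 ^ (-(j * t))) ^ 2 := by
      rw [hv, ← Real.rpow_natCast (2 ^ (-(j * t))), ← Real.rpow_mul two_pos.le, mul_assoc,
        ← Real.rpow_add two_pos, ← Real.rpow_add two_pos, ← div_div, div_eq_mul_inv (4 / κ),
        ← Real.rpow_neg two_pos.le]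
      nth_rewrite 1 [← Real.rpow_logb two_pos one_lt_two.ne' (by positivity : 0 < 4 / κ)]
      rw [← Real.rpow_add two_pos]
      congr 1
      push_cast
      ring
    rw [h4]
    have h5 : (0 : ℝ) < (2 ^ (-(j * t))) ^ 2 := by positivity
    exact (mul_lt_iff_lt_one_left h5).mpr e3
  refine le_trans ?_ (measure_mono key)
  rw [prob_compl_eq_one_sub (measurableSet_lt (measurable_nrm2_left g) measurable_const)]
  calc (1 / 2 : ENNReal) = 1 - 1 / 2 := by simp
    _ ≤ _ := tsub_le_tsub_left (hν g) 1

lemma tendsto_mul_div {S : ℕ → ℝ} {I : ℝ} (h : Tendsto (fun n : ℕ => S n / n) atTop (𝓝 I)) {q : ℕ}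
    (hq : 0 < q) : Tendsto (fun j : ℕ => S (q * j) / j) atTop (𝓝 (q * I)) := by
  have hqj : Tendsto (fun j : ℕ => q * j) atTop atTop := tendsto_id.const_mul_atTop' hq
  have hq' : (q : ℝ) ≠ 0 := by exact_mod_cast hq.ne'
  refine ((h.comp hqj).const_mul (q : ℝ)).congr fun j => ?_
  simp only [Function.comp_def]
  push_cast
  rw [mul_div_assoc', mul_div_mul_left _ _ hq']

/-- For t strictly between KΛ and (K + 1)Λ the arcs are δ-small during the first Kj steps, each of
mean cost close to the entropy. The next j steps use the maximal function over all arcs, at bounded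
mean cost, and lead to an arc of mass at least 1/2. -/
lemma IsBoundary.ae_eventually_le_logb_ball [NullSingletonClass ν] (hZ : IsBoundary μ ν Z)
    (hμ : Integrable logN μ) (hΛ0 : 0 ≤ Λ)
    (hmean : Tendsto (fun n : ℕ => meanLog μ n / n) atTop (𝓝 Λ))
    (hΛ : ∀ᵐ ω ∂(law μ), Tendsto (fun n : ℕ => logN (rp n ω) / n) atTop (𝓝 Λ))
    (hac : ∀ᵐ A ∂μ, push A ν ≪ ν) (hi : Integrable (logDens ν) (skew μ ν)) {K : ℕ} (hK : 0 < K)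
    {t : ℝ} (ht : K * Λ < t) (ht' : t < (K + 1) * Λ) {a : ℝ}
    (ha : K * ∫ p, logDens ν p ∂(skew μ ν) +
      ∫ p, Real.logb 2 (Dsup (push p.1 ν) ν 2 p.2).toReal ∂(skew μ ν) < a) :
    ∀ᵐ ω ∂(law μ), ∀ᶠ j : ℕ in atTop,
      j * -a ≤ Real.logb 2 (ν (Metric.ball (Z ω) (2 ^ (-(j * t))))).toReal := by
  have hD0 := ae_D0_push_left_eq (ν := ν) hac
  have hC := lintegral_logCount_push_left_ne_top hac hi
  have hfin := fun δ => ae_ne_top_of_lintegral_logCount (measurable_Dsup_push_left ν δ) (hC δ)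
  have hi2 := integrable_logb_Dsup_push_left hac hi
  obtain ⟨i1, h1⟩ := tendsto_integral_logb (m := skew μ ν)
    (D := fun n p => Dsup (push p.1 ν) ν (1 / ((n : ℝ) + 1)) p.2)
    (L := fun p => D0 (push p.1 ν) ν p.2) (U := fun p => Dsup (push p.1 ν) ν 2 p.2)
    (fun n => measurable_Dsup_push_left ν _) (hD0.mono fun p hp => hp.1) (hfin 2)
    (fun n p => D0_le_Dsup _ _ _ _) (fun n p => Dsup_le_Dsup_two _ _ _ _)
    (fun p => tendsto_Dsup _ _ _) (hi.congr (hD0.mono fun p hp => hp.2.2.symm)) hi2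
  rw [integral_congr_ae (hD0.mono fun p hp => hp.2.2)] at h1
  set I2 := ∫ p, Real.logb 2 (Dsup (push p.1 ν) ν 2 p.2).toReal ∂(skew μ ν) with hI2
  obtain ⟨n₀, hn₀⟩ := (((h1.const_mul (K : ℝ)).add_const I2).eventually (gt_mem_nhds ha)).exists
  set δ := 1 / ((n₀ : ℝ) + 1) with hδ
  have hδ0 : 0 < δ := Nat.one_div_pos_of_nat
  have hm := fun δ => measurable_logb_two.comp (measurable_Dsup_push_left ν δ).ennreal_toReal
  filter_upwards [hZ.ae_tendsto_sum (hm δ) (i1 n₀), hZ.ae_tendsto_sum (hm 2) hi2, hZ.equivariant,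
    hΛ, hZ.ae_tendsto_logExp hμ, hZ.ae_forall_skew (hfin δ), hZ.ae_forall_skew (hfin 2)]
    with ω e1 e2 e3 e4 e5 e6 e7
  simp only [Function.comp_def] at e1 e2
  have f1 := tendsto_mul_div e1 hK
  have f2 := (tendsto_mul_div e2 (Nat.succ_pos K)).sub (tendsto_mul_div e2 hK)
  -- The last term, 1 / j, absorbs the logarithm of the final mass 1/2.
  have f3 := (f1.add f2).add (tendsto_const_div_atTop_nhds_zero_nat (1 : ℝ))
  have hlt : K * ∫ p, Real.logb 2 (Dsup (push p.1 ν) ν δ p.2).toReal ∂(skew μ ν) +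
      ((K.succ : ℕ) * I2 - K * I2) + 0 < a := by
    push_cast
    linarith
  filter_upwards [f3.eventually (gt_mem_nhds hlt), eventually_gt_atTop 0,
    eventually_mul_N2_le hΛ0 e4 hK ht hδ0,
    eventually_half_le (ν := ν) e3 e4 (hZ.le_integral_logExp hμ hmean) e5 (Nat.succ_pos K)
      (by push_cast; exact ht')] with j g1 g2 g3 g4
  have hj : (0 : ℝ) < j := by exact_mod_cast g2
  have hr : (0 : ℝ) < 2 ^ (-(j * t)) := by positivity
  obtain ⟨Q, hQ⟩ := exists_arc_eq_ball (Z ω) hr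
  have hzQ : Z ω ∈ arc Q := by rw [hQ]; exact Metric.mem_ball_self hr
  have g5 := g4 Q hQ
  rw [Nat.succ_mul] at g1 g5
  have g6 : ν (arc (pull (rp (K * j + j) ω) Q)) ≠ 0 :=
    ((by simp : (0 : ENNReal) < 1 / 2).trans_le g5).ne'
  obtain ⟨g7, g8⟩ := le_measure_arc_of_sum e3 e7 hzQ (n := K * j) (m := j)
    (fun k _ _ => small_two _) g6
  obtain ⟨-, g9⟩ := le_measure_arc_of_sum e3 e6 hzQ (n := 0) (m := K * j)
    (fun k hk _ => small_pull _ hQ (g3 k (by omega))) (by rwa [zero_add])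
  rw [zero_add, show rp 0 ω = 1 from rfl, pull_one, hQ, ← Finset.range_eq_Ico] at g9
  rw [Finset.sum_Ico_eq_sub _ (by omega)] at g8
  have g10 : -1 ≤ Real.logb 2 (ν (arc (pull (rp (K * j + j) ω) Q))).toReal := by
    have := ENNReal.toReal_mono (measure_ne_top _ _) g5
    have h := Real.logb_le_logb_of_le one_lt_two (by simp) this
    simpa [Real.logb_inv] using h
  rw [← sub_div, ← add_div, ← add_div, div_lt_iff₀ hj] at g1
  linarith

end

/-! ### Local dimensions -/

/-- Monotonicity interpolates between multiples of a fixed step, by floor in one bound and ceiling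
in the other. Then i → ∞ sharpens the lower bound and K → ∞ makes the crude cost I negligible. -/
lemma tendsto_div_of_bounds {f : ℝ → ℝ} (hf : Monotone f) {h Λ I : ℝ} (hΛ : 0 < Λ)
    (hlo : ∀ i : ℕ, ∀ᶠ n : ℕ in atTop,
      n * (h - 1 / ((i : ℝ) + 1)) ≤ f (n * (Λ + 1 / ((i : ℝ) + 1))))
    (hup : ∀ K : ℕ, 0 < K → ∀ᶠ j : ℕ in atTop,
      f (j * ((K + 1) * Λ - Λ / 4)) ≤ j * (K * h + I + 1)) :
    Tendsto (fun t => f t / t) atTop (𝓝 (h / Λ)) := by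
  rw [tendsto_order]
  constructor
  · intro a ha
    have h1 : Tendsto (fun i : ℕ => (h - 1 / ((i : ℝ) + 1)) / (Λ + 1 / ((i : ℝ) + 1))) atTop
        (𝓝 ((h - 0) / (Λ + 0))) :=
      (tendsto_const_nhds.sub tendsto_one_div_add_atTop_nhds_zero_nat).div
        (tendsto_const_nhds.add tendsto_one_div_add_atTop_nhds_zero_nat) (by simpa using hΛ.ne')
    rw [sub_zero, add_zero] at h1
    obtain ⟨i, hi⟩ := (h1.eventually (lt_mem_nhds ha)).exists
    have hs : 0 < Λ + 1 / ((i : ℝ) + 1) := by positivity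
    have hlo' := hlo i
    generalize Λ + 1 / ((i : ℝ) + 1) = s at hi hs hlo'
    generalize h - 1 / ((i : ℝ) + 1) = b at hi hlo'
    have hfl : Tendsto (fun t : ℝ => ⌊t / s⌋₊) atTop atTop :=
      tendsto_nat_floor_atTop.comp (tendsto_id.atTop_div_const hs)
    have h2 : Tendsto (fun t : ℝ => b / s - |b| / t) atTop (𝓝 (b / s - 0)) :=
      tendsto_const_nhds.sub (tendsto_const_nhds.div_atTop tendsto_id)
    rw [sub_zero] at h2
    filter_upwards [hfl.eventually hlo', h2.eventually (lt_mem_nhds hi), eventually_gt_atTop 0]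
      with t e1 e2 e3
    refine e2.trans_le ?_
    rw [le_div_iff₀ e3, sub_mul, div_mul_cancel₀ _ e3.ne']
    have hts : 0 ≤ t / s := by positivity
    have e4 := Nat.floor_le hts
    have e5 := Nat.lt_floor_add_one (t / s)
    have e6 : f (⌊t / s⌋₊ * s) ≤ f t := hf (by rwa [le_div_iff₀ hs] at e4)
    have e7 : (t / s - ⌊t / s⌋₊) * b ≤ |b| := by
      calc (t / s - ⌊t / s⌋₊) * b ≤ (t / s - ⌊t / s⌋₊) * |b| :=
            mul_le_mul_of_nonneg_left (le_abs_self b) (by linarith)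
        _ ≤ 1 * |b| := mul_le_mul_of_nonneg_right (by linarith) (abs_nonneg b)
        _ = |b| := one_mul _
    have e8 : b / s * t = t / s * b := by ring
    linarith
  · intro a ha
    have h1 : Tendsto (fun K : ℕ => (h + (I + 1) / (K : ℝ)) / (Λ + (Λ - Λ / 4) / (K : ℝ))) atTop
        (𝓝 ((h + 0) / (Λ + 0))) :=
      (tendsto_const_nhds.add (tendsto_const_div_atTop_nhds_zero_nat _)).div
        (tendsto_const_nhds.add (tendsto_const_div_atTop_nhds_zero_nat _)) (by simpa using hΛ.ne')
    rw [add_zero, add_zero] at h1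
    obtain ⟨K, hK, hK0⟩ := ((h1.eventually (gt_mem_nhds ha)).and (eventually_gt_atTop 0)).exists
    have hK' : (0 : ℝ) < K := by exact_mod_cast hK0
    have h3 : (K * h + I + 1) / ((K + 1) * Λ - Λ / 4) < a := by
      have : (K * h + I + 1) / ((K + 1) * Λ - Λ / 4) =
          (h + (I + 1) / (K : ℝ)) / (Λ + (Λ - Λ / 4) / (K : ℝ)) := by
        rw [← mul_div_mul_left (h + (I + 1) / (K : ℝ)) _ hK'.ne', mul_add, mul_add,
          mul_div_cancel₀ _ hK'.ne', mul_div_cancel₀ _ hK'.ne']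
        congr 1 <;> ring
      rwa [this]
    have hs : 0 < (K + 1) * Λ - Λ / 4 := by nlinarith
    have hup' := hup K hK0
    generalize (K + 1) * Λ - Λ / 4 = s at h3 hs hup'
    generalize K * h + I + 1 = b at h3 hup'
    have hfl : Tendsto (fun t : ℝ => ⌈t / s⌉₊) atTop atTop :=
      tendsto_nat_ceil_atTop.comp (tendsto_id.atTop_div_const hs)
    have h2 : Tendsto (fun t : ℝ => b / s + |b| / t) atTop (𝓝 (b / s + 0)) :=
      tendsto_const_nhds.add (tendsto_const_nhds.div_atTop tendsto_id)
    rw [add_zero] at h2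
    filter_upwards [hfl.eventually hup', h2.eventually (gt_mem_nhds h3), eventually_gt_atTop 0]
      with t e1 e2 e3
    refine lt_of_le_of_lt ?_ e2
    rw [div_le_iff₀ e3, add_mul, div_mul_cancel₀ _ e3.ne']
    have hts : 0 ≤ t / s := by positivity
    have e4 := Nat.le_ceil (t / s)
    have e5 := Nat.ceil_lt_add_one hts
    have e6 : f t ≤ f (⌈t / s⌉₊ * s) := hf (by rwa [div_le_iff₀ hs] at e4)
    have e7 : (⌈t / s⌉₊ - t / s) * b ≤ |b| := by
      calc (⌈t / s⌉₊ - t / s) * b ≤ (⌈t / s⌉₊ - t / s) * |b| :=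
            mul_le_mul_of_nonneg_left (le_abs_self b) (by linarith)
        _ ≤ 1 * |b| := mul_le_mul_of_nonneg_right (by linarith) (abs_nonneg b)
        _ = |b| := one_mul _
    have e8 : b / s * t = t / s * b := by ring
    linarith

lemma tendsto_logb_nhdsGT_zero : Tendsto (Real.logb 2) (𝓝[>] 0) atBot :=
  Real.tendsto_log_nhdsGT_zero.atBot_div_const (Real.log_pos one_lt_two)

/-- The chord has derivative 2π at 0, so its logarithm differs from that of r by a bounded amount.
The two metrics therefore give the same local dimensions. -/
lemma tendsto_logb_chord : Tendsto (fun r : ℝ =>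
    Real.logb 2 (2 * Real.sin (Real.pi * r)) / Real.logb 2 r) (𝓝[>] 0) (𝓝 1) := by
  have h1 : HasDerivAt (fun r : ℝ => 2 * Real.sin (Real.pi * r)) (2 * Real.pi) 0 := by
    have h := (((hasDerivAt_id (0 : ℝ)).const_mul Real.pi).sin).const_mul 2
    simpa using h
  have h2 := h1.tendsto_slope_zero.mono_left (nhdsWithin_mono 0 fun x (hx : 0 < x) => hx.ne')
  have h3 := (Real.continuousAt_logb (b := 2) (x := 2 * Real.pi)
    (by positivity)).tendsto.comp h2
  have h4 := (h3.div_atBot tendsto_logb_nhdsGT_zero).const_add 1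
  rw [add_zero] at h4
  refine h4.congr' ?_
  have h5 : ∀ᶠ r : ℝ in 𝓝[>] 0, r < 1 / 2 :=
    eventually_nhdsWithin_of_eventually_nhds (gt_mem_nhds (by norm_num))
  filter_upwards [self_mem_nhdsWithin, h5] with r hr hr2
  have hr0 : 0 < r := hr
  have hpi := Real.pi_pos
  have hsin : 0 < Real.sin (Real.pi * r) :=
    Real.sin_pos_of_pos_of_lt_pi (by positivity) (by nlinarith)
  have hlog : Real.logb 2 r < 0 := Real.logb_neg one_lt_two hr0 (by linarith)
  simp only [Function.comp_def, zero_add, mul_zero, Real.sin_zero, sub_zero, smul_eq_mul]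
  rw [Real.logb_mul (inv_ne_zero hr0.ne') (by positivity), Real.logb_inv, add_div, neg_div,
    div_self hlog.ne]
  ring

lemma rpBall_mono (x : RP) {r r' : ℝ} (h : r ≤ r') : rpBall x r ⊆ rpBall x r' :=
  fun _ hy => lt_of_lt_of_le hy h

lemma hasLocalDim_of_tendsto {ν : Measure RP} {x : RP} {α : ℝ}
    (hpos : ∀ r : ℝ, 0 < r → ν (Metric.ball x r) ≠ 0)
    (h : Tendsto (fun t : ℝ => -Real.logb 2 (ν (Metric.ball x (2 ^ (-t)))).toReal / t) atTop (𝓝 α)) :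
    HasLocalDim ν x α := by
  have hpi := Real.pi_pos
  have hsin : ∀ r : ℝ, 0 < r → r ≤ 1 / 2 → 0 < 2 * Real.sin (Real.pi * r) := fun r h1 h2 =>
    mul_pos two_pos (Real.sin_pos_of_pos_of_lt_pi (by positivity) (by nlinarith))
  refine ⟨fun r hr => ?_, ?_⟩
  · refine lt_of_lt_of_le ?_ (measure_mono (rpBall_mono x (min_le_left r (1 / 2))))
    have h0 : 0 < min r (1 / 2) := lt_min hr (by norm_num)
    rw [rpBall_eq_ball x h0 (min_le_right _ _)]
    exact pos_iff_ne_zero.mpr (hpos _ (hsin _ h0 (min_le_right _ _)))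
  · have ht : Tendsto (fun r : ℝ => -Real.logb 2 (2 * Real.sin (Real.pi * r))) (𝓝[>] 0) atTop := by
      have := tendsto_logb_chord.pos_mul_atBot one_pos tendsto_logb_nhdsGT_zero
      refine (tendsto_neg_atBot_atTop.comp this).congr' ?_
      have h5 : ∀ᶠ r : ℝ in 𝓝[>] 0, r < 1 :=
        eventually_nhdsWithin_of_eventually_nhds (gt_mem_nhds one_pos)
      filter_upwards [self_mem_nhdsWithin, h5] with r hr hr1
      simp only [Function.comp_def]
      rw [div_mul_cancel₀ _ (Real.logb_neg one_lt_two hr hr1).ne]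
    have h2 := (h.comp ht).mul tendsto_logb_chord
    rw [mul_one] at h2
    refine h2.congr' ?_
    have h5 : ∀ᶠ r : ℝ in 𝓝[>] 0, r < 1 / 2 :=
      eventually_nhdsWithin_of_eventually_nhds (gt_mem_nhds (by norm_num))
    filter_upwards [self_mem_nhdsWithin, h5, ht.eventually (eventually_gt_atTop 0)] with r hr hr1 hr2
    have hs := hsin r hr hr1.le
    simp only [Function.comp_def, neg_neg]
    rw [Real.rpow_logb two_pos one_lt_two.ne' hs, rpBall_eq_ball x hr hr1.le, neg_div_neg_eq]
    exact div_mul_div_cancel₀ (neg_pos.mp hr2).ne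

lemma measurable_measure_ball (ν : Measure RP) [SFinite ν] (r : ℝ) :
    Measurable fun x => ν (Metric.ball x r) := by
  have hs : MeasurableSet {p : RP × RP | dist p.2 p.1 < r} :=
    measurableSet_lt (by fun_prop) measurable_const
  exact measurable_measure_prodMk_left hs

lemma IsBoundary.ae_of_ae_comp {μ : Measure G} {ν : Measure RP} {Z : (ℕ → G) → RP}
    (hZ : IsBoundary μ ν Z) {P : RP → Prop} (hP : MeasurableSet {x | P x})
    (h : ∀ᵐ ω ∂(law μ), P (Z ω)) : ∀ᵐ x ∂ν, P x := by
  rw [← hZ.map_eq]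
  exact (ae_map_iff hZ.measurable.aemeasurable hP).mpr h

lemma measurableSet_eventually {X : Type*} [MeasurableSpace X] {f g : ℕ → X → ℝ}
    (hf : ∀ n, Measurable (f n)) (hg : ∀ n, Measurable (g n)) :
    MeasurableSet {x | ∀ᶠ n in atTop, f n x ≤ g n x} := by
  simp only [eventually_atTop]
  refine measurableSet_setOfPred.mpr (Measurable.exists fun N => Measurable.forall fun n =>
    Measurable.imp measurable_const ?_)
  exact measurableSet_setOfPred.mp (measurableSet_le (hf n) (hg n))

/-- Stationary measures are exact dimensional. -/
theorem hasExactDim_of_isStationary {μ : Measure G} [IsProbabilityMeasure μ]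
    (hfin : NoFiniteInvariant μ) (hinv : NoInvariantMeasure μ) (hμ : Integrable logN μ) {Λ : ℝ}
    (hmean : Tendsto (fun n : ℕ => meanLog μ n / n) atTop (𝓝 Λ)) (hΛ0 : 0 ≤ Λ) {ν : Measure RP}
    [IsProbabilityMeasure ν] (hst : IsStationary μ ν) :
    0 < Λ ∧ FurstenbergEntropyConverges μ ν ∧ HasExactDim ν (furstenbergEntropy μ ν / Λ) := by
  have hdiff := nullSingletonClass_of_isStationary hfin hst
  obtain ⟨Z, hZ⟩ := exists_isBoundary hst (hinv ν inferInstance hdiff)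
  have hΛ := ae_tendsto_logN_rp hfin hinv hμ hmean
  obtain ⟨hi, hconv, heq, hle, hlo⟩ := hZ.entropy hΛ0 hΛ
  -- The entropy is positive and at most Λ, so the exponent is positive without a separate argument.
  have hpos : 0 < Λ := (furstenbergEntropy_pos hinv hconv).trans_le hle
  refine ⟨hpos, hconv, ?_⟩
  have hup := fun (K : ℕ) (hK : 0 < K) => hZ.ae_eventually_le_logb_ball hμ hΛ0 hmean hΛ
    (hconv.1.mono fun A hA => hA.1) hi hK (t := (K + 1) * Λ - Λ / 4) (by linarith) (by linarith)
    (lt_add_one _)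
  rw [← heq] at hup
  have hm : ∀ r : ℝ, Measurable fun x => Real.logb 2 (ν (Metric.ball x r)).toReal := fun r =>
    measurable_logb_two.comp (measurable_measure_ball ν r).ennreal_toReal
  have h1 : ∀ᵐ x ∂ν, ∀ i : ℕ, ∀ᶠ n : ℕ in atTop,
      Real.logb 2 (ν (Metric.ball x (2 ^ (-(n * (Λ + 1 / ((i : ℝ) + 1))))))).toReal ≤
        n * -(furstenbergEntropy μ ν - 1 / ((i : ℝ) + 1)) := by
    refine ae_all_iff.mpr fun i => hZ.ae_of_ae_comp
      (measurableSet_eventually (fun n => hm _) fun n => measurable_const) ?_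
    have hi0 : 0 < 1 / ((i : ℝ) + 1) := Nat.one_div_pos_of_nat
    exact hlo _ _ (by linarith) (by linarith)
  have h2 : ∀ᵐ x ∂ν, ∀ K : ℕ, 0 < K → ∀ᶠ j : ℕ in atTop,
      j * -(K * furstenbergEntropy μ ν +
        ∫ p, Real.logb 2 (Dsup (push p.1 ν) ν 2 p.2).toReal ∂(skew μ ν) + 1) ≤
      Real.logb 2 (ν (Metric.ball x (2 ^ (-(j * ((K + 1) * Λ - Λ / 4)))))).toReal := by
    refine ae_all_iff.mpr fun K => ?_
    rcases Nat.eq_zero_or_pos K with rfl | hK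
    · exact ae_of_all _ fun x hx => absurd hx (lt_irrefl 0)
    · filter_upwards [hZ.ae_of_ae_comp (measurableSet_eventually (fun n => measurable_const)
        fun n => hm _) (hup K hK)] with x hx _ using hx
  filter_upwards [h1, h2, ae_measure_ball_ne_zero ν] with x e1 e2 e3
  refine hasLocalDim_of_tendsto e3 (tendsto_div_of_bounds
    (f := fun t => -Real.logb 2 (ν (Metric.ball x (2 ^ (-t)))).toReal)
    (I := ∫ p, Real.logb 2 (Dsup (push p.1 ν) ν 2 p.2).toReal ∂(skew μ ν)) ?_ hpos ?_ ?_)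
  · intro t t' htt
    refine neg_le_neg (Real.logb_le_logb_of_le one_lt_two
      (ENNReal.toReal_pos (e3 _ (by positivity)) (measure_ne_top _ _))
      (ENNReal.toReal_mono (measure_ne_top _ _) (measure_mono (Metric.ball_subset_ball ?_))))
    exact Real.rpow_le_rpow_of_exponent_le one_le_two (by linarith)
  · intro i
    filter_upwards [e1 i] with n hn
    linarith
  · intro K hK
    filter_upwards [e2 K hK] with n hn
    linarith

end FurstenbergDim

end

/-! ### Lyapunov exponent, entropy and dimension together -/

open FurstenbergDim in
theorem theorem3p4 (μ : Measure G) [IsProbabilityMeasure μ]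
    (hunbounded : IsUnbounded (generatedGroup μ))
    (hirreducible : IsTotallyIrreducible (generatedGroup μ))
    (hmoment : Integrable (fun A : G => Real.logb 2 (opNorm A)) μ) :
    ∃ χ : ℝ, 0 < χ ∧ IsLyapunovExponent μ χ ∧
      ∀ ν : Measure RP, IsProbabilityMeasure ν → IsStationary μ ν →
        FurstenbergEntropyConverges μ ν ∧
        HasExactDim ν (furstenbergEntropy μ ν / (2 * Real.logb 2 ((2 : ℝ) ^ χ))) := by
  have hfin := noFiniteInvariant_of_isTotallyIrreducible hirreducible
  have hinv := noInvariantMeasure_of_isUnbounded hunbounded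
  have hμ := integrable_logN hmoment
  obtain ⟨Λ, hΛ0, hΛ⟩ := exists_tendsto_meanLog hμ
  have key := fun (ν : Measure RP) (_ : IsProbabilityMeasure ν) (hst : IsStationary μ ν) =>
    hasExactDim_of_isStationary hfin hinv hμ hΛ hΛ0 hst
  -- Positivity of Λ is obtained through a stationary measure, so one must be produced before χ is
  -- named.
  obtain ⟨ν₀, h₀, hst₀⟩ := exists_isStationary μ
  refine ⟨Λ / 2, half_pos (key ν₀ h₀ hst₀).1, isLyapunovExponent_of_tendsto hfin hinv hμ hΛ,
    fun ν hν hst => ⟨(key ν hν hst).2.1, ?_⟩⟩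
  rw [Real.logb_rpow two_pos one_lt_two.ne', mul_div_cancel₀ Λ two_ne_zero]
  exact (key ν hν hst).2.2
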